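/- For a free group $F_n$ with basis $a_1,\dots,a_n$, a finitely generated subgroup $H\le F_n$ and an element $g\in F_n$, let $\mathfrak I_g$ be the kernel of the homomorphism $\varphi_g\colon H*\langle x\rangle\to F_n$ that is the inclusion on $H$ and sends $x$ to $g$, where $\langle x\rangle$ is infinite cyclic. The elements of $\mathfrak I_g$ are called equations for $g$ with coefficients in $H$. The degree of an equation is the number of occurrences of $x$ and $x^{-1}$ in its cyclic reduction, written as a word in a basis $h_1,\dots,h_r$ of $H$ and $x$ and their inverses. There is a single algorithm for a random access machine with unit cost operations (addition, truncated subtraction and multiplication of natural numbers of any size, memory access, tests) that does the following. Its input consists of $n$, $r$ and the reduced words in $a_1^{\pm1},\dots,a_n^{\pm1}$ that represent $h_1,\dots,h_r$ and $g$, where $h_1,\dots,h_r$ is a basis of a subgroup $H\le F_n$ and $g\in F_n$. If $\mathfrak I_g$ contains a non-trivial equation, then the algorithm outputs the minimum degree of a non-trivial equation in $\mathfrak I_g$; otherwise it outputs $0$ (which is never the degree of a non-trivial equation in $\mathfrak I_g$). Its running time is $O(nr^9L^3\log(nrL))$, where $L$ is the maximum of the lengths of the input words $h_1,\dots,h_r,g$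 and the implied constant is absolute; in this bound, to cover degenerate inputs, each of $n,r,L$ is understood as its maximum with $1$ and $\log(nrL)$ as $\log(nrL+1)$. -/

import Mathlib

open scoped Monoid.Coprod

/-! ### Random access machine with unit cost arithmetic

The work memory is a map `ℕ → ℕ` (all cells initially `0`), the input is a read-only finite
sequence of natural numbers with random access. -/

/-- Expressions of the random access machine. -/
inductive RamExpr : Type
  /-- a constant -/
  | lit : ℕ → RamExpr
  /-- the content of the work memory cell with the given (computed) address -/
  | get : RamExpr → RamExpr
  /-- the entry of the input with the given (computed) index, `0` beyond the end of the input -/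
  | inp : RamExpr → RamExpr
  | add : RamExpr → RamExpr → RamExpr
  /-- truncated subtraction -/
  | sub : RamExpr → RamExpr → RamExpr
  | mul : RamExpr → RamExpr → RamExpr

/-- The value of an expression, for a given input and a given content of the memory. -/
def RamExpr.eval (input : List ℕ) (mem : ℕ → ℕ) : RamExpr → ℕ
  | .lit k => k
  | .get a => mem (a.eval input mem)
  | .inp a => input.getD (a.eval input mem) 0
  | .add a b => a.eval input mem + b.eval input mem
  | .sub a b => a.eval input mem - b.eval input mem
  | .mul a b => a.eval input mem * b.eval input mem

/-- The time to evaluate an expression: each constant, each memory or input access and each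
arithmetic operation in it costs one unit. -/
def RamExpr.cost : RamExpr → ℕ
  | .lit _ => 1
  | .get a => a.cost + 1
  | .inp a => a.cost + 1
  | .add a b => a.cost + b.cost + 1
  | .sub a b => a.cost + b.cost + 1
  | .mul a b => a.cost + b.cost + 1

/-- Programs of the random access machine. -/
inductive RamProg : Type
  | skip : RamProg
  /-- `store a e`: write the value of `e` into the memory cell whose address is the value
  of `a` -/
  | store : RamExpr → RamExpr → RamProg
  /-- sequential composition -/
  | seq : RamProg → RamProg → RamProg
  /-- `cond e p q`: if the value of `e` is nonzero run `p`, otherwise run `q` -/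
  | cond : RamExpr → RamProg → RamProg → RamProg
  /-- `loop e p`: while the value of `e` is nonzero, run `p` -/
  | loop : RamExpr → RamProg → RamProg

/-- `RamProg.Runs input p mem t mem'`: started with memory content `mem`, the program `p` halts
after exactly `t` units of time, with memory content `mem'`. Every store and every test costs one
unit plus the cost of the expressions in it. -/
inductive RamProg.Runs (input : List ℕ) : RamProg → (ℕ → ℕ) → ℕ → (ℕ → ℕ) → Prop
  | skip (mem : ℕ → ℕ) : Runs input .skip mem 1 mem
  | store (a e : RamExpr) (mem : ℕ → ℕ) :
      Runs input (.store a e) mem (a.cost + e.cost + 1)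
        (Function.update mem (a.eval input mem) (e.eval input mem))
  | seq {p q : RamProg} {mem mem' mem'' : ℕ → ℕ} {s t : ℕ} :
      Runs input p mem s mem' → Runs input q mem' t mem'' →
      Runs input (.seq p q) mem (s + t) mem''
  | cond_pos {e : RamExpr} {p q : RamProg} {mem mem' : ℕ → ℕ} {t : ℕ} :
      e.eval input mem ≠ 0 → Runs input p mem t mem' →
      Runs input (.cond e p q) mem (e.cost + 1 + t) mem'
  | cond_zero {e : RamExpr} {p q : RamProg} {mem mem' : ℕ → ℕ} {t : ℕ} :
      e.eval input mem = 0 → Runs input q mem t mem' →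
      Runs input (.cond e p q) mem (e.cost + 1 + t) mem'
  | loop_zero {e : RamExpr} {p : RamProg} {mem : ℕ → ℕ} :
      e.eval input mem = 0 → Runs input (.loop e p) mem (e.cost + 1) mem
  | loop_pos {e : RamExpr} {p : RamProg} {mem mem' mem'' : ℕ → ℕ} {s t : ℕ} :
      e.eval input mem ≠ 0 → Runs input p mem s mem' → Runs input (.loop e p) mem' t mem'' →
      Runs input (.loop e p) mem (e.cost + 1 + s + t) mem''

/-- On the given input, the program `p` halts after exactly `t` units of time with output `out`,
which is found in the memory cell `0`. -/
def RamProg.Computes (p : RamProg) (input : List ℕ) (t out : ℕ) : Prop :=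
  ∃ mem : ℕ → ℕ, p.Runs input (fun _ => 0) t mem ∧ mem 0 = out

/-! ### Equations over a subgroup of a free group -/

/-- The evaluation homomorphism `H * ⟨x⟩ → F` that is the inclusion on `H` and sends `x` to `g`.
The infinite cyclic group `⟨x⟩` is `Multiplicative ℤ`, with `x = Multiplicative.ofAdd 1`. -/
def evalEquation {F : Type*} [Group F] (H : Subgroup F) (g : F) :
    H ∗ Multiplicative ℤ →* F :=
  Monoid.Coprod.lift H.subtype (zpowersHom F g)

/-- The ideal of the equations for `g` with coefficients in `H`. -/
def equationIdeal {F : Type*} [Group F] (H : Subgroup F) (g : F) :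
    Subgroup (H ∗ Multiplicative ℤ) :=
  (evalEquation H g).ker

/-- The isomorphism from `H * ⟨x⟩` to the free group on `h₁, …, h_r, x`, where `h₁, …, h_r` is a
basis of `H`; the generator `x` is indexed by `none`. -/
def equationToFree {F : Type*} [Group F] {H : Subgroup F} {r : ℕ}
    (h : FreeGroupBasis (Fin r) H) : H ∗ Multiplicative ℤ →* FreeGroup (Option (Fin r)) :=
  Monoid.Coprod.lift ((FreeGroup.map some).comp h.repr.toMonoidHom)
    (zpowersHom (FreeGroup (Option (Fin r))) (FreeGroup.of none))

/-- The degree of an equation: the number of occurrences of `x` and `x⁻¹` in its cyclic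
reduction, as a word in a basis of `H` and `x`. -/
def equationDegree {F : Type*} [Group F] {H : Subgroup F} {r : ℕ}
    (h : FreeGroupBasis (Fin r) H) (w : H ∗ Multiplicative ℤ) : ℕ :=
  (FreeGroup.reduceCyclically (equationToFree h w).toWord).countP (fun c => c.1 = none)

/-- The set of the degrees of the non-trivial equations for `g` with coefficients in `H`. -/
def equationDegrees {F : Type*} [Group F] {H : Subgroup F} {r : ℕ}
    (h : FreeGroupBasis (Fin r) H) (g : F) : Set ℕ :=
  {d | ∃ w ∈ equationIdeal H g, w ≠ 1 ∧ equationDegree h w = d}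

/-! ### The input of the algorithm -/

/-- The code of an element of the free group on `a₀, …, a_{n-1}`: the length of the reduced word
that represents it, followed by the letters of that word; `aᵢ` is coded by `2 * i` and
`aᵢ⁻¹` by `2 * i + 1`. -/
def encodeElement {n : ℕ} (u : FreeGroup (Fin n)) : List ℕ :=
  u.toWord.length :: u.toWord.map (fun c => 2 * (c.1 : ℕ) + if c.2 then 0 else 1)

/-- The input that describes `H` (through a basis `h₁, …, h_r`) and `g`: the numbers `n` and `r`,
followed by the codes of `h₁, …, h_r` and of `g`. -/
def encodeInstance {n r : ℕ} {H : Subgroup (FreeGroup (Fin n))}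
    (h : FreeGroupBasis (Fin r) H) (g : FreeGroup (Fin n)) : List ℕ :=
  n :: r :: ((List.ofFn fun i => encodeElement (h i : FreeGroup (Fin n))).flatten ++
    encodeElement g)

/-- The maximum of the lengths of the reduced words that represent `h₁, …, h_r` and `g`. -/
def maxLength {n r : ℕ} {H : Subgroup (FreeGroup (Fin n))}
    (h : FreeGroupBasis (Fin r) H) (g : FreeGroup (Fin n)) : ℕ :=
  max (Finset.univ.sup fun i => (h i : FreeGroup (Fin n)).norm) g.norm

/-- The bound `n r⁹ L³ log (nrL)`. To make sense of it if one of `n`, `r`, `L` is `0` or if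
`nrL = 1`, each of `n`, `r`, `L` is replaced by its maximum with `1`, and the argument of the
logarithm is increased by `1`. This does not change the order of magnitude: `nrL + 1 ≤ (nrL)²`
if `nrL ≥ 2`. -/
noncomputable def timeBound (n r L : ℕ) : ℝ :=
  (max n 1 : ℕ) * (max r 1 : ℕ) ^ 9 * (max L 1 : ℕ) ^ 3 *
    Real.log ((max n 1 * max r 1 * max L 1 : ℕ) + 1)

/-!
# The minimum degree of an equation over a subgroup of a free group

A cyclically reduced word is a subword of a conjugate, so the minimum degree of a non-trivial
equation is the minimum number of occurrences of `x^{±1}` in a non-empty reduced word in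
`h₁, …, h_r, x` that takes the value `1` for `x = g`
(`exists_word_of_mem_equationDegrees`, `exists_mem_equationDegrees_le`). Draw the words
`h₁, …, h_r, g` as the petals of a bouquet of `r + 1` circles with edges labelled by letters. The
reduced words in the petals are the closed edge paths at the base point without backtracking, and
backtracking can be recognized from two consecutive oriented edges. So the oriented edges, here
called states, form a directed graph, and one looks for a cheapest walk between two additional
states `0` and `1` at the base point that spells a word which reduces to the empty word
(`Petal.IsTable.bridge_iff`); the cost counts the passages through the petal of `g`. If `g = 1`,
this petal is empty, and the answer is `1`.

Let a bridge from `d` to `h` be a walk from `d` to `h` whose inner states spell a word with value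
`1`. In a non-empty word with value `1` the last letter `f` cancels with an earlier letter `e` such
that the words before `e` and between `e` and `f` have value `1`. Therefore a bridge from `d` to `h`
is a single step, or it consists of a bridge from `d` to `e`, a bridge from `e` to `f` and a step
from `f` to `h`, where `e` and `f` have inverse labels (`WalkTable.bridge_iff`). For such a system
of rules, Knuth's generalization of Dijkstra's algorithm finds the least costs: finish the pairs
of states in the order of their costs, and apply to each finished pair the rules in which it occurs
as a premise. Its invariant is `WalkTable.Search`.

There are `M = O(r L)` states and so at most `M²` rounds. To make a round cheap, the second rule is
split: `Z e h` is the least cost of the part of the walk from `e` on. A state has at most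
`D = O(r)` successors, so a finished pair changes at most `D` entries of `Z`, each of which affects
at most `M` pairs, and one more row of pairs. A cheapest unfinished pair is found in time `O(M)`
with the help of the minima of the rows. The total time is `O(n + D M³) = O(n + r⁴ L³)`, where the
summand `n` is for a table of the inverse letters (`Petal.run_minDegree`).

The statements on programs have the form `Run inp p m T Q`, with explicit time bounds `T` whose
constants are generous.
-/

/-! ### A program logic for the random access machine -/

/-- An injective coding of pairs of natural numbers that uses only machine operations. -/
def quadPair (x y : ℕ) : ℕ := (x + y) * (x + y) + x

theorem quadPair_inj {x y x' y' : ℕ} : quadPair x y = quadPair x' y' ↔ x = x' ∧ y = y' := by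
  constructor
  · intro h
    unfold quadPair at h
    have hs : x + y = x' + y' := by
      rcases lt_trichotomy (x + y) (x' + y') with hl | hl | hl
      · nlinarith
      · exact hl
      · nlinarith
    rw [hs] at h
    omega
  · rintro ⟨rfl, rfl⟩
    rfl

/-- The address of the entry `(a, b)` of the two-dimensional array number `k`. -/
def cellAddr (k a b : ℕ) : ℕ := quadPair k (quadPair a b)

/-- The entry `(a, b)` of the array number `k` in the memory `m`. One-dimensional arrays use only
the entries `(a, 0)`, scalar variables only the entry `(0, 0)`. -/
def cell (m : ℕ → ℕ) (k a b : ℕ) : ℕ := m (cellAddr k a b)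

/-- The memory `m` after the assignment of `v` to the entry `(a, b)` of the array number `k`. -/
def setCell (m : ℕ → ℕ) (k a b v : ℕ) : ℕ → ℕ := Function.update m (cellAddr k a b) v

theorem cell_setCell (m : ℕ → ℕ) (k a b v k' a' b' : ℕ) :
    cell (setCell m k a b v) k' a' b' =
      if k' = k ∧ a' = a ∧ b' = b then v else cell m k' a' b' := by
  simp only [cell, setCell, Function.update_apply, cellAddr, quadPair_inj]

/-- The expression for `quadPair`. -/
def RamExpr.pairE (x y : RamExpr) : RamExpr := .add (.mul (.add x y) (.add x y)) x

/-- The expression for `cellAddr`. -/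
def RamExpr.addrE (k : ℕ) (a b : RamExpr) : RamExpr := .pairE (.lit k) (.pairE a b)

/-- The expression for an array entry. -/
def RamExpr.rd (k : ℕ) (a b : RamExpr) : RamExpr := .get (.addrE k a b)

/-- The expression for an entry of a one-dimensional array. -/
abbrev RamExpr.rd1 (k : ℕ) (a : RamExpr) : RamExpr := .rd k a (.lit 0)

/-- The expression for a scalar variable. -/
def RamExpr.var (k : ℕ) : RamExpr := .get (.lit (cellAddr k 0 0))

/-- Assignment to an array entry. -/
def RamProg.wr (k : ℕ) (a b e : RamExpr) : RamProg := .store (.addrE k a b) e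

/-- Assignment to an entry of a one-dimensional array. -/
abbrev RamProg.wr1 (k : ℕ) (a e : RamExpr) : RamProg := .wr k a (.lit 0) e

/-- Assignment to a scalar variable. -/
def RamProg.set (k : ℕ) (e : RamExpr) : RamProg := .store (.lit (cellAddr k 0 0)) e

@[simp] theorem RamExpr.eval_rd (inp : List ℕ) (m : ℕ → ℕ) (k : ℕ) (a b : RamExpr) :
    (RamExpr.rd k a b).eval inp m = cell m k (a.eval inp m) (b.eval inp m) := rfl

@[simp] theorem RamExpr.eval_var (inp : List ℕ) (m : ℕ → ℕ) (k : ℕ) :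
    (RamExpr.var k).eval inp m = cell m k 0 0 := rfl

/-- The effect of a program without loops on the memory (a loop is not executed at all). -/
def RamProg.exec (inp : List ℕ) : RamProg → (ℕ → ℕ) → (ℕ → ℕ)
  | .skip, m => m
  | .store a e, m => Function.update m (a.eval inp m) (e.eval inp m)
  | .seq p q, m => q.exec inp (p.exec inp m)
  | .cond e p q, m => if e.eval inp m = 0 then q.exec inp m else p.exec inp m
  | .loop _ _, m => m

/-- An upper bound for the running time of a program without loops. -/
def RamProg.wcet : RamProg → ℕ
  | .skip => 1
  | .store a e => a.cost + e.cost + 1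
  | .seq p q => p.wcet + q.wcet
  | .cond e p q => e.cost + 1 + (p.wcet + q.wcet)
  | .loop _ _ => 0

/-- Whether a program contains no loops. -/
def RamProg.loopFree : RamProg → Bool
  | .skip => true
  | .store _ _ => true
  | .seq p q => p.loopFree && q.loopFree
  | .cond _ p q => p.loopFree && q.loopFree
  | .loop _ _ => false

@[simp] theorem RamProg.exec_wr (inp : List ℕ) (m : ℕ → ℕ) (k : ℕ) (a b e : RamExpr) :
    (RamProg.wr k a b e).exec inp m =
      setCell m k (a.eval inp m) (b.eval inp m) (e.eval inp m) := rfl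

@[simp] theorem RamProg.exec_set (inp : List ℕ) (m : ℕ → ℕ) (k : ℕ) (e : RamExpr) :
    (RamProg.set k e).exec inp m = setCell m k 0 0 (e.eval inp m) := rfl

/-- Total correctness with a time bound: started with memory `m`, the program `p` halts within
`T` units of time, in a memory that satisfies `Q`. -/
def Run (inp : List ℕ) (p : RamProg) (m : ℕ → ℕ) (T : ℕ) (Q : (ℕ → ℕ) → Prop) : Prop :=
  ∃ t m', t ≤ T ∧ p.Runs inp m t m' ∧ Q m'

theorem Run.mono {inp p m T T'} {Q Q' : (ℕ → ℕ) → Prop} (h : Run inp p m T Q) (hT : T ≤ T')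
    (hQ : ∀ m', Q m' → Q' m') : Run inp p m T' Q' := by
  obtain ⟨t, m', ht, hr, hq⟩ := h
  exact ⟨t, m', ht.trans hT, hr, hQ _ hq⟩

theorem RamProg.runs_exec (inp : List ℕ) (p : RamProg) (hp : p.loopFree = true) (m : ℕ → ℕ) :
    ∃ t ≤ p.wcet, p.Runs inp m t (p.exec inp m) := by
  induction p generalizing m with
  | skip => exact ⟨1, le_rfl, .skip m⟩
  | store a e => exact ⟨_, le_rfl, .store a e m⟩
  | seq p q ihp ihq =>
    simp only [loopFree, Bool.and_eq_true] at hp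
    obtain ⟨s, hs, h1⟩ := ihp hp.1 m
    obtain ⟨t, ht, h2⟩ := ihq hp.2 (p.exec inp m)
    exact ⟨s + t, add_le_add hs ht, .seq h1 h2⟩
  | cond e p q ihp ihq =>
    simp only [loopFree, Bool.and_eq_true] at hp
    simp only [exec, wcet]
    split_ifs with he
    · obtain ⟨t, ht, h2⟩ := ihq hp.2 m
      exact ⟨_, by omega, .cond_zero he h2⟩
    · obtain ⟨t, ht, h2⟩ := ihp hp.1 m
      exact ⟨_, by omega, .cond_pos he h2⟩
  | loop e p => simp [loopFree] at hp

theorem Run.of_exec {inp : List ℕ} {p : RamProg} {m : ℕ → ℕ} {T : ℕ} {Q : (ℕ → ℕ) → Prop}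
    (hp : p.loopFree = true) (hT : p.wcet ≤ T) (hQ : Q (p.exec inp m)) : Run inp p m T Q := by
  obtain ⟨t, ht, h⟩ := p.runs_exec inp hp m
  exact ⟨t, _, ht.trans hT, h, hQ⟩

theorem Run.seq {inp p q m T₁ T₂} {Q : (ℕ → ℕ) → Prop}
    (h : Run inp p m T₁ (fun m' => Run inp q m' T₂ Q)) :
    Run inp (.seq p q) m (T₁ + T₂) Q := by
  obtain ⟨s, m', hs, h1, t, m'', ht, h2, hQ⟩ := h
  exact ⟨s + t, m'', add_le_add hs ht, .seq h1 h2, hQ⟩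

theorem Run.cond {inp e p q m T} {Q : (ℕ → ℕ) → Prop}
    (h1 : e.eval inp m ≠ 0 → Run inp p m T Q) (h0 : e.eval inp m = 0 → Run inp q m T Q) :
    Run inp (.cond e p q) m (e.cost + 1 + T) Q := by
  by_cases he : e.eval inp m = 0
  · obtain ⟨t, m', ht, hr, hq⟩ := h0 he
    exact ⟨_, m', by omega, .cond_zero he hr, hq⟩
  · obtain ⟨t, m', ht, hr, hq⟩ := h1 he
    exact ⟨_, m', by omega, .cond_pos he hr, hq⟩

/-- `forLoop v b p` runs `p` with the variable `v` equal to `0, 1, …, B - 1`, where `B` is the value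
of the variable `b`. -/
def RamProg.forLoop (v b : ℕ) (p : RamProg) : RamProg :=
  .seq (.set v (.lit 0))
    (.loop (.sub (.var b) (.var v)) (.seq p (.set v (.add (.var v) (.lit 1)))))

/-- The rule for loops, with an invariant `I`. The time for the test and for the increment of the
variable amounts to `12` units for each round, and the time outside of the rounds to `9` units. -/
theorem Run.forLoop {inp : List ℕ} {v b : ℕ} {p : RamProg} {m : ℕ → ℕ} (N : ℕ) (T : ℕ → ℕ)
    (I : ℕ → (ℕ → ℕ) → Prop)
    (h0 : I 0 (setCell m v 0 0 0))
    (hI : ∀ i m, I i m → cell m v 0 0 = i ∧ cell m b 0 0 = N)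
    (hs : ∀ i m, i < N → I i m → Run inp p m (T i)
      (fun m' => cell m' v 0 0 = i ∧ I (i + 1) (setCell m' v 0 0 (i + 1)))) :
    Run inp (.forLoop v b p) m (∑ i ∈ Finset.range N, (T i + 12) + 9) (I N) := by
  have key : ∀ k i m, i + k = N → I i m →
      Run inp (.loop (.sub (.var b) (.var v)) (.seq p (.set v (.add (.var v) (.lit 1))))) m
        (∑ i ∈ Finset.Ico i N, (T i + 12) + 6) (I N) := by
    intro k
    induction k with
    | zero =>
      intro i m hi h
      obtain rfl : i = N := by omega
      obtain ⟨h1, h2⟩ := hI _ _ h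
      exact ⟨_, m, by simp [RamExpr.cost, RamExpr.var], .loop_zero (by simp [RamExpr.eval, h1, h2]),
        h⟩
    | succ k ih =>
      intro i m hi h
      obtain ⟨h1, h2⟩ := hI _ _ h
      obtain ⟨s, m', hs', hr, hv, hi'⟩ := hs i m (by omega) h
      have hr2 : (RamProg.set v (.add (.var v) (.lit 1))).Runs inp m' 6
          (setCell m' v 0 0 (i + 1)) := by
        have := RamProg.Runs.store (input := inp) (.lit (cellAddr v 0 0))
          (.add (.var v) (.lit 1)) m'
        have hv' : m' (cellAddr v 0 0) = i := hv
        simpa [RamExpr.eval, hv', RamExpr.cost, RamExpr.var, setCell, RamProg.set] using this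
      obtain ⟨t, m'', ht, hr3, hq⟩ := ih (i + 1) _ (by omega) hi'
      refine ⟨_, m'', ?_, .loop_pos (by simp [RamExpr.eval, h1, h2]; omega) (.seq hr hr2) hr3, hq⟩
      rw [Finset.sum_eq_sum_Ico_succ_bot (by omega)]
      simp only [RamExpr.cost, RamExpr.var]
      omega
  obtain ⟨t, m', ht, hr, hq⟩ := key N 0 _ (by omega) h0
  refine ⟨_, m', ?_, .seq (.store _ _ _) hr, hq⟩
  simp only [RamExpr.cost, Finset.range_eq_Ico]
  omega

/-- A `forLoop` whose body has a uniform time bound. -/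
theorem Run.forLoop_const {inp : List ℕ} {v b : ℕ} {p : RamProg} {m : ℕ → ℕ} (N T : ℕ)
    (I : ℕ → (ℕ → ℕ) → Prop)
    (h0 : I 0 (setCell m v 0 0 0))
    (hI : ∀ i m, I i m → cell m v 0 0 = i ∧ cell m b 0 0 = N)
    (hs : ∀ i m, i < N → I i m → Run inp p m T
      (fun m' => cell m' v 0 0 = i ∧ I (i + 1) (setCell m' v 0 0 (i + 1)))) :
    Run inp (.forLoop v b p) m (N * (T + 12) + 9) (I N) := by
  simpa using Run.forLoop N (fun _ => T) I h0 hI hs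

/-- The memories `m` and `m'` differ at most in the arrays whose numbers are in `K`. -/
def Frame (K : List ℕ) (m m' : ℕ → ℕ) : Prop := ∀ k ∉ K, ∀ a b, cell m' k a b = cell m k a b

theorem Frame.refl (K : List ℕ) (m : ℕ → ℕ) : Frame K m m := fun _ _ _ _ => rfl

theorem Frame.trans {K m m' m''} (h : Frame K m m') (h' : Frame K m' m'') : Frame K m m'' :=
  fun k hk a b => (h' k hk a b).trans (h k hk a b)

theorem Frame.mono {K K' m m'} (h : Frame K m m') (hK : K ⊆ K') : Frame K' m m' :=
  fun k hk a b => h k (fun h' => hk (hK h')) a b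

theorem Frame.setCell {K m m' k} (h : Frame K m m') (hk : k ∈ K) (a b v : ℕ) :
    Frame K m (setCell m' k a b v) := by
  intro k' hk' a' b'
  rw [cell_setCell, if_neg, h k' hk']
  rintro ⟨rfl, -⟩
  exact hk' hk

/-! ### Walks with cancelling labels -/

/-- A finite directed graph on the states `s < M` with labels and costs, given by tables. From an
exit state `s` (`ex s ≠ 0`) one can step to all entry states (`en t ≠ 0`) other than `rev s`, from
every other state `s` only to `nxt s`. The label `0` stands for the absence of a label, and the
label of `rev s` is the inverse of the label of `s`. -/
structure WalkTable where
  /-- the number of states -/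
  M : ℕ
  /-- the labels -/
  lab : ℕ → ℕ
  /-- the indicator of the entry states -/
  en : ℕ → ℕ
  /-- the indicator of the exit states -/
  ex : ℕ → ℕ
  /-- the states with the reverse orientation -/
  rev : ℕ → ℕ
  /-- the successors of the states that are not exit states -/
  nxt : ℕ → ℕ
  /-- the costs -/
  cst : ℕ → ℕ

namespace WalkTable

/-- There is an edge from the state `s` to the state `t`. -/
def Step (A : WalkTable) (s t : ℕ) : Prop :=
  s < A.M ∧ t < A.M ∧ if A.ex s ≠ 0 then A.en t ≠ 0 ∧ t ≠ A.rev s else t = A.nxt s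

/-- The states `s` and `t` are labelled, and their labels are inverse to each other. -/
def Cancel (A : WalkTable) (s t : ℕ) : Prop := A.lab s ≠ 0 ∧ A.lab t = A.lab (A.rev s)

/-- `A.Bridge d h w` says that there is a walk from `d` to `h` whose inner states spell a word that
reduces to the empty word, and that these inner states have total cost `w`. In a non-empty word of
this kind the last letter cancels with some earlier one; this is the second rule. -/
inductive Bridge (A : WalkTable) : ℕ → ℕ → ℕ → Prop
  | step {d h : ℕ} : A.Step d h → Bridge A d h 0
  | app {d e f h w₁ w₂ : ℕ} : Bridge A d e w₁ → Bridge A e f w₂ → A.Cancel e f → A.Step f h →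
      Bridge A d h (w₁ + w₂ + (A.cst e + A.cst f))

theorem Bridge.lt {A : WalkTable} {d h w : ℕ} (H : A.Bridge d h w) : d < A.M ∧ h < A.M := by
  induction H with
  | step h => exact ⟨h.1, h.2.1⟩
  | app _ _ _ h ih _ => exact ⟨ih.1, h.2.1⟩

/-! ### Shortest bridges: the invariant of the search -/

/-- The invariant of a search for cheapest bridges in the manner of Dijkstra and Knuth. `W d h` is
the least cost found so far of a bridge from `d` to `h`, and `Z e h` that of a walk from `e` to `h`
that consists of `e`, a bridge from `e` to a state that cancels `e`, this state, and a step to `h`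
(the cost of `e` included). The pairs in `F` are finished, and `R d` is the minimum of `W d h` over
the unfinished pairs `(d, h)`. The value `μ` separates the finished pairs from the others. All
consequences of the pairs in `F₀` have been taken into account. -/
structure Search (A : WalkTable) (W Z : ℕ → ℕ → ℕ∞) (F F₀ : ℕ → ℕ → Prop) (R : ℕ → ℕ∞)
    (μ : ℕ∞) : Prop where
  soundW : ∀ (d h w : ℕ), W d h = w → A.Bridge d h w
  soundZ : ∀ (e h z : ℕ), Z e h = z → ∃ f w : ℕ, A.Bridge e f w ∧ A.Cancel e f ∧ A.Step f h ∧
    z = w + (A.cst e + A.cst f)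
  base : ∀ d h, A.Step d h → W d h = 0
  closedW : ∀ d e h, F₀ d e → W d h ≤ W d e + Z e h
  closedZ : ∀ e f h, F₀ e f → A.Cancel e f → A.Step f h →
    Z e h ≤ W e f + ((A.cst e + A.cst f : ℕ) : ℕ∞)
  low : ∀ d h, F d h → W d h ≤ μ
  high : ∀ d h, ¬ F d h → μ ≤ W d h
  rowLe : ∀ d h, ¬ F d h → R d ≤ W d h
  rowEx : ∀ d, R d = ⊤ ∨ ∃ h, ¬ F d h ∧ W d h = R d
  sub : ∀ d h, F₀ d h → F d h

/-- The table of the costs after a bridge of cost `v` from `d` to `h` has been found. -/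
noncomputable def relaxW (W : ℕ → ℕ → ℕ∞) (d h : ℕ) (v : ℕ∞) (d' h' : ℕ) : ℕ∞ :=
  if d' = d ∧ h' = h then min (W d h) v else W d' h'

/-- The row minima after a bridge of cost `v` from `d` to `h` has been found. -/
noncomputable def relaxR (W : ℕ → ℕ → ℕ∞) (R : ℕ → ℕ∞) (d h : ℕ) (v : ℕ∞) (d' : ℕ) : ℕ∞ :=
  if d' = d ∧ v < W d h then min (R d) v else R d'

theorem relaxW_le (W : ℕ → ℕ → ℕ∞) (d h : ℕ) (v : ℕ∞) (d' h' : ℕ) :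
    relaxW W d h v d' h' ≤ W d' h' := by
  unfold relaxW
  split_ifs with h
  · rw [h.1, h.2]
    exact min_le_left _ _
  · exact le_rfl

theorem relaxW_self (W : ℕ → ℕ → ℕ∞) (d h : ℕ) (v : ℕ∞) : relaxW W d h v d h = min (W d h) v := by
  simp [relaxW]

namespace Search

variable {A : WalkTable} {W Z : ℕ → ℕ → ℕ∞} {F F₀ : ℕ → ℕ → Prop} {R : ℕ → ℕ∞} {μ : ℕ∞}

theorem lt_of_ne_top (S : Search A W Z F F₀ R μ) {d h : ℕ} (hd : W d h ≠ ⊤) :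
    d < A.M ∧ h < A.M := by
  lift W d h to ℕ using hd with w hw
  exact (S.soundW d h w hw.symm).lt

theorem lt_of_Z_ne_top (S : Search A W Z F F₀ R μ) {e h : ℕ} (hd : Z e h ≠ ⊤) : h < A.M := by
  lift Z e h to ℕ using hd with z hz
  obtain ⟨f, w, -, -, h, -⟩ := S.soundZ e h z hz.symm
  exact h.2.1

/-- Values of at least `μ` do not affect the finished pairs. -/
theorem relaxW_of_finished (S : Search A W Z F F₀ R μ) {d h : ℕ} {v : ℕ∞} (hv : μ ≤ v) {d' h' : ℕ}
    (hF : F d' h') : relaxW W d h v d' h' = W d' h' := by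
  unfold relaxW
  split_ifs with he
  · obtain ⟨rfl, rfl⟩ := he
    exact min_eq_left ((S.low _ _ hF).trans hv)
  · rfl

/-- A bridge of cost at least `μ` has been found. -/
theorem relax (S : Search A W Z F F₀ R μ) {d h : ℕ} {v : ℕ∞} (hv : μ ≤ v)
    (hb : ∀ w : ℕ, v = w → A.Bridge d h w) :
    Search A (relaxW W d h v) Z F F₀ (relaxR W R d h v) μ where
  soundW d' h' w hw := by
    unfold relaxW at hw
    split_ifs at hw with he
    · obtain ⟨rfl, rfl⟩ := he
      rcases min_choice (W d' h') v with h1 | h1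
      · exact S.soundW _ _ _ (h1 ▸ hw)
      · exact hb _ (h1 ▸ hw)
    · exact S.soundW _ _ _ hw
  soundZ := S.soundZ
  base d' h' hs := le_antisymm ((relaxW_le _ _ _ _ _ _).trans (S.base _ _ hs).le) (zero_le)
  closedW d' e h' hF := by
    rw [S.relaxW_of_finished hv (S.sub _ _ hF)]
    exact (relaxW_le _ _ _ _ _ _).trans (S.closedW _ _ _ hF)
  closedZ e f h' hF := by
    rw [S.relaxW_of_finished hv (S.sub _ _ hF)]
    exact S.closedZ _ _ _ hF
  low d' h' hF := (relaxW_le _ _ _ _ _ _).trans (S.low _ _ hF)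
  high d' h' hF := by
    unfold relaxW
    split_ifs with he
    · obtain ⟨rfl, rfl⟩ := he
      exact le_min (S.high _ _ hF) hv
    · exact S.high _ _ hF
  rowLe d' h' hF := by
    unfold relaxW relaxR
    have h1 := S.rowLe _ _ hF
    by_cases hd : d' = d
    · subst hd
      by_cases hh : h' = h
      · subst hh
        by_cases hl : v < W d' h'
        · simp only [hl, and_self, if_true, hl.le, min_eq_right]
          exact min_le_right _ _
        · simp only [hl, and_false, if_false, and_self, if_true]
          exact le_min h1 (h1.trans (not_lt.1 hl))
      · simp only [hh, and_false, if_false, true_and]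
        split_ifs
        · exact (min_le_left _ _).trans h1
        · exact h1
    · simpa [hd] using h1
  rowEx d' := by
    unfold relaxW relaxR
    by_cases hd : d' = d
    · subst hd
      by_cases hl : v < W d' h
      · have hF : ¬ F d' h := fun hF => absurd (S.low _ _ hF) (not_le.2 (hv.trans_lt hl))
        rcases le_total v (R d') with hle | hle
        · exact .inr ⟨h, hF, by simp [hl, hl.le, hle]⟩
        · rcases S.rowEx d' with h1 | ⟨h2, hF2, h3⟩
          · exact .inr ⟨h, hF, by simp [hl, hl.le, h1]⟩
          · refine .inr ⟨h2, hF2, ?_⟩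
            by_cases hh : h2 = h
            · subst hh
              exact absurd (h3 ▸ hle) (not_le.2 hl)
            · simp [hh, hl, hle, h3]
      · have hmin : min (W d' h) v = W d' h := min_eq_left (not_lt.1 hl)
        have : ∀ h', (if h' = h then min (W d' h) v else W d' h') = W d' h' := by
          intro h'
          split_ifs with he
          · rw [hmin, he]
          · rfl
        simp only [hl, and_false, if_false, true_and, this]
        exact S.rowEx d'
    · simpa [hd] using S.rowEx d'
  sub := S.sub

/-- Once a pair with the least cost among the unfinished ones is finished, all values that are
found from it are at least as large, so that `W` is final on the finished pairs. -/
theorem finish (S : Search A W Z F F R μ) {a b : ℕ} {R' : ℕ → ℕ∞} {F' : ℕ → ℕ → Prop}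
    (hF' : ∀ d h, F' d h ↔ F d h ∨ (d = a ∧ h = b))
    (hab : ¬ F a b) (hW : W a b = R a) (hmin : ∀ d, d < A.M → R a ≤ R d)
    (hR : ∀ d, d ≠ a → R' d = R d) (hle : ∀ h, ¬ F' a h → R' a ≤ W a h)
    (hex : R' a = ⊤ ∨ ∃ h, ¬ F' a h ∧ W a h = R' a) :
    Search A W Z F' F R' (W a b) where
  soundW := S.soundW
  soundZ := S.soundZ
  base := S.base
  closedW := S.closedW
  closedZ := S.closedZ
  low d h hF := by
    rcases (hF' d h).1 hF with hF | ⟨rfl, rfl⟩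
    · exact (S.low _ _ hF).trans (S.high _ _ hab)
    · exact le_rfl
  high d h hF := by
    by_cases ht : W d h = ⊤
    · simp [ht]
    rw [hW]
    exact (hmin d (S.lt_of_ne_top ht).1).trans
      (S.rowLe _ _ fun h1 => hF ((hF' d h).2 (.inl h1)))
  rowLe d h hF := by
    by_cases hd : d = a
    · subst hd
      exact hle h hF
    · rw [hR d hd]
      exact S.rowLe _ _ fun h1 => hF ((hF' d h).2 (.inl h1))
  rowEx d := by
    by_cases hd : d = a
    · subst hd
      exact hex
    · rw [hR d hd]
      rcases S.rowEx d with h1 | ⟨h, h1, h2⟩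
      · exact .inl h1
      · refine .inr ⟨h, fun h3 => ?_, h2⟩
        rcases (hF' d h).1 h3 with h3 | h3
        · exact h1 h3
        · exact hd h3.1
  sub d h hF := (hF' d h).2 (.inl hF)

/-- A cheaper walk for `Z a h` has been found, and its combinations with the bridges to `a` have
been taken into account. -/
theorem relaxZ (S : Search A W Z F F₀ R μ) {a h : ℕ} {v : ℕ∞} {Z' : ℕ → ℕ → ℕ∞}
    (hZ' : ∀ e h', Z' e h' = if e = a ∧ h' = h then min (Z a h) v else Z e h')
    (hv : ∀ z : ℕ, v = z → ∃ f w : ℕ, A.Bridge a f w ∧ A.Cancel a f ∧ A.Step f h ∧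
      z = w + (A.cst a + A.cst f))
    (hW : ∀ d, F₀ d a → W d h ≤ W d a + v) :
    Search A W Z' F F₀ R μ where
  soundW := S.soundW
  soundZ e h' z hz := by
    rw [hZ'] at hz
    split_ifs at hz with he
    · obtain ⟨rfl, rfl⟩ := he
      rcases min_choice (Z e h') v with h1 | h1
      · exact S.soundZ _ _ _ (h1 ▸ hz)
      · exact hv _ (h1 ▸ hz)
    · exact S.soundZ _ _ _ hz
  base := S.base
  closedW d e h' hF := by
    rw [hZ']
    split_ifs with he
    · obtain ⟨rfl, rfl⟩ := he
      rcases min_choice (Z e h') v with h1 | h1 <;> rw [h1]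
      · exact S.closedW _ _ _ hF
      · exact hW _ hF
    · exact S.closedW _ _ _ hF
  closedZ e f h' hF hc hs := by
    rw [hZ']
    have := S.closedZ _ _ _ hF hc hs
    split_ifs with he
    · obtain ⟨rfl, rfl⟩ := he
      exact (min_le_left _ _).trans this
    · exact this
  low := S.low
  high := S.high
  rowLe := S.rowLe
  rowEx := S.rowEx
  sub := S.sub

/-- All consequences of the finished pair `(a, b)` have been taken into account. -/
theorem close (S : Search A W Z F F₀ R μ) {a b : ℕ}
    (hF : ∀ d h, F d h → F₀ d h ∨ (d = a ∧ h = b))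
    (hW : ∀ h, W a h ≤ W a b + Z b h)
    (hZ : ∀ h, A.Cancel a b → A.Step b h → Z a h ≤ W a b + ((A.cst a + A.cst b : ℕ) : ℕ∞)) :
    Search A W Z F F R μ where
  soundW := S.soundW
  soundZ := S.soundZ
  base := S.base
  closedW d e h h1 := by
    rcases hF _ _ h1 with h1 | ⟨rfl, rfl⟩
    · exact S.closedW _ _ _ h1
    · exact hW h
  closedZ e f h h1 hc hs := by
    rcases hF _ _ h1 with h1 | ⟨rfl, rfl⟩
    · exact S.closedZ _ _ _ h1 hc hs
    · exact hZ h hc hs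
  low := S.low
  high := S.high
  rowLe := S.rowLe
  rowEx := S.rowEx
  sub _ _ h := h

theorem le_of_bridge (S : Search A W Z F F R μ) (hF : ∀ d h, ¬ F d h → W d h = ⊤) {d h w : ℕ}
    (H : A.Bridge d h w) : W d h ≤ w := by
  induction H with
  | step hs => simp [S.base _ _ hs]
  | @app d e f h w₁ w₂ _ _ hc hs ih1 ih2 =>
    have fin : ∀ {d h w : ℕ}, W d h ≤ w → F d h := by
      intro d h w hw
      by_contra hn
      rw [hF _ _ hn] at hw
      exact absurd hw (by simp)
    calc W d h ≤ W d e + Z e h := S.closedW _ _ _ (fin ih1)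
      _ ≤ w₁ + (w₂ + ((A.cst e + A.cst f : ℕ) : ℕ∞)) :=
        add_le_add ih1 ((S.closedZ _ _ _ (fin ih2) hc hs).trans (add_le_add ih2 le_rfl))
      _ = _ := by push_cast; ring

/-- At the end of the search, the value of a pair is the least cost of a bridge. -/
theorem isLeast (S : Search A W Z F F R μ) (hF : ∀ d h, ¬ F d h → W d h = ⊤) (d h : ℕ) :
    (∀ w, A.Bridge d h w → W d h ≤ w) ∧ (∀ w : ℕ, W d h = w → A.Bridge d h w) :=
  ⟨fun _ => S.le_of_bridge hF, S.soundW d h⟩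

end Search

end WalkTable

/-! ### The search on the machine -/

namespace WalkTable

/-- A machine word `x` stands for infinity if it is `0`, and for `x - 1` otherwise. -/
noncomputable def dec (x : ℕ) : ℕ∞ := if x = 0 then ⊤ else ((x - 1 : ℕ) : ℕ∞)

theorem dec_zero : dec 0 = ⊤ := rfl

theorem dec_succ (x : ℕ) : dec (x + 1) = x := by simp [dec]

theorem dec_eq_top {x : ℕ} : dec x = ⊤ ↔ x = 0 := by
  unfold dec
  split_ifs with h <;> simp [h]

theorem dec_inj {x y : ℕ} : dec x = dec y ↔ x = y := by
  rcases x with _ | x <;> rcases y with _ | y <;> simp [dec_zero, dec_succ]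

theorem dec_lt_iff (x y : ℕ) : dec x < dec y ↔ x * ((y - x) + (1 - y)) ≠ 0 := by
  rcases x with _ | x <;> rcases y with _ | y <;> simp [dec_zero, dec_succ]
  omega

theorem dec_sum (x y : ℕ) :
    dec ((x + y - 1) * (1 - (1 - x * y))) = dec x + dec y := by
  rcases x with _ | x
  · simp [dec_zero]
  rcases y with _ | y
  · simp [dec_zero]
  have h1 : 1 - (1 - (x + 1) * (y + 1)) = 1 := by
    have : 0 < (x + 1) * (y + 1) := by positivity
    omega
  rw [h1, mul_one, show x + 1 + (y + 1) - 1 = (x + y) + 1 by omega, dec_succ, dec_succ, dec_succ]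
  push_cast
  rfl

theorem dec_add {x : ℕ} (hx : x ≠ 0) (c : ℕ) : dec (x + c) = dec x + c := by
  obtain ⟨x, rfl⟩ := Nat.exists_eq_succ_of_ne_zero hx
  rw [Nat.succ_eq_add_one, show x + 1 + c = (x + c) + 1 by omega, dec_succ, dec_succ]
  push_cast
  rfl

end WalkTable

namespace RamExpr

/-- An expression that is nonzero if and only if the values differ. -/
def neE (x y : RamExpr) : RamExpr := .add (.sub x y) (.sub y x)

/-- An expression that is nonzero if and only if the values agree. -/
def eqE (x y : RamExpr) : RamExpr := .sub (.lit 1) (neE x y)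

/-- An expression that is nonzero if and only if `x` is less than `y`, where `0` stands for
infinity. -/
def ltE (x y : RamExpr) : RamExpr := .mul x (.add (.sub y x) (.sub (.lit 1) y))

/-- The sum, where `0` stands for infinity and any other `x` for `x - 1`. -/
def sumE (x y : RamExpr) : RamExpr :=
  .mul (.sub (.add x y) (.lit 1)) (.sub (.lit 1) (.sub (.lit 1) (.mul x y)))

variable (inp : List ℕ) (m : ℕ → ℕ) (x y : RamExpr)

theorem eval_neE : (neE x y).eval inp m ≠ 0 ↔ x.eval inp m ≠ y.eval inp m := by
  simp only [neE, eval]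
  omega

theorem eval_eqE : (eqE x y).eval inp m ≠ 0 ↔ x.eval inp m = y.eval inp m := by
  simp only [eqE, neE, eval]
  omega

theorem eval_ltE : (ltE x y).eval inp m ≠ 0 ↔
    WalkTable.dec (x.eval inp m) < WalkTable.dec (y.eval inp m) := by
  simp only [ltE, eval, WalkTable.dec_lt_iff]

theorem dec_eval_sumE : WalkTable.dec ((sumE x y).eval inp m) =
    WalkTable.dec (x.eval inp m) + WalkTable.dec (y.eval inp m) := by
  simp only [sumE, eval, WalkTable.dec_sum]

end RamExpr

/-! The numbers of the variables and arrays of the program: `vX` is a variable, `tX` a table of a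
`WalkTable`, `aX` an array of the search. -/

local notation "vM" => 1
local notation "tLab" => 2
local notation "tEn" => 3
local notation "tEx" => 4
local notation "tRev" => 5
local notation "tNxt" => 6
local notation "tCst" => 7
local notation "aW" => 20
local notation "aZ" => 21
local notation "aF" => 22
local notation "aR" => 23
local notation "vIt" => 24
local notation "vMM" => 25
local notation "vA" => 26
local notation "vB" => 27
local notation "vD" => 28
local notation "vH" => 29
local notation "vC" => 30
local notation "vV" => 31

namespace WalkTable

open RamExpr RamProg

/-- The memory `m` holds the tables of `A`. -/
structure Stored (A : WalkTable) (m : ℕ → ℕ) : Prop where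
  M : cell m vM 0 0 = A.M
  lab : ∀ s, cell m tLab s 0 = A.lab s
  en : ∀ s, cell m tEn s 0 = A.en s
  ex : ∀ s, cell m tEx s 0 = A.ex s
  rev : ∀ s, cell m tRev s 0 = A.rev s
  nxt : ∀ s, cell m tNxt s 0 = A.nxt s
  cst : ∀ s, cell m tCst s 0 = A.cst s

theorem Stored.frame {A : WalkTable} {m m' : ℕ → ℕ} {K : List ℕ} (h : Stored A m)
    (hf : Frame K m m') (hK : ∀ k ∈ K, 20 ≤ k) : Stored A m' := by
  have key : ∀ k < 20, ∀ a b, cell m' k a b = cell m k a b :=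
    fun k hk a b => hf k (fun h1 => by have := hK k h1; omega) a b
  constructor
  · rw [key _ (by norm_num), h.M]
  all_goals intro s; rw [key _ (by norm_num)]
  exacts [h.lab s, h.en s, h.ex s, h.rev s, h.nxt s, h.cst s]

/-- The test for an edge. -/
def stepE (s t : RamExpr) : RamExpr :=
  .add (.mul (.rd1 tEx s) (.mul (.rd1 tEn t) (neE t (.rd1 tRev s))))
    (.mul (.sub (.lit 1) (.rd1 tEx s)) (eqE t (.rd1 tNxt s)))

/-- The test for cancelling states. -/
def cancelE (s t : RamExpr) : RamExpr :=
  .mul (.rd1 tLab s) (eqE (.rd1 tLab t) (.rd1 tLab (.rd1 tRev s)))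

theorem eval_stepE {A : WalkTable} {m : ℕ → ℕ} (h : Stored A m) (inp : List ℕ) (s t : RamExpr)
    (hs : s.eval inp m < A.M) (ht : t.eval inp m < A.M) :
    (stepE s t).eval inp m ≠ 0 ↔ A.Step (s.eval inp m) (t.eval inp m) := by
  simp only [stepE, RamExpr.eval, eval_rd, h.ex, h.en, Step, hs, ht, true_and]
  have h1 := eval_neE inp m t (.rd1 tRev s)
  have h2 := eval_eqE inp m t (.rd1 tNxt s)
  simp only [RamExpr.eval, eval_rd, h.rev, h.nxt] at h1 h2
  split_ifs with hx
  · rw [show 1 - A.ex (s.eval inp m) = 0 by omega, zero_mul, add_zero, mul_ne_zero_iff,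
      mul_ne_zero_iff, h1]
    simp [hx]
  · rw [not_not] at hx
    rw [hx, zero_mul, zero_add, Nat.sub_zero, one_mul, h2]

theorem eval_cancelE {A : WalkTable} {m : ℕ → ℕ} (h : Stored A m) (inp : List ℕ)
    (s t : RamExpr) :
    (cancelE s t).eval inp m ≠ 0 ↔ A.Cancel (s.eval inp m) (t.eval inp m) := by
  have h2 := eval_eqE inp m (.rd1 tLab t) (.rd1 tLab (.rd1 tRev s))
  simp only [RamExpr.eval, eval_rd, h.rev, h.lab] at h2
  simp only [cancelE, RamExpr.eval, eval_rd, h.lab, mul_ne_zero_iff, h2, Cancel]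

/-- The costs found so far. -/
noncomputable def decW (m : ℕ → ℕ) (d h : ℕ) : ℕ∞ := dec (cell m aW d h)

/-- The costs of the walks that can precede a bridge. -/
noncomputable def decZ (m : ℕ → ℕ) (e h : ℕ) : ℕ∞ := dec (cell m aZ e h)

/-- The row minima. -/
noncomputable def decR (m : ℕ → ℕ) (d : ℕ) : ℕ∞ := dec (cell m aR d 0)

/-- The finished pairs. -/
def Finished (m : ℕ → ℕ) (d h : ℕ) : Prop := cell m aF d h ≠ 0

/-- The search invariant for the content of the memory. -/
def SearchAt (A : WalkTable) (m : ℕ → ℕ) (F₀ : ℕ → ℕ → Prop) (μ : ℕ∞) : Prop :=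
  Search A (decW m) (decZ m) (Finished m) F₀ (decR m) μ

theorem decW_frame {K m m'} (h : Frame K m m') (hK : aW ∉ K) : decW m' = decW m := by
  funext d e
  rw [decW, h _ hK, decW]

theorem decZ_frame {K m m'} (h : Frame K m m') (hK : aZ ∉ K) : decZ m' = decZ m := by
  funext d e
  rw [decZ, h _ hK, decZ]

theorem decR_frame {K m m'} (h : Frame K m m') (hK : aR ∉ K) : decR m' = decR m := by
  funext d
  rw [decR, h _ hK, decR]

theorem Finished_frame {K m m'} (h : Frame K m m') (hK : aF ∉ K) : Finished m' = Finished m := by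
  funext d e
  rw [Finished, h _ hK, Finished]

theorem SearchAt.frame {A : WalkTable} {m m' F₀ μ K} (S : SearchAt A m F₀ μ) (h : Frame K m m')
    (hK : ∀ k ∈ K, 24 ≤ k) : SearchAt A m' F₀ μ := by
  have : ∀ k < 24, k ∉ K := fun k hk h1 => by have := hK k h1; omega
  rwa [SearchAt, decW_frame h (this _ (by norm_num)), decZ_frame h (this _ (by norm_num)),
    Finished_frame h (this _ (by norm_num)), decR_frame h (this _ (by norm_num))]

/-- Take the value of `e` into account as the cost of a bridge between the states in the variables
`i` and `j`. -/
def relaxP (i j : ℕ) (e : RamExpr) : RamProg :=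
  .seq (.set vV e)
    (.cond (ltE (.var vV) (.rd aW (.var i) (.var j)))
      (.seq (.wr aW (.var i) (.var j) (.var vV))
        (.cond (ltE (.var vV) (.rd1 aR (.var i))) (.wr1 aR (.var i) (.var vV)) .skip))
      .skip)

theorem run_relaxP {inp : List ℕ} (m : ℕ → ℕ) {i j : ℕ} {e : RamExpr} {T : ℕ}
    (hT : (relaxP i j e).wcet ≤ T) (hi : 24 ≤ i ∧ i < 31) (hj : 24 ≤ j ∧ j < 31) :
    Run inp (relaxP i j e) m T (fun m' => Frame [aW, aR, vV] m m' ∧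
      decW m' = relaxW (decW m) (cell m i 0 0) (cell m j 0 0) (dec (e.eval inp m)) ∧
      decR m' = relaxR (decW m) (decR m) (cell m i 0 0) (cell m j 0 0) (dec (e.eval inp m))) := by
  refine Run.of_exec rfl hT ?_
  have hi1 : i ≠ 20 := by omega
  have hi2 : i ≠ 31 := by omega
  have hj2 : j ≠ 31 := by omega
  set m₁ := setCell m vV 0 0 (e.eval inp m) with hm₁
  have hf₁ : Frame [aW, aR, vV] m m₁ := (Frame.refl _ _).setCell (by simp) _ _ _
  have hiv : cell m₁ i 0 0 = cell m i 0 0 := by simp [hm₁, cell_setCell, hi2]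
  have hjv : cell m₁ j 0 0 = cell m j 0 0 := by simp [hm₁, cell_setCell, hj2]
  have hV : cell m₁ vV 0 0 = e.eval inp m := by simp [hm₁, cell_setCell]
  have hW : decW m₁ = decW m := by
    funext a b
    simp [hm₁, decW, cell_setCell]
  have hR : decR m₁ = decR m := by
    funext a
    simp [hm₁, decR, cell_setCell]
  set v := dec (e.eval inp m) with hv
  set d := cell m i 0 0 with hd
  set h := cell m j 0 0 with hh
  have t1 := eval_ltE inp m₁ (.var vV) (.rd aW (.var i) (.var j))
  simp only [eval_var, eval_rd, hV, hiv, hjv, ← hv] at t1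
  change _ ↔ v < decW m₁ d h at t1
  rw [hW] at t1
  simp only [relaxP, exec, exec_set, ← hm₁]
  by_cases c1 : v < decW m d h
  · rw [if_neg (t1.2 c1)]
    simp only [exec_wr, eval_var, hiv, hjv, hV]
    set m₂ := setCell m₁ aW d h (e.eval inp m) with hm₂
    have hf₂ : Frame [aW, aR, vV] m m₂ := hf₁.setCell (by simp) _ _ _
    have hiv2 : cell m₂ i 0 0 = d := by simp [hm₂, cell_setCell, hi1, hiv]
    have hV2 : cell m₂ vV 0 0 = e.eval inp m := by simp [hm₂, cell_setCell, hV]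
    have hR2 : decR m₂ = decR m := by
      rw [← hR]
      funext a
      simp [hm₂, decR, cell_setCell]
    have hW2 : decW m₂ = relaxW (decW m) d h v := by
      funext a b
      simp only [hm₂, decW, cell_setCell, true_and, relaxW]
      split_ifs with hab
      · exact (min_eq_right c1.le).symm
      · exact congrFun (congrFun hW a) b
    have t2 := eval_ltE inp m₂ (.var vV) (.rd1 aR (.var i))
    simp only [eval_var, eval_rd, hV2, hiv2, RamExpr.eval, ← hv] at t2
    change _ ↔ v < decR m₂ d at t2
    rw [hR2] at t2
    by_cases c2 : v < decR m d
    · rw [if_neg (t2.2 c2)]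
      simp only [RamExpr.eval, hiv2, hV2]
      refine ⟨hf₂.setCell (by simp) _ _ _, ?_, ?_⟩
      · rw [← hW2]
        funext a b
        simp [decW, cell_setCell]
      · funext a
        simp only [decR, cell_setCell, true_and, and_true, relaxR, c1]
        split_ifs with ha
        · exact (min_eq_right c2.le).symm
        · exact congrFun hR2 a
    · rw [if_pos (by simpa using mt t2.1 c2)]
      refine ⟨hf₂, hW2, ?_⟩
      rw [hR2]
      funext a
      unfold relaxR
      split_ifs with ha
      · rw [ha.1, min_eq_left (not_lt.1 c2)]
      · rfl
  · rw [if_pos (by simpa using mt t1.1 c1)]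
    refine ⟨hf₁, ?_, ?_⟩
    · rw [hW]
      funext a b
      unfold relaxW
      split_ifs with hab
      · rw [hab.1, hab.2, min_eq_left (not_lt.1 c1)]
      · rfl
    · rw [hR]
      funext a
      simp [relaxR, c1]

/-- Combine the bridges to the state `a` with the walk of cost `c` from `a` to `h`. -/
def relaxColumn : RamProg :=
  .forLoop vD vM (relaxP vD vH (sumE (.rd aW (.var vD) (.var vA)) (.var vC)))

theorem SearchAt.relax {A : WalkTable} {m m' F₀ μ K} (S : SearchAt A m F₀ μ) {d h : ℕ} {v : ℕ∞}
    (hv : μ ≤ v) (hb : ∀ w : ℕ, v = w → A.Bridge d h w) (hf : Frame K m m')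
    (hK : aZ ∉ K ∧ aF ∉ K) (hW : decW m' = relaxW (decW m) d h v)
    (hR : decR m' = relaxR (decW m) (decR m) d h v) : SearchAt A m' F₀ μ := by
  rw [SearchAt, hW, hR, decZ_frame hf hK.1, Finished_frame hf hK.2]
  exact Search.relax S hv hb

/-- The bound `μ ≤ c` guarantees that finished pairs are not affected. -/
theorem run_relaxColumn {inp : List ℕ} {A : WalkTable} {m : ℕ → ℕ} {F₀ : ℕ → ℕ → Prop} {μ c : ℕ∞}
    {a h : ℕ} (hA : Stored A m) (S : SearchAt A m F₀ μ) (ha : cell m vA 0 0 = a)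
    (hh : cell m vH 0 0 = h) (hc : dec (cell m vC 0 0) = c) (hμ : μ ≤ c)
    (hz : ∀ z : ℕ, c = z → ∃ f w : ℕ, A.Bridge a f w ∧ A.Cancel a f ∧ A.Step f h ∧
      z = w + (A.cst a + A.cst f)) :
    Run inp relaxColumn m (A.M * 1500 + 9) (fun m' => Frame [aW, aR, vV, vD] m m' ∧
      SearchAt A m' F₀ μ ∧ (∀ d, F₀ d a → decW m' d h ≤ decW m' d a + c) ∧
      ∀ d e, Finished m d e → decW m' d e = decW m d e) := by
  refine (Run.forLoop_const A.M 1488 (fun i m' => cell m' vD 0 0 = i ∧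
    Frame [aW, aR, vV, vD] m m' ∧ SearchAt A m' F₀ μ ∧
    (∀ d < i, F₀ d a → decW m' d h ≤ decW m' d a + c) ∧
    ∀ d e, Finished m d e → decW m' d e = decW m d e) ?_ ?_ ?_).mono le_rfl ?_
  · refine ⟨by simp [cell_setCell], (Frame.refl _ _).setCell (by simp) _ _ _, ?_,
      fun d hd => absurd hd (by omega), ?_⟩
    · exact S.frame (K := [vD]) ((Frame.refl _ _).setCell (by simp) _ _ _) (by simp)
    · intro d e _
      simp [decW, cell_setCell]
  · rintro i m' ⟨h1, h2, -⟩
    exact ⟨h1, by rw [h2 _ (by simp), hA.M]⟩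
  · rintro i m' hi ⟨h1, h2, h3, h4, h5⟩
    refine (run_relaxP m' (Nat.le_of_ble_eq_true rfl) (by norm_num) (by norm_num)).mono le_rfl ?_
    rintro m'' ⟨f1, f2, f3⟩
    have e1 : cell m' vA 0 0 = a := by rw [h2 _ (by simp), ha]
    have e2 : cell m' vH 0 0 = h := by rw [h2 _ (by simp), hh]
    have e3 : cell m' vC 0 0 = cell m vC 0 0 := by rw [h2 _ (by simp)]
    rw [dec_eval_sumE] at f2 f3
    simp only [eval_var, eval_rd, h1, e1, e2, e3, hc] at f2 f3
    change _ = WalkTable.relaxW _ _ _ (decW m' i a + c) at f2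
    change _ = WalkTable.relaxR _ _ _ _ (decW m' i a + c) at f3
    have hv : μ ≤ decW m' i a + c := hμ.trans le_add_self
    have S' : SearchAt A m'' F₀ μ := by
      refine h3.relax hv ?_ f1 (by simp) f2 f3
      intro w hw
      have t1 : decW m' i a ≠ ⊤ := fun ht => by simp [ht] at hw
      have t2 : c ≠ ⊤ := fun ht => by simp [ht] at hw
      lift c to ℕ using t2
      obtain ⟨f, w2, k1, k2, k3, k4⟩ := hz _ rfl
      obtain ⟨w1, hw1⟩ := ENat.ne_top_iff_exists.1 t1
      rw [← hw1] at hw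
      have : w = w1 + w2 + (A.cst a + A.cst f) := by
        have : w1 + c = w := by exact_mod_cast hw
        omega
      rw [this]
      exact .app (h3.soundW _ _ _ hw1.symm) k1 k2 k3
    have hfin : ∀ d e, Finished m d e → decW m'' d e = decW m' d e := by
      intro d e hd
      rw [f2]
      refine Search.relaxW_of_finished h3 hv ?_
      rwa [Finished_frame h2 (by simp)]
    have hF₀ : ∀ d, F₀ d a → Finished m d a := by
      intro d hd
      rw [← Finished_frame h2 (by simp)]
      exact h3.sub _ _ hd
    have fr : Frame [vD] m'' (setCell m'' vD 0 0 (i + 1)) :=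
      (Frame.refl _ _).setCell (by simp) _ _ _
    refine ⟨by rw [f1 _ (by simp), h1], by simp [cell_setCell], ?_, S'.frame fr (by simp), ?_, ?_⟩
    · exact (h2.trans (f1.mono (by simp))).setCell (by simp) _ _ _
    · rw [decW_frame fr (by simp)]
      intro d hd hFd
      rw [hfin _ _ (hF₀ d hFd)]
      rcases Nat.lt_succ_iff_lt_or_eq.1 hd with hd | rfl
      · exact (f2 ▸ relaxW_le _ _ _ _ _ _).trans (h4 d hd hFd)
      · rw [f2, relaxW_self]
        exact min_le_right _ _
    · rw [decW_frame fr (by simp)]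
      intro d e hd
      rw [hfin _ _ hd, h5 _ _ hd]
  · rintro m' ⟨-, h2, h3, h4, h5⟩
    refine ⟨h2, h3, fun d hd => ?_, h5⟩
    by_cases hdM : d < A.M
    · exact h4 d hdM hd
    · have : decW m' d a = ⊤ := by
        by_contra ht
        exact hdM (Search.lt_of_ne_top h3 ht).1
      simp [this]

end WalkTable

/-! ### The steps of a round of the search -/

namespace WalkTable

open RamExpr RamProg

/-- Combine all bridges to the state `a` with the walks that consist of `a`, a bridge of cost `c`
from `a` to `b` (the costs of `a` and `b` included), `b` itself, and a step. -/
def relaxAfter : RamProg :=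
  .forLoop vH vM (.cond (stepE (.var vB) (.var vH))
    (.seq relaxColumn
      (.cond (ltE (.var vC) (.rd aZ (.var vA) (.var vH)))
        (.wr aZ (.var vA) (.var vH) (.var vC)) .skip))
    .skip)

theorem run_updateZ {inp : List ℕ} {A : WalkTable} {m : ℕ → ℕ} {F₀ : ℕ → ℕ → Prop} {μ c : ℕ∞}
    {a h : ℕ} (S : SearchAt A m F₀ μ) (ha : cell m vA 0 0 = a)
    (hh : cell m vH 0 0 = h) (hc : dec (cell m vC 0 0) = c)
    (hz : ∀ z : ℕ, c = z → ∃ f w : ℕ, A.Bridge a f w ∧ A.Cancel a f ∧ A.Step f h ∧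
      z = w + (A.cst a + A.cst f))
    (hW : ∀ d, F₀ d a → decW m d h ≤ decW m d a + c) :
    Run inp (.cond (ltE (.var vC) (.rd aZ (.var vA) (.var vH)))
        (.wr aZ (.var vA) (.var vH) (.var vC)) .skip) m 200 (fun m' => Frame [aZ] m m' ∧
      SearchAt A m' F₀ μ ∧ decZ m' a h ≤ c ∧ ∀ h', decZ m' a h' ≤ decZ m a h') := by
  refine Run.of_exec rfl (Nat.le_of_ble_eq_true rfl) ?_
  have t := eval_ltE inp m (.var vC) (.rd aZ (.var vA) (.var vH))
  simp only [eval_var, eval_rd, ha, hh, hc] at t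
  change _ ↔ c < decZ m a h at t
  have key : ∀ m', Frame [aZ] m m' →
      (∀ e h', decZ m' e h' = if e = a ∧ h' = h then min (decZ m a h) c else decZ m e h') →
      Frame [aZ] m m' ∧ SearchAt A m' F₀ μ ∧ decZ m' a h ≤ c ∧
        ∀ h', decZ m' a h' ≤ decZ m a h' := by
    intro m' hf hZ
    refine ⟨hf, ?_, ?_, ?_⟩
    · rw [SearchAt, decW_frame hf (by simp), decR_frame hf (by simp), Finished_frame hf (by simp)]
      exact Search.relaxZ S hZ hz hW
    · rw [hZ]
      simp
    · intro h'
      rw [hZ]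
      split_ifs with he
      · rw [he.2]
        exact min_le_left _ _
      · exact le_rfl
  simp only [exec, exec_wr, eval_var, ha, hh]
  by_cases hlt : c < decZ m a h
  · rw [if_neg (t.2 hlt)]
    refine key _ ((Frame.refl _ _).setCell (by simp) _ _ _) fun e h' => ?_
    simp only [decZ, cell_setCell, true_and]
    split_ifs with he
    · rw [hc]
      exact (min_eq_right hlt.le).symm
    · rfl
  · rw [if_pos (by simpa using mt t.1 hlt)]
    refine key _ (Frame.refl _ _) fun e h' => ?_
    split_ifs with he
    · rw [he.1, he.2, min_eq_left (not_lt.1 hlt)]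
    · rfl

/-- Only the at most `D` successors `h` of `b` cause a run of `relaxColumn`. -/
theorem run_relaxAfter {inp : List ℕ} {A : WalkTable} {m : ℕ → ℕ} {F₀ : ℕ → ℕ → Prop} {μ : ℕ∞}
    {a b D : ℕ} (hA : Stored A m) (S : SearchAt A m F₀ μ) (ha : cell m vA 0 0 = a)
    (hb : cell m vB 0 0 = b) (hbM : b < A.M) (hab : decW m a b = μ)
    (hc : dec (cell m vC 0 0) = μ + (A.cst a + A.cst b : ℕ)) (hcan : A.Cancel a b)
    (hD : Set.ncard {t | A.Step b t} ≤ D) :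
    Run inp relaxAfter m (A.M * 500 + D * (A.M * 1500 + 300) + 9) (fun m' =>
      Frame [aW, aR, aZ, vV, vD, vH] m m' ∧
      SearchAt A m' F₀ μ ∧
      (∀ h, A.Step b h → decZ m' a h ≤ μ + (A.cst a + A.cst b : ℕ)) ∧
      ∀ d e, Finished m d e → decW m' d e = decW m d e) := by
  classical
  set c : ℕ∞ := μ + (A.cst a + A.cst b : ℕ) with hcdef
  have hT : ∑ i ∈ Finset.range A.M,
      (((stepE (.var vB) (.var vH)).cost + 1 +
        (if A.Step b i then A.M * 1500 + 9 + 200 else 1)) + 12) + 9 ≤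
      A.M * 500 + D * (A.M * 1500 + 300) + 9 := by
    have h1 : ∀ i, (((stepE (.var vB) (.var vH)).cost + 1 +
        (if A.Step b i then A.M * 1500 + 9 + 200 else 1)) + 12) ≤
        500 + if A.Step b i then A.M * 1500 + 300 else 0 := by
      have h2 : (stepE (.var vB) (.var vH)).cost ≤ 480 := Nat.le_of_ble_eq_true rfl
      intro i
      split_ifs <;> omega
    refine add_le_add ((Finset.sum_le_sum fun i _ => h1 i).trans ?_) le_rfl
    rw [Finset.sum_add_distrib, Finset.sum_const, Finset.card_range, smul_eq_mul,
      ← Finset.sum_filter, Finset.sum_const, smul_eq_mul]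
    refine Nat.add_le_add_left (Nat.mul_le_mul_right _ (le_trans ?_ hD)) _
    rw [← Set.ncard_coe_finset]
    refine Set.ncard_le_ncard ?_ ?_
    · intro t ht
      simpa using (Finset.mem_filter.1 ht).2
    · exact (Set.finite_lt_nat A.M).subset fun t ht => ht.2.1
  refine (Run.forLoop A.M (fun i => (stepE (.var vB) (.var vH)).cost + 1 +
    (if A.Step b i then A.M * 1500 + 9 + 200 else 1)) (fun i m' => cell m' vH 0 0 = i ∧
    Frame [aW, aR, aZ, vV, vD, vH] m m' ∧ SearchAt A m' F₀ μ ∧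
    (∀ h < i, A.Step b h → decZ m' a h ≤ c) ∧
    ∀ d e, Finished m d e → decW m' d e = decW m d e) ?_ ?_ ?_).mono hT ?_
  · have fr : Frame [vH] m (setCell m vH 0 0 0) := (Frame.refl _ _).setCell (by simp) _ _ _
    refine ⟨by simp [cell_setCell], fr.mono (by simp), S.frame fr (by simp),
      fun d hd => absurd hd (by omega), ?_⟩
    intro d e _
    rw [decW_frame fr (by simp)]
  · rintro i m' ⟨h1, h2, -⟩
    exact ⟨h1, by rw [h2 _ (by simp), hA.M]⟩
  · rintro i m' hi ⟨h1, h2, h3, h4, h5⟩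
    have hA' : Stored A m' := hA.frame h2 (by simp)
    have e1 : cell m' vA 0 0 = a := by rw [h2 _ (by simp), ha]
    have e2 : cell m' vB 0 0 = b := by rw [h2 _ (by simp), hb]
    have e3 : dec (cell m' vC 0 0) = c := by rw [h2 _ (by simp), hc]
    have hstep := eval_stepE hA' inp (.var vB) (.var vH) (by simpa [e2]) (by simpa [h1])
    simp only [eval_var, e2, h1] at hstep
    have fr : ∀ m'', Frame [vH] m'' (setCell m'' vH 0 0 (i + 1)) := fun m'' =>
      (Frame.refl _ _).setCell (by simp) _ _ _
    refine Run.cond ?_ ?_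
    · intro hne
      have hs := hstep.1 hne
      rw [if_pos hs]
      have hz : ∀ z : ℕ, c = z → ∃ f w : ℕ, A.Bridge a f w ∧ A.Cancel a f ∧ A.Step f i ∧
          z = w + (A.cst a + A.cst f) := by
        intro z hz
        rw [hcdef] at hz
        have t1 : μ ≠ ⊤ := fun ht => by simp [ht] at hz
        obtain ⟨w, rfl⟩ := ENat.ne_top_iff_exists.1 t1
        exact ⟨b, w, S.soundW _ _ _ hab, hcan, hs, by exact_mod_cast hz.symm⟩
      refine Run.seq ((run_relaxColumn hA' h3 e1 h1 e3 le_self_add hz).mono le_rfl ?_)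
      rintro m₁ ⟨f1, s1, w1, w2⟩
      refine (run_updateZ (c := c) s1 (by rw [f1 _ (by simp), e1]) (by rw [f1 _ (by simp), h1])
        (by rw [f1 _ (by simp), e3]) hz w1).mono le_rfl ?_
      rintro m₂ ⟨f2, s2, z1, z2⟩
      have f12 : Frame [aW, aR, aZ, vV, vD, vH] m' m₂ :=
        (f1.mono (by simp)).trans (f2.mono (by simp))
      refine ⟨by rw [f2 _ (by simp), f1 _ (by simp), h1], by simp [cell_setCell],
        (h2.trans f12).setCell (by simp) _ _ _, s2.frame (fr _) (by simp), ?_, ?_⟩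
      · rw [decZ_frame (fr _) (by simp)]
        intro h hh hbh
        rcases Nat.lt_succ_iff_lt_or_eq.1 hh with hh | rfl
        · refine (z2 h).trans ?_
          rw [decZ_frame f1 (by simp)]
          exact h4 h hh hbh
        · exact z1
      · rw [decW_frame (fr _) (by simp), decW_frame f2 (by simp)]
        intro d e hd
        rw [w2 _ _ (by rwa [Finished_frame h2 (by simp)]), h5 _ _ hd]
    · intro h0
      have hs : ¬ A.Step b i := fun hs => hstep.2 hs h0
      rw [if_neg hs]
      refine Run.of_exec rfl le_rfl ?_
      simp only [exec]
      refine ⟨h1, by simp [cell_setCell], h2.setCell (by simp) _ _ _, h3.frame (fr _) (by simp),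
        ?_, ?_⟩
      · rw [decZ_frame (fr _) (by simp)]
        intro h hh hbh
        rcases Nat.lt_succ_iff_lt_or_eq.1 hh with hh | rfl
        · exact h4 h hh hbh
        · exact absurd hbh hs
      · rwa [decW_frame (fr _) (by simp)]
  · rintro m' ⟨-, h2, h3, h4, h5⟩
    exact ⟨h2, h3, fun h hs => h4 h hs.2.1 hs, h5⟩

/-- Combine the bridge from `a` to `b` with all walks that can follow it. -/
def relaxRow : RamProg :=
  .forLoop vH vM (relaxP vA vH (sumE (.rd aW (.var vA) (.var vB)) (.rd aZ (.var vB) (.var vH))))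

theorem run_relaxRow {inp : List ℕ} {A : WalkTable} {m : ℕ → ℕ} {F₀ : ℕ → ℕ → Prop} {μ : ℕ∞}
    {a b : ℕ} (hA : Stored A m) (S : SearchAt A m F₀ μ) (ha : cell m vA 0 0 = a)
    (hb : cell m vB 0 0 = b) (hab : decW m a b = μ) (hfin : Finished m a b) :
    Run inp relaxRow m (A.M * 1500 + 9) (fun m' => Frame [aW, aR, vV, vH] m m' ∧
      SearchAt A m' F₀ μ ∧ (∀ h, decW m' a h ≤ μ + decZ m b h) ∧ decW m' a b = μ) := by
  refine (Run.forLoop_const A.M 1488 (fun i m' => cell m' vH 0 0 = i ∧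
    Frame [aW, aR, vV, vH] m m' ∧ SearchAt A m' F₀ μ ∧
    (∀ h < i, decW m' a h ≤ μ + decZ m b h) ∧ decW m' a b = μ) ?_ ?_ ?_).mono le_rfl ?_
  · have fr : Frame [vH] m (setCell m vH 0 0 0) := (Frame.refl _ _).setCell (by simp) _ _ _
    refine ⟨by simp [cell_setCell], fr.mono (by simp), S.frame fr (by simp),
      fun d hd => absurd hd (by omega), ?_⟩
    rw [decW_frame fr (by simp), hab]
  · rintro i m' ⟨h1, h2, -⟩
    exact ⟨h1, by rw [h2 _ (by simp), hA.M]⟩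
  · rintro i m' hi ⟨h1, h2, h3, h4, h5⟩
    refine (run_relaxP m' (Nat.le_of_ble_eq_true rfl) (by norm_num) (by norm_num)).mono le_rfl ?_
    rintro m'' ⟨f1, f2, f3⟩
    have e1 : cell m' vA 0 0 = a := by rw [h2 _ (by simp), ha]
    have e2 : cell m' vB 0 0 = b := by rw [h2 _ (by simp), hb]
    have e3 : cell m' aZ b i = cell m aZ b i := h2 _ (by simp) _ _
    rw [dec_eval_sumE] at f2 f3
    simp only [eval_var, eval_rd, h1, e1, e2, e3] at f2 f3
    change _ = WalkTable.relaxW _ _ _ (decW m' a b + decZ m b i) at f2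
    change _ = WalkTable.relaxR _ _ _ _ (decW m' a b + decZ m b i) at f3
    rw [h5] at f2 f3
    have hv : μ ≤ μ + decZ m b i := le_self_add
    have S' : SearchAt A m'' F₀ μ := by
      refine h3.relax hv ?_ f1 (by simp) f2 f3
      intro w hw
      have t1 : μ ≠ ⊤ := fun ht => by simp [ht] at hw
      have t2 : decZ m b i ≠ ⊤ := fun ht => by simp [ht] at hw
      lift μ to ℕ using t1
      obtain ⟨z, hz⟩ := ENat.ne_top_iff_exists.1 t2
      obtain ⟨f, w2, k1, k2, k3, k4⟩ := S.soundZ _ _ _ hz.symm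
      rw [← hz] at hw
      have : w = μ + w2 + (A.cst b + A.cst f) := by
        have : μ + z = w := by exact_mod_cast hw
        omega
      rw [this]
      exact .app (S.soundW _ _ _ hab) k1 k2 k3
    have fr : Frame [vH] m'' (setCell m'' vH 0 0 (i + 1)) :=
      (Frame.refl _ _).setCell (by simp) _ _ _
    refine ⟨by rw [f1 _ (by simp), h1], by simp [cell_setCell], ?_, S'.frame fr (by simp), ?_, ?_⟩
    · exact (h2.trans (f1.mono (by simp))).setCell (by simp) _ _ _
    · rw [decW_frame fr (by simp)]
      intro h hh
      rcases Nat.lt_succ_iff_lt_or_eq.1 hh with hh | rfl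
      · exact (f2 ▸ relaxW_le _ _ _ _ _ _).trans (h4 h hh)
      · rw [f2, relaxW_self]
        exact min_le_right _ _
    · rw [decW_frame fr (by simp), f2, Search.relaxW_of_finished h3 hv, h5]
      rwa [Finished_frame h2 (by simp)]
  · rintro m' ⟨-, h2, h3, h4, h5⟩
    refine ⟨h2, h3, fun h => ?_, h5⟩
    by_cases hM : h < A.M
    · exact h4 h hM
    · have : decZ m b h = ⊤ := by
        by_contra ht
        exact hM (Search.lt_of_Z_ne_top S ht)
      simp [this]

/-- Find a row with the least row minimum. -/
def findRow : RamProg :=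
  .seq (.set vA (.lit 0))
    (.forLoop vD vM (.cond (ltE (.rd1 aR (.var vD)) (.rd1 aR (.var vA))) (.set vA (.var vD)) .skip))

theorem run_findRow {inp : List ℕ} {A : WalkTable} {m : ℕ → ℕ} (hA : Stored A m) (hM : 0 < A.M) :
    Run inp findRow m (A.M * 500 + 20) (fun m' => Frame [vA, vD] m m' ∧
      cell m' vA 0 0 < A.M ∧ ∀ d < A.M, decR m (cell m' vA 0 0) ≤ decR m d) := by
  refine Run.mono (T := 4 + (A.M * 500 + 9)) ?_ (by omega) fun _ h => h
  refine Run.seq (Run.of_exec rfl (Nat.le_of_ble_eq_true rfl) ?_)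
  refine (Run.forLoop_const A.M 488 (fun i m' => cell m' vD 0 0 = i ∧ Frame [vA, vD] m m' ∧
      cell m' vA 0 0 < A.M ∧ ∀ d < i, decR m (cell m' vA 0 0) ≤ decR m d) ?_ ?_ ?_).mono le_rfl ?_
  · refine ⟨by simp [cell_setCell], ?_, by simpa [cell_setCell, RamExpr.eval] using hM,
      fun d hd => absurd hd (by omega)⟩
    exact ((Frame.refl _ _).setCell (by simp) _ _ _).setCell (by simp) _ _ _
  · rintro i m' ⟨h1, h2, -⟩
    exact ⟨h1, by rw [h2 _ (by simp), hA.M]⟩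
  · rintro i m' hi ⟨h1, h2, h3, h4⟩
    refine Run.of_exec rfl (Nat.le_of_ble_eq_true rfl) ?_
    have t := eval_ltE inp m' (.rd1 aR (.var vD)) (.rd1 aR (.var vA))
    simp only [eval_var, eval_rd, RamExpr.eval] at t
    change _ ↔ decR m' _ < decR m' _ at t
    rw [decR_frame h2 (by simp), h1] at t
    simp only [exec]
    by_cases hlt : decR m i < decR m (cell m' vA 0 0)
    · rw [if_neg (t.2 hlt)]
      simp only [exec_set, eval_var, h1]
      refine ⟨by simp [cell_setCell, h1], by simp [cell_setCell],
        (h2.setCell (by simp) _ _ _).setCell (by simp) _ _ _, by simpa [cell_setCell], ?_⟩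
      intro d hd
      simp only [cell_setCell]
      simp only [reduceIte, Nat.reduceEqDiff, false_and, and_self]
      rcases Nat.lt_succ_iff_lt_or_eq.1 hd with hd | rfl
      · exact hlt.le.trans (h4 d hd)
      · exact le_rfl
    · rw [if_pos (by simpa using mt t.1 hlt)]
      refine ⟨h1, by simp [cell_setCell], h2.setCell (by simp) _ _ _, by simpa [cell_setCell], ?_⟩
      intro d hd
      simp only [cell_setCell]
      simp only [reduceIte, Nat.reduceEqDiff, false_and]
      rcases Nat.lt_succ_iff_lt_or_eq.1 hd with hd | rfl
      · exact h4 d hd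
      · exact not_lt.1 hlt
  · rintro m' ⟨-, h2, h3, h4⟩
    exact ⟨h2, h3, h4⟩

/-- Find an unfinished pair in the row `a` that attains the row minimum. -/
def findColumn : RamProg :=
  .forLoop vH vM (.cond (.mul (.sub (.lit 1) (.rd aF (.var vA) (.var vH)))
    (eqE (.rd aW (.var vA) (.var vH)) (.rd1 aR (.var vA)))) (.set vB (.var vH)) .skip)

theorem run_findColumn {inp : List ℕ} {A : WalkTable} {m : ℕ → ℕ} (hA : Stored A m) {a : ℕ}
    (ha : cell m vA 0 0 = a) (hex : ∃ h < A.M, ¬ Finished m a h ∧ decW m a h = decR m a) :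
    Run inp findColumn m (A.M * 800 + 9) (fun m' => Frame [vB, vH] m m' ∧
      ¬ Finished m a (cell m' vB 0 0) ∧ decW m a (cell m' vB 0 0) = decR m a) := by
  refine (Run.forLoop_const A.M 788 (fun i m' => cell m' vH 0 0 = i ∧ Frame [vB, vH] m m' ∧
      ∀ h < i, ¬ Finished m a h ∧ decW m a h = decR m a →
        ¬ Finished m a (cell m' vB 0 0) ∧ decW m a (cell m' vB 0 0) = decR m a)
      ?_ ?_ ?_).mono le_rfl ?_
  · exact ⟨by simp [cell_setCell], (Frame.refl _ _).setCell (by simp) _ _ _,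
      fun d hd => absurd hd (by omega)⟩
  · rintro i m' ⟨h1, h2, -⟩
    exact ⟨h1, by rw [h2 _ (by simp), hA.M]⟩
  · rintro i m' hi ⟨h1, h2, h3⟩
    refine Run.of_exec rfl (Nat.le_of_ble_eq_true rfl) ?_
    have e1 : cell m' vA 0 0 = a := by rw [h2 _ (by simp), ha]
    have t := eval_eqE inp m' (.rd aW (.var vA) (.var vH)) (.rd1 aR (.var vA))
    simp only [eval_var, eval_rd, RamExpr.eval, h1, e1] at t
    have t2 : (RamExpr.mul (.sub (.lit 1) (.rd aF (.var vA) (.var vH)))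
        (eqE (.rd aW (.var vA) (.var vH)) (.rd1 aR (.var vA)))).eval inp m' ≠ 0 ↔
        ¬ Finished m a i ∧ decW m a i = decR m a := by
      simp only [RamExpr.eval, eval_rd, eval_var, h1, e1, mul_ne_zero_iff, t]
      rw [h2 aW (by simp), h2 aR (by simp), h2 aF (by simp), ← dec_inj, decW, decR, Finished]
      exact and_congr (by omega) Iff.rfl
    simp only [exec]
    by_cases hp : ¬ Finished m a i ∧ decW m a i = decR m a
    · rw [if_neg (t2.2 hp)]
      simp only [exec_set, eval_var, h1]
      refine ⟨by simp [cell_setCell, h1], by simp [cell_setCell],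
        (h2.setCell (by simp) _ _ _).setCell (by simp) _ _ _, fun _ _ _ => ?_⟩
      simpa [cell_setCell] using hp
    · rw [if_pos (by simpa using mt t2.1 hp)]
      refine ⟨h1, by simp [cell_setCell], h2.setCell (by simp) _ _ _, ?_⟩
      intro h hh hq
      have : cell (setCell m' vH 0 0 (i + 1)) vB 0 0 = cell m' vB 0 0 := by simp [cell_setCell]
      rw [this]
      rcases Nat.lt_succ_iff_lt_or_eq.1 hh with hh | rfl
      · exact h3 h hh hq
      · exact absurd hq hp
  · rintro m' ⟨-, h2, h3⟩
    obtain ⟨h, hh, hq⟩ := hex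
    exact ⟨h2, h3 h hh hq⟩

/-- Recompute the minimum of the row `a`. -/
def updateMin : RamProg :=
  .seq (.wr1 aR (.var vA) (.lit 0))
    (.forLoop vH vM (.cond (.mul (.sub (.lit 1) (.rd aF (.var vA) (.var vH)))
      (ltE (.rd aW (.var vA) (.var vH)) (.rd1 aR (.var vA))))
        (.wr1 aR (.var vA) (.rd aW (.var vA) (.var vH))) .skip))

theorem run_updateMin {inp : List ℕ} {A : WalkTable} {m : ℕ → ℕ} (hA : Stored A m) {a : ℕ}
    (ha : cell m vA 0 0 = a) (hout : ∀ h, A.M ≤ h → decW m a h = ⊤) :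
    Run inp updateMin m (A.M * 800 + 100) (fun m' => Frame [aR, vH] m m' ∧
      (∀ d, d ≠ a → decR m' d = decR m d) ∧ (∀ h, ¬ Finished m a h → decR m' a ≤ decW m a h) ∧
      (decR m' a = ⊤ ∨ ∃ h, ¬ Finished m a h ∧ decW m a h = decR m' a)) := by
  refine Run.mono (T := 91 + (A.M * 800 + 9)) ?_ (by omega) fun _ h => h
  refine Run.seq (Run.of_exec rfl (Nat.le_of_ble_eq_true rfl) ?_)
  refine (Run.forLoop_const A.M 788 (fun i m' => cell m' vH 0 0 = i ∧ Frame [aR, vH] m m' ∧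
      (∀ d, d ≠ a → decR m' d = decR m d) ∧
      (∀ h < i, ¬ Finished m a h → decR m' a ≤ decW m a h) ∧
      (decR m' a = ⊤ ∨ ∃ h, ¬ Finished m a h ∧ decW m a h = decR m' a))
      ?_ ?_ ?_).mono le_rfl ?_
  · simp only [exec_wr, eval_var, ha, RamExpr.eval]
    refine ⟨by simp [cell_setCell],
      ((Frame.refl _ _).setCell (by simp) _ _ _).setCell (by simp) _ _ _, ?_,
      fun d hd => absurd hd (by omega), .inl ?_⟩
    · intro d hd
      simp [decR, cell_setCell, hd]
    · simp [decR, cell_setCell, dec_zero]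
  · rintro i m' ⟨h1, h2, -⟩
    exact ⟨h1, by rw [h2 _ (by simp), hA.M]⟩
  · rintro i m' hi ⟨h1, h2, h3, h4, h5⟩
    refine Run.of_exec rfl (Nat.le_of_ble_eq_true rfl) ?_
    have e1 : cell m' vA 0 0 = a := by rw [h2 _ (by simp), ha]
    have t := eval_ltE inp m' (.rd aW (.var vA) (.var vH)) (.rd1 aR (.var vA))
    simp only [eval_var, eval_rd, RamExpr.eval, h1, e1] at t
    have e4 : cell m' aW a i = cell m aW a i := h2 _ (by simp) _ _
    have t2 : (RamExpr.mul (.sub (.lit 1) (.rd aF (.var vA) (.var vH)))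
        (ltE (.rd aW (.var vA) (.var vH)) (.rd1 aR (.var vA)))).eval inp m' ≠ 0 ↔
        ¬ Finished m a i ∧ decW m a i < decR m' a := by
      simp only [RamExpr.eval, eval_rd, eval_var, h1, e1, mul_ne_zero_iff, t]
      rw [h2 aW (by simp), h2 aF (by simp), decW, decR, Finished]
      exact and_congr (by omega) Iff.rfl
    simp only [exec]
    have fr : ∀ m'', Frame [vH] m'' (setCell m'' vH 0 0 (i + 1)) := fun m'' =>
      (Frame.refl _ _).setCell (by simp) _ _ _
    by_cases hp : ¬ Finished m a i ∧ decW m a i < decR m' a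
    · rw [if_neg (t2.2 hp)]
      simp only [exec_wr, eval_var, eval_rd, h1, e1, RamExpr.eval, e4]
      have hRa : decR (setCell m' aR a 0 (cell m aW a i)) a = decW m a i := by
        simp [decR, cell_setCell, decW]
      refine ⟨by simp [cell_setCell, h1], by simp [cell_setCell],
        (h2.setCell (by simp) _ _ _).setCell (by simp) _ _ _, ?_⟩
      rw [decR_frame (fr _) (by simp), hRa]
      refine ⟨fun d hd => ?_, fun h hh hF => ?_, .inr ⟨i, hp.1, rfl⟩⟩
      · rw [← h3 d hd]
        simp [decR, cell_setCell, hd]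
      · rcases Nat.lt_succ_iff_lt_or_eq.1 hh with hh | rfl
        · exact hp.2.le.trans (h4 h hh hF)
        · exact le_rfl
    · rw [if_pos (by simpa using mt t2.1 hp)]
      refine ⟨h1, by simp [cell_setCell], h2.setCell (by simp) _ _ _, ?_⟩
      rw [decR_frame (fr _) (by simp)]
      refine ⟨h3, fun h hh hF => ?_, h5⟩
      rcases Nat.lt_succ_iff_lt_or_eq.1 hh with hh | rfl
      · exact h4 h hh hF
      · exact not_lt.1 fun hl => hp ⟨hF, hl⟩
  · rintro m' ⟨-, h2, h3, h4, h5⟩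
    refine ⟨h2, h3, fun h hF => ?_, h5⟩
    by_cases hM : h < A.M
    · exact h4 h hM hF
    · rw [hout h (not_lt.1 hM)]
      exact le_top

end WalkTable

/-! ### The rounds of the search -/

namespace WalkTable

open RamExpr RamProg

/-- Mark the pair `(a, b)` as finished. -/
def markPair : RamProg := .wr aF (.var vA) (.var vB) (.lit 1)

/-- Consider the walks that start with the state `a`, the bridge to `b`, and `b`, if `a` and `b`
cancel. -/
def relaxCancel : RamProg :=
  .cond (cancelE (.var vA) (.var vB))
    (.seq (.set vC (.add (.rd aW (.var vA) (.var vB))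
      (.add (.rd1 tCst (.var vA)) (.rd1 tCst (.var vB))))) relaxAfter) .skip

/-- One round of the search: finish a cheapest unfinished pair, and evaluate its consequences. -/
def searchRound : RamProg :=
  .seq findRow
    (.cond (.rd1 aR (.var vA))
      (.seq findColumn (.seq markPair (.seq updateMin (.seq relaxCancel relaxRow))))
      .skip)

theorem run_relaxCancel {inp : List ℕ} {A : WalkTable} {m : ℕ → ℕ} {F₀ : ℕ → ℕ → Prop} {μ : ℕ∞}
    {a b D : ℕ} (hA : Stored A m) (S : SearchAt A m F₀ μ) (ha : cell m vA 0 0 = a)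
    (hb : cell m vB 0 0 = b) (hbM : b < A.M) (hab : decW m a b = μ) (hμ : μ ≠ ⊤)
    (hfin : Finished m a b) (hD : Set.ncard {t | A.Step b t} ≤ D) :
    Run inp relaxCancel m (A.M * 500 + D * (A.M * 1500 + 300) + 3000) (fun m' =>
      Frame [aW, aR, aZ, vV, vD, vH, vC] m m' ∧
      SearchAt A m' F₀ μ ∧
      (∀ h, A.Cancel a b → A.Step b h → decZ m' a h ≤ μ + (A.cst a + A.cst b : ℕ)) ∧
      decW m' a b = μ) := by
  have hcost : (cancelE (.var vA) (.var vB)).cost ≤ 2400 := Nat.le_of_ble_eq_true rfl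
  refine Run.mono (T := (cancelE (.var vA) (.var vB)).cost + 1 +
    (400 + (A.M * 500 + D * (A.M * 1500 + 300) + 9))) ?_ (by omega) fun _ h => h
  have t := eval_cancelE hA inp (.var vA) (.var vB)
  simp only [eval_var, ha, hb] at t
  refine Run.cond (fun h1 => ?_) (fun h0 => ?_)
  · refine Run.seq (Run.of_exec rfl (Nat.le_of_ble_eq_true rfl) ?_)
    simp only [exec_set, eval_var, eval_rd, RamExpr.eval, ha, hb, hA.cst]
    set m₁ := setCell m vC 0 0 (cell m aW a b + (A.cst a + A.cst b)) with hm₁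
    have fr : Frame [vC] m m₁ := (Frame.refl _ _).setCell (by simp) _ _ _
    refine (run_relaxAfter (D := D) (hA.frame fr (by simp)) (S.frame fr (by simp))
      (by rw [fr _ (by simp), ha]) (by rw [fr _ (by simp), hb]) hbM
      (by rw [decW_frame fr (by simp), hab]) ?_ (t.1 h1) hD).mono le_rfl ?_
    · have h2 : cell m₁ vC 0 0 = cell m aW a b + (A.cst a + A.cst b) := by
        simp [hm₁, cell_setCell]
      rw [h2, dec_add, ← hab, decW]
      intro h3
      rw [← hab, decW, Ne, dec_eq_top] at hμ
      exact hμ h3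
    · rintro m' ⟨f1, s1, z1, w1⟩
      refine ⟨(fr.mono (by simp)).trans (f1.mono (by simp)), s1, fun h _ => z1 h, ?_⟩
      rw [w1 _ _ (by rwa [Finished_frame fr (by simp)]), decW_frame fr (by simp), hab]
  · refine Run.of_exec rfl (by simp [RamProg.wcet]; omega) ?_
    exact ⟨Frame.refl _ _, S, fun h hc => absurd h0 (t.2 hc), hab⟩

/-- The search is exhausted: the remaining pairs admit no bridge that has been found. -/
def Exhausted (m : ℕ → ℕ) : Prop := ∀ d h, ¬ Finished m d h → decW m d h = ⊤

/-- In a round, a further pair is finished, or there is no finite value left. The time depends on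
the number `D` of successors of a state. -/
theorem run_searchRound {inp : List ℕ} {A : WalkTable} {m : ℕ → ℕ} {μ : ℕ∞} {D : ℕ}
    (hA : Stored A m) (hM : 0 < A.M) (S : SearchAt A m (Finished m) μ)
    (hD : ∀ b, Set.ncard {t | A.Step b t} ≤ D) :
    Run inp searchRound m (A.M * 5000 + D * (A.M * 1500 + 300) + 5000) (fun m' =>
      Frame [aW, aR, aZ, aF, vA, vB, vC, vD, vH, vV] m m' ∧
      (∃ μ', SearchAt A m' (Finished m') μ') ∧
      (Exhausted m' ∨ ∃ a b, a < A.M ∧ b < A.M ∧ decW m a b ≠ ⊤ ∧ ¬ Finished m a b ∧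
        ∀ d h, Finished m' d h ↔ Finished m d h ∨ (d = a ∧ h = b))) := by
  have hcost : (RamExpr.rd1 aR (.var vA)).cost ≤ 300 := Nat.le_of_ble_eq_true rfl
  refine Run.mono (T := (A.M * 500 + 20) + ((RamExpr.rd1 aR (.var vA)).cost + 1 +
    ((A.M * 800 + 9) + (400 + ((A.M * 800 + 100) +
      ((A.M * 500 + D * (A.M * 1500 + 300) + 3000) + (A.M * 1500 + 9)))))))
    ?_ (by omega) fun _ h => h
  refine Run.seq ((run_findRow hA hM).mono le_rfl ?_)
  rintro m₁ ⟨f1, r1, r2⟩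
  have S1 : SearchAt A m₁ (Finished m) μ := S.frame f1 (by simp)
  obtain ⟨a, ha⟩ : ∃ a, cell m₁ vA 0 0 = a := ⟨_, rfl⟩
  rw [ha] at r1 r2
  have hR1 : decR m₁ = decR m := decR_frame f1 (by simp)
  have hW1 : decW m₁ = decW m := decW_frame f1 (by simp)
  have hZ1 : decZ m₁ = decZ m := decZ_frame f1 (by simp)
  have hF1 : Finished m₁ = Finished m := Finished_frame f1 (by simp)
  refine Run.cond (fun hne => ?_) (fun h0 => ?_)
  · simp only [eval_rd, eval_var, ha, RamExpr.eval] at hne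
    have hRa : decR m a ≠ ⊤ := by
      rw [← hR1, decR, Ne, dec_eq_top]
      exact hne
    have hex : ∃ h < A.M, ¬ Finished m₁ a h ∧ decW m₁ a h = decR m₁ a := by
      rw [hF1, hW1, hR1]
      rcases S.rowEx a with h1 | ⟨h, h1, h2⟩
      · exact absurd h1 hRa
      · exact ⟨h, (Search.lt_of_ne_top S (h2 ▸ hRa)).2, h1, h2⟩
    refine Run.seq ((run_findColumn (hA.frame f1 (by simp)) ha hex).mono le_rfl ?_)
    rintro m₂ ⟨f2, c1, c2⟩
    obtain ⟨b, hb⟩ : ∃ b, cell m₂ vB 0 0 = b := ⟨_, rfl⟩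
    rw [hb, hF1] at c1
    rw [hb, hW1, hR1] at c2
    have hWab : decW m a b ≠ ⊤ := c2 ▸ hRa
    have hbM := (Search.lt_of_ne_top S hWab).2
    have f02 : Frame [aW, aR, aZ, aF, vA, vB, vC, vD, vH, vV] m m₂ :=
      (f1.mono (by simp)).trans (f2.mono (by simp))
    have ha2 : cell m₂ vA 0 0 = a := by rw [f2 _ (by simp), ha]
    have hA2 : Stored A m₂ := hA.frame f02 (by simp)
    refine Run.seq (Run.of_exec rfl (Nat.le_of_ble_eq_true rfl) ?_)
    simp only [markPair, exec_wr, eval_var, ha2, hb, RamExpr.eval]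
    set m₃ := setCell m₂ aF a b 1 with hm₃
    have f3 : Frame [aF] m₂ m₃ := (Frame.refl _ _).setCell (by simp) _ _ _
    have hF3 : ∀ d h, Finished m₃ d h ↔ Finished m d h ∨ (d = a ∧ h = b) := by
      intro d h
      rw [← hF1, ← Finished_frame f2 (by simp)]
      simp only [Finished, hm₃, cell_setCell, true_and]
      split_ifs with he <;> simp [he]
    have hW3 : decW m₃ = decW m := by
      rw [decW_frame f3 (by simp), decW_frame f2 (by simp), hW1]
    have hZ3 : decZ m₃ = decZ m := by
      rw [decZ_frame f3 (by simp), decZ_frame f2 (by simp), hZ1]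
    have hR3 : decR m₃ = decR m := by
      rw [decR_frame f3 (by simp), decR_frame f2 (by simp), hR1]
    have ha3 : cell m₃ vA 0 0 = a := by rw [f3 _ (by simp), ha2]
    have hb3 : cell m₃ vB 0 0 = b := by rw [f3 _ (by simp), hb]
    have hA3 : Stored A m₃ := hA2.frame f3 (by simp)
    refine Run.seq ((run_updateMin hA3 ha3 ?_).mono le_rfl ?_)
    · intro h hh
      rw [hW3]
      by_contra ht
      exact absurd (Search.lt_of_ne_top S ht).2 (not_lt.2 hh)
    rintro m₄ ⟨f4, u1, u2, u3⟩
    rw [hW3] at u2 u3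
    rw [hR3] at u1
    have hF4 : Finished m₄ = Finished m₃ := Finished_frame f4 (by simp)
    have S4 : SearchAt A m₄ (Finished m) (decW m a b) := by
      rw [SearchAt, decW_frame f4 (by simp), hW3, decZ_frame f4 (by simp), hZ3, hF4]
      exact Search.finish S hF3 c1 c2 (fun d hd => by simpa only [hR1] using r2 d hd) u1 u2 u3
    have hfin4 : Finished m₄ a b := by
      rw [hF4, hF3]
      exact .inr ⟨rfl, rfl⟩
    have ha4 : cell m₄ vA 0 0 = a := by rw [f4 _ (by simp), ha3]
    have hb4 : cell m₄ vB 0 0 = b := by rw [f4 _ (by simp), hb3]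
    have hA4 : Stored A m₄ := by
      refine (hA3.frame (K := [20, 21, 22, 23, vH]) (f4.mono (by simp)) (by simp))
    have hW4 : decW m₄ a b = decW m a b := by rw [decW_frame f4 (by simp), hW3]
    refine Run.seq ((run_relaxCancel hA4 S4 ha4 hb4 hbM hW4 hWab hfin4 (hD b)).mono le_rfl ?_)
    rintro m₅ ⟨f5, S5, z5, w5⟩
    have hF5 : Finished m₅ = Finished m₄ := Finished_frame f5 (by simp)
    have ha5 : cell m₅ vA 0 0 = a := by rw [f5 _ (by simp), ha4]
    have hb5 : cell m₅ vB 0 0 = b := by rw [f5 _ (by simp), hb4]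
    refine (run_relaxRow (hA4.frame f5 (by simp)) S5 ha5 hb5 w5 (by rwa [hF5])).mono le_rfl ?_
    rintro m₆ ⟨f6, S6, w6, w6'⟩
    have hF6 : Finished m₆ = Finished m₃ := by rw [Finished_frame f6 (by simp), hF5, hF4]
    have f26 : Frame [aW, aR, aZ, aF, vA, vB, vC, vD, vH, vV] m₂ m₆ :=
      (((f3.mono (by simp)).trans (f4.mono (by simp))).trans (f5.mono (by simp))).trans
        (f6.mono (by simp))
    refine ⟨f02.trans f26, ⟨decW m a b, Search.close S6 (a := a) (b := b) ?_ ?_ ?_⟩, .inr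
      ⟨a, b, r1, hbM, hWab, c1, ?_⟩⟩
    · intro d h
      rw [hF6, hF3]
      exact id
    · rw [decZ_frame f6 (by simp), w6']
      exact w6
    · rw [decZ_frame f6 (by simp), w6']
      exact z5
    · rw [hF6]
      exact hF3
  · simp only [eval_rd, eval_var, ha, RamExpr.eval] at h0
    have hRa : decR m a = ⊤ := by
      rw [← hR1, decR, dec_eq_top]
      exact h0
    refine Run.of_exec rfl (by simp [RamProg.wcet]; omega) ?_
    simp only [exec]
    refine ⟨f1.mono (by simp), ⟨μ, ?_⟩, .inl ?_⟩
    · rw [hF1]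
      exact S1
    · intro d h
      rw [hF1, hW1]
      intro hF
      by_contra ht
      have h1 := S.rowLe d h hF
      have h2 := r2 d (Search.lt_of_ne_top S ht).1
      rw [hRa, top_le_iff] at h2
      rw [h2, top_le_iff] at h1
      exact ht h1

/-- Enter the bridges that consist of a single step. -/
def initSearch : RamProg :=
  .forLoop vD vM (.forLoop vH vM (.cond (stepE (.var vD) (.var vH))
    (.seq (.wr aW (.var vD) (.var vH) (.lit 1)) (.wr1 aR (.var vD) (.lit 1))) .skip))

theorem run_initSearch {inp : List ℕ} {A : WalkTable} {m : ℕ → ℕ} (hA : Stored A m)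
    (h0 : ∀ k ∈ [aW, aZ, aF, aR], ∀ a b, cell m k a b = 0) :
    Run inp initSearch m (A.M * (A.M * 1000 + 21) + 9) (fun m' =>
      Frame [aW, aR, vD, vH] m m' ∧ SearchAt A m' (Finished m') 0 ∧
      ∀ d h, ¬ Finished m' d h) := by
  -- the entries for the pairs `(d, h)` with `P d h` have been made
  let J : (ℕ → ℕ → Prop) → (ℕ → ℕ) → Prop := fun P m' =>
    Frame [aW, aR, vD, vH] m m' ∧
    (∀ d h, cell m' aW d h = 0 ∨ (cell m' aW d h = 1 ∧ A.Step d h)) ∧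
    (∀ d h, P d h → A.Step d h → cell m' aW d h = 1) ∧
    ∀ d, (cell m' aR d 0 = 0 ∧ ∀ h, cell m' aW d h = 0) ∨
      (cell m' aR d 0 = 1 ∧ ∃ h, cell m' aW d h = 1)
  have Jvar : ∀ P m' k v, J P m' → k = vD ∨ k = vH → J P (setCell m' k 0 0 v) := by
    rintro P m' k v ⟨j1, j2, j3, j4⟩ hk
    have hne : aW ≠ k ∧ aR ≠ k := by omega
    refine ⟨j1.setCell (by rcases hk with rfl | rfl <;> simp) _ _ _, ?_⟩
    simpa [cell_setCell, hne.1, hne.2] using ⟨j2, j3, j4⟩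
  have Jmono : ∀ P P' m', J P m' → (∀ d h, P' d h → A.Step d h → P d h) → J P' m' :=
    fun P P' m' hJ h => ⟨hJ.1, hJ.2.1, fun d e h1 h2 => hJ.2.2.1 d e (h d e h1 h2) h2, hJ.2.2.2⟩
  refine (Run.forLoop_const A.M (A.M * 1000 + 9) (fun i m' => cell m' vD 0 0 = i ∧
    J (fun d _ => d < i) m') ?_ ?_ ?_).mono (by nlinarith) ?_
  · refine ⟨by simp [cell_setCell], Jvar _ _ _ _ ⟨Frame.refl _ _, ?_, ?_, ?_⟩ (.inl rfl)⟩
    · exact fun d h => .inl (h0 _ (by simp) _ _)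
    · exact fun d h hd => absurd hd (by omega)
    · exact fun d => .inl ⟨h0 _ (by simp) _ _, fun h => h0 _ (by simp) _ _⟩
  · rintro i m' ⟨h1, h2⟩
    exact ⟨h1, by rw [h2.1 _ (by simp), hA.M]⟩
  · rintro i m' hi ⟨h1, h2⟩
    refine (Run.forLoop_const A.M 988 (fun j m' => cell m' vH 0 0 = j ∧ cell m' vD 0 0 = i ∧
      J (fun d h => d < i ∨ (d = i ∧ h < j)) m') ?_ ?_ ?_).mono le_rfl ?_
    · refine ⟨by simp [cell_setCell], by simp [cell_setCell, h1], Jvar _ _ _ _ ?_ (.inr rfl)⟩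
      exact Jmono _ _ _ h2 fun d h hd _ => by omega
    · rintro j m' ⟨h1, -, h2⟩
      exact ⟨h1, by rw [h2.1 _ (by simp), hA.M]⟩
    · rintro j m' hj ⟨g1, g2, hJ⟩
      refine Run.of_exec rfl (Nat.le_of_ble_eq_true rfl) ?_
      have t := eval_stepE (hA.frame hJ.1 (by simp)) inp (.var vD) (.var vH)
        (by simpa [g2]) (by simpa [g1])
      simp only [eval_var, g1, g2] at t
      simp only [exec]
      by_cases hs : A.Step i j
      · rw [if_neg (t.2 hs)]
        simp only [exec_wr, eval_var, RamExpr.eval, g1, g2]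
        have g2' : cell (setCell m' aW i j 1) vD 0 0 = i := by simp [cell_setCell, g2]
        rw [g2']
        refine ⟨by simp [cell_setCell, g1], by simp [cell_setCell], by simp [cell_setCell, g2],
          Jvar _ _ _ _ ⟨?_, ?_, ?_, ?_⟩ (.inr rfl)⟩
        · exact (hJ.1.setCell (by simp) _ _ _).setCell (by simp) _ _ _
        · intro d h
          simp only [cell_setCell, Nat.reduceEqDiff, false_and, if_false, true_and]
          split_ifs with he
          · rw [he.1, he.2]
            exact .inr ⟨rfl, hs⟩
          · exact hJ.2.1 d h
        · intro d h hd hs'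
          simp only [cell_setCell, Nat.reduceEqDiff, false_and, if_false, true_and]
          split_ifs with he
          · rfl
          · exact hJ.2.2.1 d h (by omega) hs'
        · intro d
          simp only [cell_setCell, Nat.reduceEqDiff, false_and, if_false, true_and, and_true]
          by_cases hd : d = i
          · subst hd
            exact .inr ⟨by simp, j, by simp⟩
          · simpa [hd] using hJ.2.2.2 d
      · rw [if_pos (by simpa using mt t.1 hs)]
        refine ⟨g1, by simp [cell_setCell], by simp [cell_setCell, g2],
          Jvar _ _ _ _ (Jmono _ _ _ hJ fun d h hd hs' => ?_) (.inr rfl)⟩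
        rcases hd with hd | ⟨rfl, hd⟩
        · exact .inl hd
        · rcases Nat.lt_succ_iff_lt_or_eq.1 hd with hd | rfl
          · exact .inr ⟨rfl, hd⟩
          · exact absurd hs' hs
    · rintro m'' ⟨-, g2, hJ⟩
      refine ⟨g2, by simp [cell_setCell], Jvar _ _ _ _ (Jmono _ _ _ hJ fun d h hd hs => ?_)
        (.inl rfl)⟩
      have := hs.2.1
      omega
  · rintro m' ⟨-, j1, j2, j3, j4⟩
    have hF : ∀ d h, ¬ Finished m' d h := by
      intro d h
      simp [Finished, j1 aF (by simp), h0 aF (by simp)]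
    have hZ : ∀ e h, decZ m' e h = ⊤ := by
      intro d h
      simp [decZ, j1 aZ (by simp), h0 aZ (by simp), dec_zero]
    have d1 : dec 1 = 0 := by simp [dec]
    refine ⟨j1, ?_, hF⟩
    constructor
    · intro d h w hw
      rcases j2 d h with hd | ⟨hd, hs⟩ <;> rw [decW, hd] at hw
      · simp [dec_zero] at hw
      · rw [d1] at hw
        obtain rfl : w = 0 := by exact_mod_cast hw.symm
        exact .step hs
    · intro e h z hz
      rw [hZ] at hz
      simp at hz
    · intro d h hs
      rw [decW, j3 d h hs.1 hs, d1]
    · exact fun d e h hd => absurd hd (hF _ _)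
    · exact fun d e h hd => absurd hd (hF _ _)
    · exact fun d h hd => absurd hd (hF _ _)
    · exact fun _ _ _ => zero_le
    · intro d h _
      rcases j4 d with ⟨-, h1⟩ | ⟨h1, -⟩
      · rw [decW, h1, dec_zero]
        exact le_top
      · rw [decR, h1, d1]
        exact zero_le
    · intro d
      rcases j4 d with ⟨h1, -⟩ | ⟨h1, h, h2⟩
      · exact .inl (by rw [decR, h1, dec_zero])
      · exact .inr ⟨h, hF _ _, by rw [decR, decW, h1, h2]⟩
    · exact fun _ _ h => h

/-- The search. -/
def searchAll : RamProg :=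
  .seq initSearch (.seq (.set vMM (.mul (.var vM) (.var vM))) (.forLoop vIt vMM searchRound))

open Classical in
/-- The number of the finished pairs of states. -/
noncomputable def numFinished (A : WalkTable) (m : ℕ → ℕ) : ℕ :=
  ((Finset.range A.M ×ˢ Finset.range A.M).filter fun p => Finished m p.1 p.2).card

/-- As long as the search is not exhausted, each round finishes one more of the `M²` pairs. -/
theorem run_searchAll {inp : List ℕ} {A : WalkTable} {m : ℕ → ℕ} {D : ℕ} (hA : Stored A m)
    (hM : 0 < A.M) (h0 : ∀ k ∈ [aW, aZ, aF, aR], ∀ a b, cell m k a b = 0)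
    (hD : ∀ b, Set.ncard {t | A.Step b t} ≤ D) :
    Run inp searchAll m (30000 * (D + 1) * A.M ^ 3) (fun m' =>
      ∀ d h, (∀ w, A.Bridge d h w → decW m' d h ≤ w) ∧
        ∀ w : ℕ, decW m' d h = w → A.Bridge d h w) := by
  classical
  refine Run.mono (T := (A.M * (A.M * 1000 + 21) + 9) + (100 +
    (A.M * A.M * (A.M * 5000 + D * (A.M * 1500 + 300) + 5000 + 12) + 9))) ?_ ?_ fun _ h => h
  swap
  · obtain ⟨k, hk⟩ := Nat.exists_eq_add_of_lt hM
    rw [zero_add] at hk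
    rw [hk]
    ring_nf
    nlinarith [Nat.zero_le k, Nat.zero_le D, Nat.zero_le (D * k), Nat.zero_le (D * k ^ 2),
      Nat.zero_le (D * k ^ 3), Nat.zero_le (k ^ 2), Nat.zero_le (k ^ 3)]
  refine Run.seq ((run_initSearch hA h0).mono le_rfl ?_)
  rintro m₁ ⟨f1, S1, hF1⟩
  refine Run.seq (Run.of_exec rfl (Nat.le_of_ble_eq_true rfl) ?_)
  have hA1 : Stored A m₁ := by
    exact hA.frame (K := [aW, aR, vD, vH]) f1 (by simp)
  simp only [exec_set, eval_var, RamExpr.eval, hA1.M]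
  set m₂ := setCell m₁ vMM 0 0 (A.M * A.M) with hm₂
  have f2 : Frame [vMM] m₁ m₂ := (Frame.refl _ _).setCell (by simp) _ _ _
  have hA2 : Stored A m₂ := hA1.frame f2 (by simp)
  have fin : ∀ m₃ m₄, Finished m₃ = Finished m₄ → numFinished A m₃ = numFinished A m₄ := by
    intro m₃ m₄ h
    unfold numFinished
    rw [h]
  refine (Run.forLoop_const (A.M * A.M) (A.M * 5000 + D * (A.M * 1500 + 300) + 5000)
    (fun i m' => cell m' vIt 0 0 = i ∧ cell m' vMM 0 0 = A.M * A.M ∧ Stored A m' ∧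
      (∃ μ, SearchAt A m' (Finished m') μ) ∧ (Exhausted m' ∨ i ≤ numFinished A m'))
    ?_ ?_ ?_).mono le_rfl ?_
  · have f3 : Frame [vIt] m₂ (setCell m₂ vIt 0 0 0) := (Frame.refl _ _).setCell (by simp) _ _ _
    refine ⟨by simp [cell_setCell], by simp [cell_setCell, hm₂], hA2.frame f3 (by simp), ⟨0, ?_⟩,
      .inr (Nat.zero_le _)⟩
    rw [Finished_frame f3 (by simp), Finished_frame f2 (by simp)]
    exact (S1.frame f2 (by simp)).frame f3 (by simp)
  · rintro i m' ⟨h1, h2, -⟩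
    exact ⟨h1, h2⟩
  · rintro i m' hi ⟨h1, h2, h3, ⟨μ, h4⟩, h5⟩
    refine (run_searchRound h3 hM h4 hD).mono le_rfl ?_
    rintro m'' ⟨f, ⟨μ', S'⟩, hor⟩
    have f3 : Frame [vIt] m'' (setCell m'' vIt 0 0 (i + 1)) :=
      (Frame.refl _ _).setCell (by simp) _ _ _
    have hF : Finished (setCell m'' vIt 0 0 (i + 1)) = Finished m'' := Finished_frame f3 (by simp)
    have hW : decW (setCell m'' vIt 0 0 (i + 1)) = decW m'' := decW_frame f3 (by simp)
    refine ⟨by rw [f _ (by simp), h1], by simp [cell_setCell], ?_, ?_, ⟨μ', ?_⟩, ?_⟩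
    · rw [f3 _ (by simp), f _ (by simp), h2]
    · exact (h3.frame f (by simp)).frame f3 (by simp)
    · rw [hF]
      exact S'.frame f3 (by simp)
    · unfold Exhausted
      rw [hF, hW, fin _ _ hF]
      rcases hor with hor | ⟨a, b, ha, hb, hab, hn, hiff⟩
      · exact .inl hor
      · refine .inr ?_
        rcases h5 with h5 | h5
        · exact absurd (h5 a b hn) hab
        · refine Nat.succ_le_of_lt (h5.trans_lt (Finset.card_lt_card ?_))
          rw [Finset.ssubset_iff_of_subset]
          · exact ⟨(a, b), by simp [ha, hb, hiff], by simp [hn]⟩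
          · intro p hp
            simp only [Finset.mem_filter] at hp ⊢
            exact ⟨hp.1, (hiff _ _).2 (.inl hp.2)⟩
  · rintro m' ⟨-, -, -, ⟨μ, S⟩, h5⟩ d h
    refine Search.isLeast S ?_ d h
    rcases h5 with h5 | h5
    · exact h5
    · -- all pairs are finished
      intro d h hF
      by_contra ht
      obtain ⟨h1, h2⟩ := Search.lt_of_ne_top S ht
      have hall := Finset.filter_card_eq (s := Finset.range A.M ×ˢ Finset.range A.M)
        (p := fun p => Finished m' p.1 p.2) (le_antisymm (Finset.card_filter_le _ _) (by
          rw [Finset.card_product, Finset.card_range]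
          exact h5))
      exact hF (hall (d, h) (by simp [h1, h2]))

end WalkTable

local notation "tTwin" => 8
local notation "vN" => 9
local notation "vI" => 10
local notation "vRR" => 11
local notation "vQ" => 12
local notation "vJ" => 13
local notation "vLen" => 14
local notation "vP" => 15
local notation "vS" => 16
local notation "vFst" => 17
local notation "vLst" => 18
local notation "vCst" => 19

/-! ### The tables of the petal graph -/

namespace Petal

/-- The index in the input of the entry with the length of the word number `j`, if the word number
`i` has length `len i`. -/
def off (len : ℕ → ℕ) : ℕ → ℕ
  | 0 => 2
  | j + 1 => off len j + 1 + len j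

/-- The index in the input of the letter number `p` of the word number `j`. -/
def pos (len : ℕ → ℕ) (j p : ℕ) : ℕ := off len j + 1 + p

theorem off_mono (len : ℕ → ℕ) {i j : ℕ} (h : i ≤ j) : off len i ≤ off len j := by
  induction h with
  | refl => exact le_rfl
  | step _ ih => exact ih.trans (by simp only [off]; omega)

theorem two_le_off (len : ℕ → ℕ) (j : ℕ) : 2 ≤ off len j := off_mono len (Nat.zero_le j)

theorem pos_lt_pos {len : ℕ → ℕ} {j' p' j p : ℕ}
    (h : (j' < j ∧ p' < len j') ∨ (j' = j ∧ p' < p)) : pos len j' p' < pos len j p := by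
  unfold pos
  rcases h with ⟨h1, h2⟩ | ⟨rfl, h2⟩
  · have h3 := off_mono len (Nat.succ_le_of_lt h1)
    simp only [off] at h3
    omega
  · omega

theorem pos_inj {len : ℕ → ℕ} {j' p' j p : ℕ} (hp' : p' < len j') (hp : p < len j)
    (h : pos len j' p' = pos len j p) : j' = j ∧ p' = p := by
  rcases lt_trichotomy j' j with hj | rfl | hj
  · exact absurd h (pos_lt_pos (.inl ⟨hj, hp'⟩)).ne
  · refine ⟨rfl, ?_⟩
    unfold pos at h
    omega
  · exact absurd h (pos_lt_pos (.inl ⟨hj, hp⟩)).ne'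

theorem pos_lt_off {len : ℕ → ℕ} {r j p : ℕ} (hj : j ≤ r) (hp : p < len j) :
    pos len j p < off len (r + 1) := by
  have h3 := off_mono len (Nat.succ_le_succ hj)
  simp only [off, pos] at h3 ⊢
  omega

/-- The code of the inverse of the letter with code `c`. -/
def twin (c : ℕ) : ℕ := if c % 2 = 0 then c + 1 else c - 1

/-- The table of the petal graph of `r + 1` words: the word number `j` has length `len j`, and its
letter number `p` has code `cc j p`. A letter occurrence at the index `k` of the input gives the two
states `2 * k` (passed forwards) and `2 * k + 1` (passed backwards). The entry states are those of
the first letters of the words and their inverses, the exit states those of the last letters, where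
the state `0` is an additional exit state, and `1` an additional entry state. The cost counts the
passages through the word number `r`. -/
structure IsTable (A : WalkTable) (r : ℕ) (len : ℕ → ℕ) (cc : ℕ → ℕ → ℕ) : Prop where
  M : A.M = 2 * off len (r + 1)
  lab : ∀ j ≤ r, ∀ p < len j, A.lab (2 * pos len j p) = cc j p + 1 ∧
    A.lab (2 * pos len j p + 1) = twin (cc j p) + 1
  rev : ∀ j ≤ r, ∀ p < len j, A.rev (2 * pos len j p) = 2 * pos len j p + 1 ∧
    A.rev (2 * pos len j p + 1) = 2 * pos len j p
  nxt : ∀ j ≤ r, ∀ p < len j, A.nxt (2 * pos len j p) = 2 * pos len j p + 2 ∧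
    A.nxt (2 * pos len j p + 1) = 2 * pos len j p - 1
  en : ∀ j ≤ r, ∀ p < len j, (A.en (2 * pos len j p) ≠ 0 ↔ p = 0) ∧
    (A.en (2 * pos len j p + 1) ≠ 0 ↔ p + 1 = len j)
  ex : ∀ j ≤ r, ∀ p < len j, (A.ex (2 * pos len j p) ≠ 0 ↔ p + 1 = len j) ∧
    (A.ex (2 * pos len j p + 1) ≠ 0 ↔ p = 0)
  cst : ∀ j ≤ r, ∀ p < len j, A.cst (2 * pos len j p) = (if p = 0 ∧ j = r then 1 else 0) ∧
    A.cst (2 * pos len j p + 1) = (if p = 0 ∧ j = r then 1 else 0)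
  of_lab : ∀ s, A.lab s ≠ 0 → ∃ j ≤ r, ∃ p < len j, s = 2 * pos len j p ∨ s = 2 * pos len j p + 1
  of_en : ∀ s, A.en s ≠ 0 → s = 1 ∨
    ∃ j ≤ r, ∃ p < len j, s = 2 * pos len j p ∨ s = 2 * pos len j p + 1
  ex_zero : A.ex 0 ≠ 0
  en_one : A.en 1 ≠ 0
  rev_zero : A.rev 0 = 1

theorem IsTable.ncard_step_le {A : WalkTable} {r : ℕ} {len : ℕ → ℕ} {cc : ℕ → ℕ → ℕ}
    (hA : IsTable A r len cc) (b : ℕ) : Set.ncard {t | A.Step b t} ≤ 2 * (r + 1) + 2 := by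
  set E : Finset ℕ := insert 1 (insert (A.nxt b)
    ((Finset.range (r + 1)).image (fun j => 2 * pos len j 0) ∪
      (Finset.range (r + 1)).image (fun j => 2 * pos len j (len j - 1) + 1))) with hE
  have hsub : {t | A.Step b t} ⊆ (E : Set ℕ) := by
    rintro t ⟨-, -, ht⟩
    rw [hE, Finset.mem_coe]
    simp only [Finset.mem_insert, Finset.mem_union, Finset.mem_image, Finset.mem_range]
    split_ifs at ht with hb
    · rcases hA.of_en t ht.1 with h | ⟨j, hj, p, hp, h | h⟩
      · exact .inl h
      · refine .inr (.inr (.inl ⟨j, by omega, ?_⟩))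
        rw [h, ((hA.en j hj p hp).1.1 (h ▸ ht.1))]
      · refine .inr (.inr (.inr ⟨j, by omega, ?_⟩))
        have := (hA.en j hj p hp).2.1 (h ▸ ht.1)
        rw [h, show len j - 1 = p by omega]
    · exact .inr (.inl ht)
  refine (Set.ncard_le_ncard hsub E.finite_toSet).trans ?_
  rw [Set.ncard_coe_finset]
  refine (Finset.card_insert_le _ _).trans ?_
  have h1 := Finset.card_insert_le (A.nxt b)
    ((Finset.range (r + 1)).image (fun j => 2 * pos len j 0) ∪
      (Finset.range (r + 1)).image (fun j => 2 * pos len j (len j - 1) + 1))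
  have h2 := Finset.card_union_le ((Finset.range (r + 1)).image (fun j => 2 * pos len j 0))
    ((Finset.range (r + 1)).image (fun j => 2 * pos len j (len j - 1) + 1))
  have h3 := Finset.card_image_le (s := Finset.range (r + 1)) (f := fun j => 2 * pos len j 0)
  have h4 := Finset.card_image_le (s := Finset.range (r + 1))
    (f := fun j => 2 * pos len j (len j - 1) + 1)
  rw [Finset.card_range] at h3 h4
  omega

/-! ### The computation of the tables -/

open RamExpr RamProg

/-- The table that is stored in the memory `m`. -/
def tableOf (m : ℕ → ℕ) : WalkTable where
  M := cell m vM 0 0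
  lab s := cell m tLab s 0
  en s := cell m tEn s 0
  ex s := cell m tEx s 0
  rev s := cell m tRev s 0
  nxt s := cell m tNxt s 0
  cst s := cell m tCst s 0

theorem stored_tableOf (m : ℕ → ℕ) : (tableOf m).Stored m :=
  ⟨rfl, fun _ => rfl, fun _ => rfl, fun _ => rfl, fun _ => rfl, fun _ => rfl, fun _ => rfl⟩

/-- Compute the codes of the inverses of the letters. -/
def twinTable : RamProg :=
  .forLoop vI vN (.seq
    (.wr1 tTwin (.add (.var vI) (.var vI)) (.add (.add (.var vI) (.var vI)) (.lit 1)))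
    (.wr1 tTwin (.add (.add (.var vI) (.var vI)) (.lit 1)) (.add (.var vI) (.var vI))))

theorem run_twinTable {inp : List ℕ} {m : ℕ → ℕ} {n : ℕ} (hn : cell m vN 0 0 = n) :
    Run inp twinTable m (n * 300 + 9) (fun m' => Frame [tTwin, vI] m m' ∧
      ∀ c < 2 * n, cell m' tTwin c 0 = twin c) := by
  refine (Run.forLoop_const n 288 (fun i m' => cell m' vI 0 0 = i ∧ Frame [tTwin, vI] m m' ∧
    ∀ c < 2 * i, cell m' tTwin c 0 = twin c) ?_ ?_ ?_).mono le_rfl ?_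
  · exact ⟨by simp [cell_setCell], (Frame.refl _ _).setCell (by simp) _ _ _,
      fun d hd => absurd hd (by omega)⟩
  · rintro i m' ⟨h1, h2, -⟩
    exact ⟨h1, by rw [h2 _ (by simp), hn]⟩
  · rintro i m' hi ⟨h1, h2, h3⟩
    refine Run.of_exec rfl (Nat.le_of_ble_eq_true rfl) ?_
    simp only [exec, exec_wr, RamExpr.eval, eval_var, h1]
    have e1 : cell (setCell m' tTwin (i + i) 0 (i + i + 1)) vI 0 0 = i := by
      simp [cell_setCell, h1]
    simp only [e1]
    refine ⟨by simp [cell_setCell, h1], by simp [cell_setCell],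
      ((h2.setCell (by simp) _ _ _).setCell (by simp) _ _ _).setCell (by simp) _ _ _, ?_⟩
    intro c hc
    simp only [cell_setCell, Nat.reduceEqDiff, false_and, if_false, true_and, and_true]
    split_ifs with ha hb
    · rw [ha, twin, if_neg (by omega)]
      rfl
    · rw [hb, twin, if_pos (by omega)]
    · exact h3 c (by omega)
  · rintro m' ⟨-, h2, h3⟩
    exact ⟨h2, h3⟩

/-- Enter the data of the letter number `p` of the word number `j`. -/
def enterLetter : RamProg :=
  .seq (.set vS (.mul (.lit 2) (.add (.add (.var vQ) (.lit 1)) (.var vP))))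
  (.seq (.set vFst (.sub (.lit 1) (.var vP)))
  (.seq (.set vLst (eqE (.add (.var vP) (.lit 1)) (.var vLen)))
  (.seq (.set vCst (.mul (.var vFst) (eqE (.add (.var vJ) (.lit 1)) (.var vRR))))
  (.seq (.wr1 tLab (.var vS) (.add (.inp (.add (.add (.var vQ) (.lit 1)) (.var vP))) (.lit 1)))
  (.seq (.wr1 tLab (.add (.var vS) (.lit 1))
    (.add (.rd1 tTwin (.inp (.add (.add (.var vQ) (.lit 1)) (.var vP)))) (.lit 1)))
  (.seq (.wr1 tRev (.var vS) (.add (.var vS) (.lit 1)))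
  (.seq (.wr1 tRev (.add (.var vS) (.lit 1)) (.var vS))
  (.seq (.wr1 tNxt (.var vS) (.add (.var vS) (.lit 2)))
  (.seq (.wr1 tNxt (.add (.var vS) (.lit 1)) (.sub (.var vS) (.lit 1)))
  (.seq (.wr1 tEn (.var vS) (.var vFst))
  (.seq (.wr1 tEn (.add (.var vS) (.lit 1)) (.var vLst))
  (.seq (.wr1 tEx (.var vS) (.var vLst))
  (.seq (.wr1 tEx (.add (.var vS) (.lit 1)) (.var vFst))
  (.seq (.wr1 tCst (.var vS) (.var vCst))
    (.wr1 tCst (.add (.var vS) (.lit 1)) (.var vCst))))))))))))))))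

/-- The data of the letter number `p` of the word number `j` are in the memory. -/
structure LetterAt (m : ℕ → ℕ) (r : ℕ) (len : ℕ → ℕ) (cc : ℕ → ℕ → ℕ) (j p : ℕ) : Prop where
  lab : cell m tLab (2 * pos len j p) 0 = cc j p + 1 ∧
    cell m tLab (2 * pos len j p + 1) 0 = twin (cc j p) + 1
  rev : cell m tRev (2 * pos len j p) 0 = 2 * pos len j p + 1 ∧
    cell m tRev (2 * pos len j p + 1) 0 = 2 * pos len j p
  nxt : cell m tNxt (2 * pos len j p) 0 = 2 * pos len j p + 2 ∧
    cell m tNxt (2 * pos len j p + 1) 0 = 2 * pos len j p - 1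
  en : (cell m tEn (2 * pos len j p) 0 ≠ 0 ↔ p = 0) ∧
    (cell m tEn (2 * pos len j p + 1) 0 ≠ 0 ↔ p + 1 = len j)
  ex : (cell m tEx (2 * pos len j p) 0 ≠ 0 ↔ p + 1 = len j) ∧
    (cell m tEx (2 * pos len j p + 1) 0 ≠ 0 ↔ p = 0)
  cst : cell m tCst (2 * pos len j p) 0 = (if p = 0 ∧ j = r then 1 else 0) ∧
    cell m tCst (2 * pos len j p + 1) 0 = (if p = 0 ∧ j = r then 1 else 0)

theorem LetterAt.congr {m m' : ℕ → ℕ} {r : ℕ} {len : ℕ → ℕ} {cc : ℕ → ℕ → ℕ} {j p : ℕ}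
    (h : LetterAt m r len cc j p)
    (hm : ∀ k, 2 ≤ k → k < 8 → ∀ s, s = 2 * pos len j p ∨ s = 2 * pos len j p + 1 →
      cell m' k s 0 = cell m k s 0) : LetterAt m' r len cc j p := by
  have h1 : ∀ k, 2 ≤ k → k < 8 → cell m' k (2 * pos len j p) 0 = cell m k (2 * pos len j p) 0 :=
    fun k hk hk' => hm k hk hk' _ (.inl rfl)
  have h2 : ∀ k, 2 ≤ k → k < 8 → cell m' k (2 * pos len j p + 1) 0 = cell m k (2 * pos len j p + 1) 0 :=
    fun k hk hk' => hm k hk hk' _ (.inr rfl)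
  constructor
  all_goals rw [h1 _ (by norm_num) (by norm_num), h2 _ (by norm_num) (by norm_num)]
  exacts [h.lab, h.rev, h.nxt, h.en, h.ex, h.cst]

/-- Exactly the letters in `P` have been entered into the tables. -/
structure Entered (m : ℕ → ℕ) (r : ℕ) (len : ℕ → ℕ) (cc : ℕ → ℕ → ℕ) (P : ℕ → ℕ → Prop) :
    Prop where
  letter : ∀ j p, P j p → LetterAt m r len cc j p
  of_lab : ∀ s, cell m tLab s 0 ≠ 0 →
    ∃ j p, P j p ∧ (s = 2 * pos len j p ∨ s = 2 * pos len j p + 1)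
  of_en : ∀ s, cell m tEn s 0 ≠ 0 → s = 1 ∨
    ∃ j p, P j p ∧ (s = 2 * pos len j p ∨ s = 2 * pos len j p + 1)
  ex_zero : cell m tEx 0 0 = 1
  en_one : cell m tEn 1 0 = 1
  rev_zero : cell m tRev 0 0 = 1

theorem Entered.congr {m m' : ℕ → ℕ} {r : ℕ} {len : ℕ → ℕ} {cc : ℕ → ℕ → ℕ}
    {P P' : ℕ → ℕ → Prop} (h : Entered m r len cc P)
    (hm : ∀ k, 2 ≤ k → k < 8 → ∀ s, cell m' k s 0 = cell m k s 0) (hP : ∀ j p, P j p ↔ P' j p) :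
    Entered m' r len cc P' := by
  have : P = P' := by
    funext j p
    exact propext (hP j p)
  subst this
  constructor
  · exact fun j p hjp => (h.letter j p hjp).congr fun k hk hk' s _ => hm k hk hk' s
  · intro s
    rw [hm _ (by norm_num) (by norm_num)]
    exact h.of_lab s
  · intro s
    rw [hm _ (by norm_num) (by norm_num)]
    exact h.of_en s
  · rw [hm _ (by norm_num) (by norm_num), h.ex_zero]
  · rw [hm _ (by norm_num) (by norm_num), h.en_one]
  · rw [hm _ (by norm_num) (by norm_num), h.rev_zero]

/-- The letters must be entered in the order of their positions. -/
theorem run_enterLetter {inp : List ℕ} {m : ℕ → ℕ} {r : ℕ} {len : ℕ → ℕ} {cc : ℕ → ℕ → ℕ}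
    {P : ℕ → ℕ → Prop} {j p : ℕ} (hE : Entered m r len cc P)
    (hP : ∀ j' p', P j' p' → pos len j' p' < pos len j p) (hp : p < len j) (hj : j ≤ r)
    (hQ : cell m vQ 0 0 = off len j) (hvP : cell m vP 0 0 = p) (hL : cell m vLen 0 0 = len j)
    (hJ : cell m vJ 0 0 = j) (hR : cell m vRR 0 0 = r + 1) (hc : inp.getD (pos len j p) 0 = cc j p)
    (ht : cell m tTwin (cc j p) 0 = twin (cc j p)) :
    Run inp enterLetter m 5000 (fun m' =>
      Frame [tLab, tRev, tNxt, tEn, tEx, tCst, vS, vFst, vLst, vCst] m m' ∧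
      Entered m' r len cc fun j' p' => P j' p' ∨ (j' = j ∧ p' = p)) := by
  refine Run.of_exec rfl (Nat.le_of_ble_eq_true rfl) ?_
  have hpos : off len j + 1 + p = pos len j p := rfl
  have h3 : 3 ≤ pos len j p := by have := two_le_off len j; omega
  obtain ⟨k, hk⟩ : ∃ k, pos len j p = k := ⟨_, rfl⟩
  rw [hk] at hc
  -- the effect on the tables
  have key : ∀ m', Frame [tLab, tRev, tNxt, tEn, tEx, tCst, vS, vFst, vLst, vCst] m m' →
      (∀ x, cell m' tLab x 0 = if x = 2 * k + 1 then twin (cc j p) + 1 else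
        if x = 2 * k then cc j p + 1 else cell m tLab x 0) →
      (∀ x, cell m' tRev x 0 = if x = 2 * k + 1 then 2 * k else
        if x = 2 * k then 2 * k + 1 else cell m tRev x 0) →
      (∀ x, cell m' tNxt x 0 = if x = 2 * k + 1 then 2 * k - 1 else
        if x = 2 * k then 2 * k + 2 else cell m tNxt x 0) →
      (∀ x, cell m' tEn x 0 = if x = 2 * k + 1 then
        1 - (p + 1 - len j + (len j - (p + 1))) else
        if x = 2 * k then 1 - p else cell m tEn x 0) →
      (∀ x, cell m' tEx x 0 = if x = 2 * k + 1 then 1 - p else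
        if x = 2 * k then 1 - (p + 1 - len j + (len j - (p + 1))) else cell m tEx x 0) →
      (∀ x, cell m' tCst x 0 = if x = 2 * k + 1 then
        (1 - p) * (1 - (j + 1 - (r + 1) + (r + 1 - (j + 1)))) else
        if x = 2 * k then (1 - p) * (1 - (j + 1 - (r + 1) + (r + 1 - (j + 1))))
        else cell m tCst x 0) →
      Frame [tLab, tRev, tNxt, tEn, tEx, tCst, vS, vFst, vLst, vCst] m m' ∧
        Entered m' r len cc fun j' p' => P j' p' ∨ (j' = j ∧ p' = p) := by
    intro m' hf hlab hrev hnxt hen hex hcst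
    have hcv : (1 - p) * (1 - (j + 1 - (r + 1) + (r + 1 - (j + 1)))) =
        if p = 0 ∧ j = r then 1 else 0 := by
      split_ifs with h
      · simp [h.1, h.2]
      · rcases Nat.eq_zero_or_pos p with rfl | hp0
        · have : 1 - (j + 1 - (r + 1) + (r + 1 - (j + 1))) = 0 := by omega
          rw [this, mul_zero]
        · rw [Nat.sub_eq_zero_of_le hp0, zero_mul]
    rw [hcv] at hcst
    have n1 : 2 * k ≠ 2 * k + 1 := by omega
    refine ⟨hf, ⟨?_, ?_, ?_, ?_, ?_, ?_⟩⟩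
    · rintro j' p' (h | ⟨rfl, rfl⟩)
      · have hlt := hP _ _ h
        refine (hE.letter _ _ h).congr fun t ht' ht s hs => ?_
        have hs1 : s ≠ 2 * k + 1 := by omega
        have hs2 : s ≠ 2 * k := by omega
        interval_cases t
        · rw [hlab, if_neg hs1, if_neg hs2]
        · rw [hen, if_neg hs1, if_neg hs2]
        · rw [hex, if_neg hs1, if_neg hs2]
        · rw [hrev, if_neg hs1, if_neg hs2]
        · rw [hnxt, if_neg hs1, if_neg hs2]
        · rw [hcst, if_neg hs1, if_neg hs2]
      · constructor <;> rw [hk]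
        · simp only [hlab, n1, if_true, if_false, and_self]
        · simp only [hrev, n1, if_true, if_false, and_self]
        · simp only [hnxt, n1, if_true, if_false, and_self]
        · simp only [hen, n1, if_true, if_false]
          omega
        · simp only [hex, n1, if_true, if_false]
          omega
        · simp only [hcst, n1, if_true, if_false, and_self]
    · intro s hs
      rw [hlab] at hs
      by_cases h1 : s = 2 * k + 1
      · exact ⟨j, p, .inr ⟨rfl, rfl⟩, .inr (by rw [hk, h1])⟩
      by_cases h2 : s = 2 * k
      · exact ⟨j, p, .inr ⟨rfl, rfl⟩, .inl (by rw [hk, h2])⟩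
      rw [if_neg h1, if_neg h2] at hs
      obtain ⟨j', p', h, h'⟩ := hE.of_lab s hs
      exact ⟨j', p', .inl h, h'⟩
    · intro s hs
      rw [hen] at hs
      by_cases h1 : s = 2 * k + 1
      · exact .inr ⟨j, p, .inr ⟨rfl, rfl⟩, .inr (by rw [hk, h1])⟩
      by_cases h2 : s = 2 * k
      · exact .inr ⟨j, p, .inr ⟨rfl, rfl⟩, .inl (by rw [hk, h2])⟩
      rw [if_neg h1, if_neg h2] at hs
      rcases hE.of_en s hs with h | ⟨j', p', h, h'⟩
      · exact .inl h
      · exact .inr ⟨j', p', .inl h, h'⟩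
    · rw [hex, if_neg (by omega), if_neg (by omega), hE.ex_zero]
    · rw [hen, if_neg (by omega), if_neg (by omega), hE.en_one]
    · rw [hrev, if_neg (by omega), if_neg (by omega), hE.rev_zero]
  simp only [enterLetter, exec, exec_wr, exec_set, RamExpr.eval, eval_rd, eval_var, cell_setCell,
    Nat.reduceEqDiff, false_and, if_false, and_self, if_true, hQ, hvP, hL, hJ, hR, hpos, hc, ht,
    eqE, neE, hk]
  refine key _ ?_ ?_ ?_ ?_ ?_ ?_ ?_
  · repeat' first
      | exact Frame.refl _ _
      | refine Frame.setCell ?_ (by simp) _ _ _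
  all_goals
    intro x
    simp only [cell_setCell, Nat.reduceEqDiff, false_and, if_false, true_and, and_true]

/-- Enter the data of a word, and go to the next word. -/
def parseWord : RamProg :=
  .seq (.set vLen (.inp (.var vQ)))
    (.seq (.forLoop vP vLen enterLetter) (.set vQ (.add (.add (.var vQ) (.lit 1)) (.var vLen))))

/-- The input `inp` consists of the numbers `n` and `r` and of `r + 1` words, each preceded by its
length, in letters with codes less than `2 * n`. -/
structure IsInput (inp : List ℕ) (n r : ℕ) (len : ℕ → ℕ) : Prop where
  n_eq : inp.getD 0 0 = n
  r_eq : inp.getD 1 0 = r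
  len_eq : ∀ j ≤ r, inp.getD (off len j) 0 = len j
  code_lt : ∀ j ≤ r, ∀ p < len j, inp.getD (pos len j p) 0 < 2 * n

/-- The code of the letter number `p` of the word number `j`. -/
def letterCode (inp : List ℕ) (len : ℕ → ℕ) (j p : ℕ) : ℕ := inp.getD (pos len j p) 0

theorem run_parseWord {inp : List ℕ} {m : ℕ → ℕ} {n r : ℕ} {len : ℕ → ℕ} {j : ℕ}
    (hinp : IsInput inp n r len) (hj : j ≤ r)
    (hE : Entered m r len (letterCode inp len) fun j' p' => j' < j ∧ p' < len j')
    (hQ : cell m vQ 0 0 = off len j) (hJ : cell m vJ 0 0 = j) (hR : cell m vRR 0 0 = r + 1)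
    (ht : ∀ c < 2 * n, cell m tTwin c 0 = twin c) :
    Run inp parseWord m (len j * 5012 + 100) (fun m' =>
      Frame [tLab, tRev, tNxt, tEn, tEx, tCst, vS, vFst, vLst, vCst, vP, vLen, vQ] m m' ∧
      (Entered m' r len (letterCode inp len) fun j' p' => j' < j + 1 ∧ p' < len j') ∧
      cell m' vQ 0 0 = off len (j + 1) ∧ cell m' vLen 0 0 = len j) := by
  refine Run.mono (T := 10 + ((len j * (5000 + 12) + 9) + 20)) ?_ (by omega) fun _ h => h
  refine Run.seq (Run.of_exec rfl (Nat.le_of_ble_eq_true rfl) ?_)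
  simp only [exec_set, RamExpr.eval, eval_var, hQ, hinp.len_eq j hj]
  refine Run.seq ((Run.forLoop_const (len j) 5000 (fun i m' => cell m' vP 0 0 = i ∧
    Frame [tLab, tRev, tNxt, tEn, tEx, tCst, vS, vFst, vLst, vCst, vP, vLen] m m' ∧
    cell m' vLen 0 0 = len j ∧ Entered m' r len (letterCode inp len)
      fun j' p' => (j' < j ∧ p' < len j') ∨ (j' = j ∧ p' < i)) ?_ ?_ ?_).mono le_rfl ?_)
  · refine ⟨by simp [cell_setCell], ?_, by simp [cell_setCell], ?_⟩
    · exact ((Frame.refl _ _).setCell (by simp) _ _ _).setCell (by simp) _ _ _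
    · refine hE.congr (fun k _ hk s => ?_) fun j' p' => by simp
      rw [cell_setCell, cell_setCell, if_neg (by omega), if_neg (by omega)]
  · rintro i m' ⟨h1, -, h2, -⟩
    exact ⟨h1, h2⟩
  · rintro i m' hi ⟨h1, h2, h3, h4⟩
    refine (run_enterLetter h4 (fun j' p' h => pos_lt_pos h) hi hj (by rw [h2 _ (by simp), hQ]) h1
      h3 (by rw [h2 _ (by simp), hJ]) (by rw [h2 _ (by simp), hR]) rfl ?_).mono le_rfl ?_
    · rw [h2 _ (by simp)]
      exact ht _ (hinp.code_lt j hj i hi)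
    · rintro m'' ⟨f, hE''⟩
      refine ⟨by rw [f _ (by simp), h1], by simp [cell_setCell],
        (h2.trans (f.mono (by simp))).setCell (by simp) _ _ _, ?_, ?_⟩
      · simp only [cell_setCell, Nat.reduceEqDiff, false_and, if_false]
        rw [f _ (by simp), h3]
      · refine hE''.congr (fun k _ hk s => ?_) fun j' p' => by omega
        rw [cell_setCell, if_neg (by omega)]
  · rintro m' ⟨h1, h2, h3, h4⟩
    refine Run.of_exec rfl (Nat.le_of_ble_eq_true rfl) ?_
    simp only [exec_set, RamExpr.eval, eval_var, h3, h2 vQ (by simp), hQ]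
    refine ⟨(h2.mono (by simp)).setCell (by simp) _ _ _, ?_, by simp [cell_setCell, off], ?_⟩
    · refine h4.congr (fun k _ hk s => ?_) fun j' p' => ?_
      · rw [cell_setCell, if_neg (by omega)]
      · constructor
        · rintro (⟨h5, h6⟩ | ⟨rfl, h6⟩)
          · exact ⟨by omega, h6⟩
          · exact ⟨by omega, h6⟩
        · rintro ⟨h5, h6⟩
          rcases Nat.lt_succ_iff_lt_or_eq.1 h5 with h5 | rfl
          · exact .inl ⟨h5, h6⟩
          · exact .inr ⟨rfl, h6⟩
    · simp [cell_setCell, h3]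

/-- Enter the data of the states `0` and `1`, and of the variables for the size of the input. -/
def parseHeader : RamProg :=
  .seq (.set vRR (.add (.inp (.lit 1)) (.lit 1)))
  (.seq (.wr1 tEx (.lit 0) (.lit 1))
  (.seq (.wr1 tEn (.lit 1) (.lit 1))
  (.seq (.wr1 tRev (.lit 0) (.lit 1))
    (.set vQ (.lit 2)))))

/-- Compute the tables from the input. -/
def parseInput : RamProg :=
  .seq (.set vN (.inp (.lit 0))) (.seq twinTable (.seq parseHeader
    (.seq (.forLoop vJ vRR parseWord) (.set vM (.mul (.lit 2) (.var vQ))))))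

theorem sum_len (len : ℕ → ℕ) (k : ℕ) :
    ∑ j ∈ Finset.range k, (len j + 1) + 2 = off len k := by
  induction k with
  | zero => rfl
  | succ k ih =>
    rw [Finset.sum_range_succ, off, ← ih]
    ring

theorem run_parseInput {inp : List ℕ} {n r : ℕ} {len : ℕ → ℕ} (hinp : IsInput inp n r len) :
    Run inp parseInput (fun _ => 0) (n * 300 + 6000 * off len (r + 1)) (fun m =>
      (∀ k, 20 ≤ k → ∀ a b, cell m k a b = 0) ∧ IsTable (tableOf m) r len (letterCode inp len) ∧
      cell m vLen 0 0 = len r) := by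
  have hT : ∑ j ∈ Finset.range (r + 1), ((len j * 5012 + 100) + 12) + 9 ≤
      6000 * off len (r + 1) - 10000 := by
    rw [← sum_len, mul_add]
    refine Nat.le_sub_of_add_le ?_
    have : ∑ j ∈ Finset.range (r + 1), ((len j * 5012 + 100) + 12) ≤
        ∑ j ∈ Finset.range (r + 1), 6000 * (len j + 1) :=
      Finset.sum_le_sum fun j _ => by omega
    rw [← Finset.mul_sum] at this
    omega
  have hoff := two_le_off len (r + 1)
  set K : List ℕ := [tLab, tRev, tNxt, tEn, tEx, tCst, vS, vFst, vLst, vCst, vP, vLen, vQ, vJ,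
    tTwin, vI, vN, vRR, vM] with hK
  refine Run.mono (T := 10 + ((n * 300 + 9) + (200 + ((6000 * off len (r + 1) - 10000) + 20))))
    ?_ (by omega) fun _ h => h
  refine Run.seq (Run.of_exec rfl (Nat.le_of_ble_eq_true rfl) ?_)
  simp only [exec_set, RamExpr.eval, hinp.n_eq]
  set m₁ := setCell (fun _ => 0) vN 0 0 n with hm₁
  have f1 : Frame [vN] (fun _ => 0) m₁ := (Frame.refl _ _).setCell (by simp) _ _ _
  refine Run.seq ((run_twinTable (n := n) (by simp [hm₁, cell_setCell])).mono le_rfl ?_)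
  rintro m₂ ⟨f2, htw⟩
  have f02 : Frame [vN, tTwin, vI] (fun _ => 0) m₂ :=
    (f1.mono (K' := [vN, tTwin, vI]) (by simp)).trans (f2.mono (by simp))
  refine Run.seq (Run.of_exec rfl (Nat.le_of_ble_eq_true rfl) ?_)
  simp only [parseHeader, exec, exec_set, exec_wr, RamExpr.eval, hinp.r_eq]
  have key : ∀ m₃, Frame [vRR, tEx, tEn, tRev, vQ] m₂ m₃ → cell m₃ vRR 0 0 = r + 1 →
      cell m₃ vQ 0 0 = 2 → cell m₃ tEx 0 0 = 1 → (∀ s, cell m₃ tEn s 0 = if s = 1 then 1 else 0) →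
      cell m₃ tRev 0 0 = 1 → Run inp
        (.seq (.forLoop vJ vRR parseWord) (.set vM (.mul (.lit 2) (.var vQ)))) m₃
        (6000 * off len (r + 1) - 10000 + 20) (fun m =>
      (∀ k, 20 ≤ k → ∀ a b, cell m k a b = 0) ∧ IsTable (tableOf m) r len (letterCode inp len) ∧
      cell m vLen 0 0 = len r) := by
    intro m₃ f3 hRR hQ hex hen hrev
    have f03 : Frame K (fun _ => 0) m₃ := (f02.mono (by simp [hK])).trans (f3.mono (by simp [hK]))
    refine Run.seq ((Run.forLoop (r + 1) (fun j => len j * 5012 + 100) (fun j m' =>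
      cell m' vJ 0 0 = j ∧ cell m' vRR 0 0 = r + 1 ∧ Frame K (fun _ => 0) m' ∧
      (Entered m' r len (letterCode inp len) fun j' p' => j' < j ∧ p' < len j') ∧
      cell m' vQ 0 0 = off len j ∧ (∀ c < 2 * n, cell m' tTwin c 0 = twin c) ∧
      ∀ j', j = j' + 1 → cell m' vLen 0 0 = len j') ?_ ?_ ?_).mono hT ?_)
    · refine ⟨by simp [cell_setCell], by simp [cell_setCell, hRR],
        f03.setCell (by simp [hK]) _ _ _, ?_, by simp [cell_setCell, hQ, off], ?_, by simp⟩
      · constructor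
        · rintro j p ⟨h, -⟩
          omega
        · intro s hs
          refine absurd ?_ hs
          rw [cell_setCell, if_neg (by omega), f3 _ (by simp), f02 _ (by simp)]
          rfl
        · intro s hs
          rw [cell_setCell, if_neg (by omega), hen] at hs
          exact .inl (by simpa using hs)
        · rw [cell_setCell, if_neg (by omega), hex]
        · rw [cell_setCell, if_neg (by omega), hen, if_pos rfl]
        · rw [cell_setCell, if_neg (by omega), hrev]
      · intro c hc
        rw [cell_setCell, if_neg (by omega), f3 _ (by simp), htw c hc]
    · rintro j m' ⟨h1, h2, -⟩
      exact ⟨h1, h2⟩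
    · rintro j m' hj ⟨h1, h2, h3, h4, h5, h6, -⟩
      refine (run_parseWord hinp (by omega) h4 h5 h1 h2 h6).mono le_rfl ?_
      rintro m'' ⟨f, hE, hq, hl⟩
      refine ⟨by rw [f _ (by simp), h1], by simp [cell_setCell], ?_,
        (h3.trans (f.mono (by simp [hK]))).setCell (by simp [hK]) _ _ _, ?_, ?_, ?_, ?_⟩
      · rw [cell_setCell, if_neg (by omega), f _ (by simp), h2]
      · refine hE.congr (fun k _ hk s => ?_) fun _ _ => Iff.rfl
        rw [cell_setCell, if_neg (by omega)]
      · rw [cell_setCell, if_neg (by omega), hq]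
      · intro c hc
        rw [cell_setCell, if_neg (by omega), f _ (by simp), h6 c hc]
      · rintro j' hj'
        obtain rfl : j = j' := by omega
        rw [cell_setCell, if_neg (by omega), hl]
    · rintro m' ⟨-, -, h3, h4, h5, -, h7⟩
      refine Run.of_exec rfl (Nat.le_of_ble_eq_true rfl) ?_
      simp only [exec_set, RamExpr.eval, eval_var, h5]
      set m'' := setCell m' vM 0 0 (2 * off len (r + 1)) with hm''
      have h4' : Entered m'' r len (letterCode inp len) fun j' p' => j' < r + 1 ∧ p' < len j' := by
        refine h4.congr (fun k hk _ s => ?_) fun _ _ => Iff.rfl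
        rw [hm'', cell_setCell, if_neg (by omega)]
      refine ⟨fun k hk a b => ?_, ?_, ?_⟩
      · rw [(h3.setCell (by simp [hK]) _ _ _ : Frame K _ m'') k (by simp only [hK, List.mem_cons, List.not_mem_nil, or_false]; omega)]
        rfl
      · have hl : ∀ j ≤ r, ∀ p < len j, LetterAt m'' r len (letterCode inp len) j p :=
          fun j hj p hp => h4'.letter j p ⟨by omega, hp⟩
        constructor
        · simp [tableOf, hm'', cell_setCell]
        · exact fun j hj p hp => (hl j hj p hp).lab
        · exact fun j hj p hp => (hl j hj p hp).rev
        · exact fun j hj p hp => (hl j hj p hp).nxt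
        · exact fun j hj p hp => (hl j hj p hp).en
        · exact fun j hj p hp => (hl j hj p hp).ex
        · exact fun j hj p hp => (hl j hj p hp).cst
        · intro s hs
          obtain ⟨j, p, ⟨hj, hp⟩, h⟩ := h4'.of_lab s hs
          exact ⟨j, by omega, p, hp, h⟩
        · intro s hs
          rcases h4'.of_en s hs with h | ⟨j, p, ⟨hj, hp⟩, h⟩
          · exact .inl h
          · exact .inr ⟨j, by omega, p, hp, h⟩
        · exact h4'.ex_zero.trans_ne one_ne_zero
        · exact h4'.en_one.trans_ne one_ne_zero
        · exact h4'.rev_zero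
      · rw [hm'', cell_setCell, if_neg (by omega), h7 r rfl]
  refine key _ ?_ ?_ ?_ ?_ ?_ ?_
  · repeat' first
      | exact Frame.refl _ _
      | refine Frame.setCell ?_ (by simp) _ _ _
  · simp [cell_setCell]
  · simp [cell_setCell]
  · simp [cell_setCell]
  · intro s
    simp only [cell_setCell, Nat.reduceEqDiff, false_and, if_false, true_and, and_true]
    split_ifs
    · rfl
    · rw [f02 _ (by simp)]
      rfl
  · simp [cell_setCell]

end Petal

namespace Petal

open RamExpr RamProg

/-! ### The algorithm -/

/-- The algorithm: the least cost of a bridge from `0` to `1` in the petal graph, or `1` if the last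
word of the input is empty. -/
def minDegree : RamProg :=
  .seq parseInput (.cond (.var vLen)
    (.seq WalkTable.searchAll (.set 0 (.sub (.rd aW (.lit 0) (.lit 1)) (.lit 1))))
    (.set 0 (.lit 1)))

/-- The alternatives in the last part are that there is no bridge, and that the output is the least
cost of a bridge. -/
theorem run_minDegree {inp : List ℕ} {n r : ℕ} {len : ℕ → ℕ} (hinp : IsInput inp n r len) :
    Run inp minDegree (fun _ => 0)
      (n * 300 + 6000 * off len (r + 1) + 30000 * (2 * r + 5) * (2 * off len (r + 1)) ^ 3 + 400)
      (fun m => (len r = 0 → m 0 = 1) ∧ (len r ≠ 0 → ∃ A, IsTable A r len (letterCode inp len) ∧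
        ((∀ w, ¬ A.Bridge 0 1 w) ∧ m 0 = 0 ∨
          A.Bridge 0 1 (m 0) ∧ ∀ w, A.Bridge 0 1 w → m 0 ≤ w))) := by
  refine Run.mono (T := (n * 300 + 6000 * off len (r + 1)) + (2 + 1 +
    (30000 * (2 * r + 5) * (2 * off len (r + 1)) ^ 3 + 300))) ?_ (by omega) fun _ h => h
  refine Run.seq ((run_parseInput hinp).mono le_rfl ?_)
  rintro m ⟨hz, hA, hl⟩
  refine Run.cond (fun h1 => ?_) (fun h0 => ?_)
  · rw [eval_var, hl] at h1
    have hM := hA.M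
    have hoff := two_le_off len (r + 1)
    refine Run.seq ((WalkTable.run_searchAll (D := 2 * (r + 1) + 2) (stored_tableOf m) (by omega)
      (fun k hk => hz k ?_) hA.ncard_step_le).mono (by rw [hM]; rfl) ?_)
    · simp only [List.mem_cons, List.not_mem_nil, or_false] at hk
      omega
    · intro m' hm'
      obtain ⟨h2, h3⟩ := hm' 0 1
      refine Run.of_exec rfl (Nat.le_of_ble_eq_true rfl) ⟨fun h => absurd h h1, fun _ =>
        ⟨_, hA, ?_⟩⟩
      have hout : (RamProg.set 0 (.sub (.rd aW (.lit 0) (.lit 1)) (.lit 1))).exec inp m' 0 =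
          cell m' aW 0 1 - 1 := by
        change cell (setCell m' 0 0 0 _) 0 0 0 = _
        simp [cell_setCell, RamExpr.eval]
      rw [hout]
      by_cases hc : cell m' aW 0 1 = 0
      · refine .inl ⟨fun w hw => ?_, by rw [hc]⟩
        have := h2 w hw
        rw [WalkTable.decW, hc, WalkTable.dec_zero] at this
        simp at this
      · obtain ⟨v, hv⟩ := Nat.exists_eq_succ_of_ne_zero hc
        rw [Nat.succ_eq_add_one] at hv
        simp only [WalkTable.decW, hv, WalkTable.dec_succ] at h2 h3
        rw [hv, Nat.add_sub_cancel]
        exact .inr ⟨h3 v rfl, fun w hw => by exact_mod_cast h2 w hw⟩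
  · rw [eval_var, hl] at h0
    refine Run.of_exec rfl (le_trans (Nat.le_of_ble_eq_true rfl : _ ≤ 300) (by omega))
      ⟨fun _ => ?_, fun h => absurd h0 h⟩
    change cell (setCell m 0 0 0 _) 0 0 0 = _
    simp [cell_setCell, RamExpr.eval]

end Petal

/-! ### Bridges and words with trivial value -/

/-- In a word that reduces to a single letter, this letter survives at some place, and the words
before and after it are trivial. -/
theorem FreeGroup.Red.exists_eq_append_cons {α : Type*} {L : List (α × Bool)} {y : α × Bool}
    (h : FreeGroup.Red L [y]) :
    ∃ P Q, L = P ++ y :: Q ∧ FreeGroup.mk P = 1 ∧ FreeGroup.mk Q = 1 := by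
  induction h using Relation.ReflTransGen.head_induction_on with
  | refl => exact ⟨[], [], rfl, rfl, rfl⟩
  | @head L L' hs _ ih =>
    obtain ⟨P, Q, rfl, hP, hQ⟩ := ih
    -- the cancelled pair is inserted before or after the letter `y`
    generalize hL' : P ++ y :: Q = L' at hs
    cases hs with
    | @not L₁ L₂ x b =>
      rcases List.append_eq_append_iff.1 hL' with ⟨S, rfl, h2⟩ | ⟨S, rfl, rfl⟩
      · rcases S with _ | ⟨z, S⟩
        · rw [List.nil_append] at h2
          subst h2
          refine ⟨P ++ [(x, b), (x, !b)], Q, by simp, ?_, hQ⟩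
          rw [← FreeGroup.mul_mk, hP, one_mul]
          exact Quot.sound (.not (L₁ := []) (L₂ := []))
        · rw [List.cons_append, List.cons.injEq] at h2
          obtain ⟨rfl, rfl⟩ := h2
          refine ⟨P, S ++ (x, b) :: (x, !b) :: L₂, by simp, hP, ?_⟩
          rw [← hQ]
          exact Quot.sound .not
      · refine ⟨L₁ ++ (x, b) :: (x, !b) :: S, Q, by simp, ?_, hQ⟩
        rw [← hP]
        exact Quot.sound .not

/-- In a word with value `1`, the last letter cancels with some earlier one. -/
theorem FreeGroup.exists_cancel_last {α : Type*} {L : List (α × Bool)} {z : α × Bool}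
    (h : FreeGroup.mk (L ++ [z]) = 1) :
    ∃ P Q, L = P ++ (z.1, !z.2) :: Q ∧ FreeGroup.mk P = 1 ∧ FreeGroup.mk Q = 1 := by
  classical
  apply FreeGroup.Red.exists_eq_append_cons
  have h1 : FreeGroup.mk L = FreeGroup.mk [(z.1, !z.2)] := by
    rw [← FreeGroup.mul_mk] at h
    rw [eq_inv_of_mul_eq_one_left h, FreeGroup.inv_mk]
    rfl
  have h2 := FreeGroup.reduce.sound h1
  rw [FreeGroup.reduce_singleton] at h2
  exact h2 ▸ FreeGroup.reduce.red

namespace WalkTable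

/-- Bridges are the walks whose inner states spell a word with value `1`, if `gl s` is the letter
with which the state `s` is labelled. -/
theorem bridge_iff {A : WalkTable} {α : Type*} (gl : ℕ → α × Bool)
    (hC : ∀ e f, A.Cancel e f ↔ A.lab e ≠ 0 ∧ A.lab f ≠ 0 ∧ gl e = ((gl f).1, !(gl f).2))
    (d h w : ℕ) :
    A.Bridge d h w ↔ ∃ u : List ℕ, List.IsChain A.Step (d :: (u ++ [h])) ∧
      (∀ s ∈ u, A.lab s ≠ 0) ∧ FreeGroup.mk (u.map gl) = 1 ∧ (u.map A.cst).sum = w := by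
  constructor
  · intro H
    induction H with
    | step h => exact ⟨[], by simpa using h, by simp, rfl, rfl⟩
    | @app d e f h w₁ w₂ _ _ hc hs ih1 ih2 =>
      obtain ⟨u₁, c₁, l₁, m₁, rfl⟩ := ih1
      obtain ⟨u₂, c₂, l₂, m₂, rfl⟩ := ih2
      obtain ⟨hle, hlf, hg⟩ := (hC e f).1 hc
      refine ⟨u₁ ++ e :: (u₂ ++ [f]), ?_, ?_, ?_, ?_⟩
      · have h1 : List.IsChain A.Step ((d :: u₁) ++ e :: (u₂ ++ f :: [h])) := by
          rw [List.isChain_split]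
          refine ⟨by simpa using c₁, ?_⟩
          rw [← List.cons_append, List.isChain_split]
          exact ⟨by simpa using c₂, by simpa using hs⟩
        simpa using h1
      · intro s hs
        simp only [List.mem_append, List.mem_cons, List.not_mem_nil, or_false] at hs
        rcases hs with hs | rfl | hs | rfl
        exacts [l₁ s hs, hle, l₂ s hs, hlf]
      · simp only [List.map_append, List.map_cons, List.map_nil]
        rw [← FreeGroup.mul_mk, m₁, one_mul,
          show gl e :: (u₂.map gl ++ [gl f]) = [gl e] ++ (u₂.map gl ++ [gl f]) from rfl,
          ← FreeGroup.mul_mk, ← FreeGroup.mul_mk, m₂, one_mul, FreeGroup.mul_mk, hg]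
        have : FreeGroup.mk [((gl f).1, !(gl f).2), ((gl f).1, !!(gl f).2)] = 1 :=
          Quot.sound (.not (L₁ := []) (L₂ := []))
        simpa using this
      · simp only [List.map_append, List.map_cons, List.map_nil, List.sum_append, List.sum_cons,
          List.sum_nil]
        omega
  · rintro ⟨u, hu, hl, hm, rfl⟩
    obtain ⟨k, hk⟩ : ∃ k, u.length ≤ k := ⟨_, le_rfl⟩
    induction k generalizing u d h with
    | zero =>
      obtain rfl : u = [] := List.length_eq_zero_iff.1 (by omega)
      exact .step (by simpa using hu)
    | succ k ih =>
      rcases List.eq_nil_or_concat u with rfl | ⟨L, f, rfl⟩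
      · exact .step (by simpa using hu)
      · rw [List.concat_eq_append] at *
        rw [List.map_append] at hm
        obtain ⟨P, Q, hPQ, hP, hQ⟩ := FreeGroup.exists_cancel_last hm
        obtain ⟨u₁, L', rfl, rfl, hL'⟩ := List.map_eq_append_iff.1 hPQ
        obtain ⟨e, u₂, rfl, hge, rfl⟩ := List.map_eq_cons_iff.1 hL'
        have hu' : List.IsChain A.Step ((d :: u₁) ++ e :: (u₂ ++ f :: [h])) := by
          simpa using hu
        obtain ⟨c₁, c₂₃⟩ := List.isChain_split.1 hu'
        obtain ⟨c₂, c₃⟩ := (List.isChain_split (l₁ := e :: u₂)).1 c₂₃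
        simp only [List.length_append, List.length_cons, List.length_nil] at hk
        have b₁ := ih d e u₁ (by simpa using c₁) (fun s hs => hl s (by simp [hs])) hP (by omega)
        have b₂ := ih e f u₂ (by simpa using c₂) (fun s hs => hl s (by simp [hs])) hQ (by omega)
        have := Bridge.app b₁ b₂ ((hC e f).2 ⟨hl e (by simp), hl f (by simp), hge⟩)
          (by simpa using c₃ : A.Step f h)
        convert this using 1
        simp only [List.map_append, List.map_cons, List.map_nil, List.sum_append, List.sum_cons,
          List.sum_nil]
        omega

end WalkTable

namespace Petal

/-! ### Walks in the petal graph and words in the petals -/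

/-- The state number `i` on the passage through the petal number `j`, forwards or backwards. -/
def petalState (len : ℕ → ℕ) (j : ℕ) (b : Bool) (i : ℕ) : ℕ :=
  if b then 2 * pos len j i else 2 * pos len j (len j - 1 - i) + 1

/-- The states on the passage through a petal. -/
def petalWalk (len : ℕ → ℕ) (x : ℕ × Bool) : List ℕ :=
  (List.range' 0 (len x.1)).map (petalState len x.1 x.2)

/-- The letter with code `c`. -/
def ofCode (c : ℕ) : ℕ × Bool := (c / 2, c % 2 == 0)

theorem ofCode_inj {c c' : ℕ} (h : ofCode c = ofCode c') : c = c' := by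
  simp only [ofCode, Prod.mk.injEq] at h
  have : (c % 2 = 0) ↔ (c' % 2 = 0) := by simpa using h.2
  omega

theorem ofCode_twin (c : ℕ) : ofCode (twin c) = ((ofCode c).1, !(ofCode c).2) := by
  unfold ofCode twin
  split_ifs with h
  · simp only [Prod.mk.injEq, h]
    refine ⟨by omega, ?_⟩
    have : (c + 1) % 2 = 1 := by omega
    simp [this]
  · have h1 : c % 2 = 1 := by omega
    have h2 : (c - 1) % 2 = 0 := by omega
    simp only [Prod.mk.injEq, h1, h2]
    exact ⟨by omega, rfl⟩

section

variable {len : ℕ → ℕ}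

theorem petalState_inj {j j' : ℕ} {b b' : Bool} {i i' : ℕ} (hi : i < len j) (hi' : i' < len j')
    (h : petalState len j b i = petalState len j' b' i') : j = j' ∧ b = b' ∧ i = i' := by
  unfold petalState at h
  cases b <;> cases b' <;> simp only [Bool.false_eq_true, if_true, if_false] at h
  · obtain ⟨rfl, h2⟩ := pos_inj (len := len) (by omega) (by omega)
      (show pos len j (len j - 1 - i) = pos len j' (len j' - 1 - i') by omega)
    exact ⟨rfl, rfl, by omega⟩
  · omega
  · omega
  · obtain ⟨rfl, h2⟩ := pos_inj hi hi' (show pos len j i = pos len j' i' by omega)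
    exact ⟨rfl, rfl, h2⟩

theorem petalState_ge (j : ℕ) (b : Bool) (i : ℕ) : 6 ≤ petalState len j b i := by
  have := two_le_off len j
  unfold petalState pos
  split_ifs <;> omega

theorem petalWalk_eq {x : ℕ × Bool} (hx : 0 < len x.1) : petalWalk len x =
    petalState len x.1 x.2 0 :: (List.range' 1 (len x.1 - 1)).map (petalState len x.1 x.2) := by
  unfold petalWalk
  obtain ⟨k, hk⟩ := Nat.exists_eq_succ_of_ne_zero hx.ne'
  rw [hk, Nat.succ_eq_add_one, List.range'_succ]
  rfl

namespace IsTable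

variable {A : WalkTable} {r : ℕ} {cc : ℕ → ℕ → ℕ} (hA : IsTable A r len cc)

include hA

theorem state_lt {j : ℕ} (hj : j ≤ r) (b : Bool) {i : ℕ} (hi : i < len j) :
    petalState len j b i < A.M := by
  rw [hA.M]
  unfold petalState
  have h1 := pos_lt_off hj hi
  have h2 := pos_lt_off hj (show len j - 1 - i < len j by omega)
  split_ifs <;> omega

theorem ex_iff {j : ℕ} (hj : j ≤ r) (b : Bool) {i : ℕ} (hi : i < len j) :
    A.ex (petalState len j b i) ≠ 0 ↔ i + 1 = len j := by
  unfold petalState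
  split_ifs
  · exact (hA.ex j hj i hi).1
  · rw [(hA.ex j hj _ (by omega)).2]
    omega

theorem en_iff {j : ℕ} (hj : j ≤ r) (b : Bool) {i : ℕ} (hi : i < len j) :
    A.en (petalState len j b i) ≠ 0 ↔ i = 0 := by
  unfold petalState
  split_ifs
  · exact (hA.en j hj i hi).1
  · rw [(hA.en j hj _ (by omega)).2]
    omega

theorem nxt_eq {j : ℕ} (hj : j ≤ r) (b : Bool) {i : ℕ} (hi : i + 1 < len j) :
    A.nxt (petalState len j b i) = petalState len j b (i + 1) := by
  unfold petalState
  split_ifs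
  · rw [(hA.nxt j hj i (by omega)).1]
    unfold pos
    omega
  · rw [(hA.nxt j hj _ (by omega)).2]
    unfold pos
    omega

theorem rev_eq {j : ℕ} (hj : j ≤ r) (b : Bool) {i : ℕ} (hi : i < len j) :
    A.rev (petalState len j b i) = petalState len j (!b) (len j - 1 - i) := by
  unfold petalState
  cases b
  · simp only [Bool.false_eq_true, if_false, Bool.not_false, if_true]
    exact (hA.rev j hj _ (by omega)).2
  · simp only [if_true, Bool.not_true, Bool.false_eq_true, if_false]
    rw [(hA.rev j hj _ hi).1, show len j - 1 - (len j - 1 - i) = i by omega]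

theorem exists_state {s : ℕ} (hs : A.lab s ≠ 0) :
    ∃ j ≤ r, ∃ b, ∃ i < len j, s = petalState len j b i := by
  obtain ⟨j, hj, p, hp, rfl | rfl⟩ := hA.of_lab s hs
  · exact ⟨j, hj, true, p, hp, rfl⟩
  · refine ⟨j, hj, false, len j - 1 - p, by omega, ?_⟩
    simp only [petalState, Bool.false_eq_true, if_false]
    rw [show len j - 1 - (len j - 1 - p) = p by omega]

theorem lab_eq {j : ℕ} (hj : j ≤ r) (b : Bool) {i : ℕ} (hi : i < len j) :
    A.lab (petalState len j b i) =
      (if b then cc j i else twin (cc j (len j - 1 - i))) + 1 := by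
  unfold petalState
  split_ifs
  · exact (hA.lab j hj i hi).1
  · exact (hA.lab j hj _ (by omega)).2

theorem cancel_iff (e f : ℕ) : A.Cancel e f ↔ A.lab e ≠ 0 ∧ A.lab f ≠ 0 ∧
    ofCode (A.lab e - 1) = ((ofCode (A.lab f - 1)).1, !(ofCode (A.lab f - 1)).2) := by
  unfold WalkTable.Cancel
  refine and_congr_right fun he => ?_
  obtain ⟨j, hj, b, i, hi, rfl⟩ := hA.exists_state he
  have htt : ∀ c, twin (twin c) = c := by
    intro c
    unfold twin
    split_ifs <;> omega
  have hrev : A.lab (A.rev (petalState len j b i)) =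
      twin (A.lab (petalState len j b i) - 1) + 1 := by
    rw [hA.rev_eq hj b hi, hA.lab_eq hj _ (by omega), hA.lab_eq hj _ hi]
    cases b
    · simp [htt]
    · simp [show len j - 1 - (len j - 1 - i) = i by omega]
  rw [hrev, ← ofCode_twin]
  constructor
  · intro h
    rw [h]
    exact ⟨by omega, by simp [htt]⟩
  · rintro ⟨h1, h2⟩
    rw [ofCode_inj h2, htt]
    omega

/-- A walk that has entered a petal can go on to its end; only the part after it matters. -/
theorem isChain_petal {j : ℕ} (hj : j ≤ r) (b : Bool) (v : List ℕ) (k i : ℕ)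
    (hk : i + 1 + k = len j) :
    List.IsChain A.Step (petalState len j b i ::
      ((List.range' (i + 1) k).map (petalState len j b) ++ v)) ↔
    List.IsChain A.Step (petalState len j b (len j - 1) :: v) := by
  induction k generalizing i with
  | zero => simp [show len j - 1 = i by omega]
  | succ k ih =>
    rw [List.range'_succ, List.map_cons, List.cons_append, List.isChain_cons_cons,
      ih (i + 1) (by omega), and_iff_right]
    refine ⟨hA.state_lt hj b (by omega), hA.state_lt hj b (by omega), ?_⟩
    rw [if_neg, hA.nxt_eq hj b (by omega)]
    rw [hA.ex_iff hj b (by omega)]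
    omega

/-- A walk that has entered a petal passes through the rest of it. -/
theorem eq_append_of_isChain {j : ℕ} (hj : j ≤ r) (b : Bool) (k i : ℕ)
    (hk : i + 1 + k = len j) {u : List ℕ}
    (hu : List.IsChain A.Step (petalState len j b i :: (u ++ [1]))) :
    ∃ v, u = (List.range' (i + 1) k).map (petalState len j b) ++ v := by
  induction k generalizing i u with
  | zero => exact ⟨u, by simp⟩
  | succ k ih =>
    have hne : ¬ A.ex (petalState len j b i) ≠ 0 := by
      rw [hA.ex_iff hj b (by omega)]
      omega
    rcases u with _ | ⟨t, u⟩
    · have h1 : A.Step (petalState len j b i) 1 := by simpa using hu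
      have h2 := h1.2.2
      rw [if_neg hne, hA.nxt_eq hj b (by omega)] at h2
      have := petalState_ge (len := len) j b (i + 1)
      omega
    · rw [List.cons_append, List.isChain_cons_cons] at hu
      have h2 := hu.1.2.2
      rw [if_neg hne, hA.nxt_eq hj b (by omega)] at h2
      subst h2
      obtain ⟨v, rfl⟩ := ih (i + 1) (by omega) hu.2
      exact ⟨v, by rw [List.range'_succ]; rfl⟩

/-- Reduced words in the petals give walks. -/
theorem isChain_of_isReduced (hlen : ∀ j ≤ r, 0 < len j) (w : List (ℕ × Bool))
    (hw : FreeGroup.IsReduced w) (hr : ∀ x ∈ w, x.1 ≤ r) {e : ℕ} (he : e < A.M) (hex : A.ex e ≠ 0)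
    (h1 : w = [] → A.rev e ≠ 1) (h2 : ∀ x ∈ w.head?, A.rev e ≠ petalState len x.1 x.2 0) :
    List.IsChain A.Step (e :: (w.flatMap (petalWalk len) ++ [1])) := by
  induction w generalizing e with
  | nil =>
    have hM : 1 < A.M := by
      rw [hA.M]
      have := two_le_off len (r + 1)
      omega
    simpa [WalkTable.Step, he, hM, hex, hA.en_one] using (h1 rfl).symm
  | cons x w ih =>
    have hx := hr x (by simp)
    have hl := hlen _ hx
    rw [List.flatMap_cons, petalWalk_eq hl, List.cons_append, List.cons_append,
      List.isChain_cons_cons, List.append_assoc, hA.isChain_petal hx x.2 _ _ 0 (by omega)]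
    refine ⟨⟨he, hA.state_lt hx _ hl, ?_⟩, ih (List.IsChain.tail hw)
      (fun y hy => hr y (by simp [hy])) (hA.state_lt hx _ (by omega)) ?_ ?_ ?_⟩
    · rw [if_pos hex, hA.en_iff hx _ hl]
      exact ⟨rfl, (h2 x (by simp)).symm⟩
    · rw [hA.ex_iff hx _ (by omega)]
      omega
    · intro _
      rw [hA.rev_eq hx _ (by omega)]
      have := petalState_ge (len := len) x.1 (!x.2) (len x.1 - 1 - (len x.1 - 1))
      omega
    · intro y hy
      rcases w with _ | ⟨z, w⟩
      · simp at hy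
      · obtain rfl : z = y := by simpa using hy
        rw [hA.rev_eq hx _ (by omega)]
        intro h
        obtain ⟨h3, h4, -⟩ := petalState_inj (by omega) (hlen _ (hr z (by simp))) h
        have := (FreeGroup.isReduced_cons_cons.1 hw).1 h3
        rw [this] at h4
        simp at h4

/-- Walks give reduced words in the petals. -/
theorem exists_isReduced_of_isChain (k : ℕ) (u : List ℕ)
    (hk : u.length ≤ k) (hu : ∀ s ∈ u, A.lab s ≠ 0) {e : ℕ} (hex : A.ex e ≠ 0)
    (hc : List.IsChain A.Step (e :: (u ++ [1]))) :
    ∃ w : List (ℕ × Bool), FreeGroup.IsReduced w ∧ (∀ x ∈ w, x.1 ≤ r) ∧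
      u = w.flatMap (petalWalk len) ∧ (∀ x ∈ w.head?, A.rev e ≠ petalState len x.1 x.2 0) := by
  induction k generalizing u e with
  | zero =>
    obtain rfl : u = [] := List.length_eq_zero_iff.1 (by omega)
    exact ⟨[], FreeGroup.IsReduced.nil, by simp, rfl, by simp⟩
  | succ k ih =>
    rcases u with _ | ⟨t, u⟩
    · exact ⟨[], FreeGroup.IsReduced.nil, by simp, rfl, by simp⟩
    obtain ⟨j, hj, b, i, hi, rfl⟩ := hA.exists_state (hu t (by simp))
    rw [List.cons_append, List.isChain_cons_cons] at hc
    obtain ⟨hs, hc⟩ := hc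
    have hs' := hs.2.2
    rw [if_pos hex, hA.en_iff hj _ hi] at hs'
    obtain ⟨rfl, hrev⟩ := hs'
    obtain ⟨v, rfl⟩ := hA.eq_append_of_isChain hj b (len j - 1) 0 (by omega) hc
    rw [List.append_assoc, hA.isChain_petal hj b _ _ 0 (by omega)] at hc
    obtain ⟨w, w1, w2, rfl, w3⟩ := ih v (by simp at hk; omega)
      (fun s hs => hu s (by simp [hs])) (e := petalState len j b (len j - 1))
      (by rw [hA.ex_iff hj b (by omega)]; omega) hc
    refine ⟨(j, b) :: w, ?_, ?_, ?_, ?_⟩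
    · rcases w with _ | ⟨y, w⟩
      · exact FreeGroup.IsReduced.singleton
      · refine FreeGroup.isReduced_cons_cons.2 ⟨fun h => ?_, w1⟩
        have h3 := w3 y (by simp)
        rw [hA.rev_eq hj b (by omega)] at h3
        by_contra hb
        refine h3 ?_
        have hb' : (!b) = y.2 := by
          cases b <;> cases hy : y.2 <;> simp_all
        rw [hb', ← show j = y.1 from h, show len j - 1 - (len j - 1) = 0 by omega]
    · intro x hx
      rcases List.mem_cons.1 hx with rfl | hx
      · exact hj
      · exact w2 x hx
    · rw [List.flatMap_cons, petalWalk_eq (x := (j, b)) hi]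
      rfl
    · intro x hx
      obtain rfl : (j, b) = x := by simpa using hx
      exact hrev.symm

theorem sum_cst {x : ℕ × Bool} (hx : x.1 ≤ r) (hlen : 0 < len x.1) :
    ((petalWalk len x).map A.cst).sum = if x.1 = r then 1 else 0 := by
  have h1 : ∀ i < len x.1, A.cst (petalState len x.1 x.2 i) =
      if i = (if x.2 then 0 else len x.1 - 1) then (if x.1 = r then 1 else 0) else 0 := by
    intro i hi
    unfold petalState
    split_ifs with h2 h3 _ _ h3
    all_goals first
      | rw [(hA.cst _ hx i hi).1]
      | rw [(hA.cst _ hx _ (by omega)).2]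
    all_goals simp only [ite_eq_left_iff, ite_eq_right_iff]
    all_goals omega
  have h2 : ((petalWalk len x).map A.cst).sum =
      ∑ i ∈ Finset.range (len x.1), A.cst (petalState len x.1 x.2 i) := by
    rw [petalWalk, ← List.range_eq_range', List.map_map]
    rfl
  rw [h2, Finset.sum_congr rfl fun i hi => h1 i (Finset.mem_range.1 hi), Finset.sum_ite_eq',
    if_pos]
  rw [Finset.mem_range]
  split_ifs <;> omega

/-- The labels on the passage through a petal spell the word of the petal, or its inverse. -/
theorem map_ofCode {wl : ℕ → List (ℕ × Bool)} (hwl : ∀ j ≤ r, (wl j).length = len j)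
    (hcc : ∀ j ≤ r, ∀ p (hp : p < (wl j).length), ofCode (cc j p) = (wl j)[p])
    {x : ℕ × Bool} (hx : x.1 ≤ r) :
    (petalWalk len x).map (fun s => ofCode (A.lab s - 1)) =
      if x.2 then wl x.1 else FreeGroup.invRev (wl x.1) := by
  have hl := hwl _ hx
  obtain ⟨j, b⟩ := x
  simp only at hx hl ⊢
  cases b
  · refine List.ext_getElem (by simp [petalWalk, hl]) fun i h1 h2 => ?_
    simp only [petalWalk, List.length_map, List.length_range'] at h1
    simp only [petalWalk, List.getElem_map, List.getElem_range', zero_add, one_mul,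
      Bool.false_eq_true, if_false, FreeGroup.invRev, List.getElem_reverse, List.length_map]
    rw [hA.lab_eq hx _ h1]
    simp only [Bool.false_eq_true, if_false, Nat.add_sub_cancel, ofCode_twin]
    rw [hcc j hx _ (by omega)]
    simp only [hl]
  · refine List.ext_getElem (by simp [petalWalk, hl]) fun i h1 h2 => ?_
    simp only [petalWalk, List.length_map, List.length_range'] at h1
    simp only [petalWalk, List.getElem_map, List.getElem_range', zero_add, one_mul, if_true]
    rw [hA.lab_eq hx _ h1]
    simp only [if_true, Nat.add_sub_cancel]
    exact hcc j hx i (by omega)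

theorem mk_flatMap {wl : ℕ → List (ℕ × Bool)} (hwl : ∀ j ≤ r, (wl j).length = len j)
    (hcc : ∀ j ≤ r, ∀ p (hp : p < (wl j).length), ofCode (cc j p) = (wl j)[p])
    (w : List (ℕ × Bool)) (hw : ∀ x ∈ w, x.1 ≤ r) :
    FreeGroup.mk ((w.flatMap (petalWalk len)).map fun s => ofCode (A.lab s - 1)) =
      FreeGroup.lift (fun j => FreeGroup.mk (wl j)) (FreeGroup.mk w) := by
  induction w with
  | nil => rfl
  | cons x w ih =>
    rw [List.flatMap_cons, List.map_append, ← FreeGroup.mul_mk,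
      ih fun y hy => hw y (by simp [hy]), hA.map_ofCode hwl hcc (hw x (by simp)),
      show x :: w = [x] ++ w from rfl, ← FreeGroup.mul_mk, map_mul]
    congr 1
    split_ifs with hx
    · simp [FreeGroup.lift_mk, hx]
    · simp [FreeGroup.lift_mk, hx, FreeGroup.inv_mk]

/-- Bridges from `0` to `1` are the same as non-empty reduced words in the petals with value `1`. -/
theorem bridge_iff (hlen : ∀ j ≤ r, 0 < len j) {wl : ℕ → List (ℕ × Bool)}
    (hwl : ∀ j ≤ r, (wl j).length = len j)
    (hcc : ∀ j ≤ r, ∀ p (hp : p < (wl j).length), ofCode (cc j p) = (wl j)[p]) (d : ℕ) :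
    A.Bridge 0 1 d ↔ ∃ w : List (ℕ × Bool), w ≠ [] ∧ FreeGroup.IsReduced w ∧ (∀ x ∈ w, x.1 ≤ r) ∧
      FreeGroup.lift (fun j => FreeGroup.mk (wl j)) (FreeGroup.mk w) = 1 ∧
      w.countP (fun x => x.1 = r) = d := by
  have hsum : ∀ w : List (ℕ × Bool), (∀ x ∈ w, x.1 ≤ r) →
      ((w.flatMap (petalWalk len)).map A.cst).sum = w.countP (fun x => x.1 = r) := by
    intro w hw
    induction w with
    | nil => rfl
    | cons x w ih =>
      rw [List.flatMap_cons, List.map_append, List.sum_append,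
        ih fun y hy => hw y (by simp [hy]), hA.sum_cst (hw x (by simp)) (hlen _ (hw x (by simp))),
        List.countP_cons, add_comm]
      simp
  rw [A.bridge_iff (fun s => ofCode (A.lab s - 1)) hA.cancel_iff]
  constructor
  · rintro ⟨u, h1, h2, h3, h4⟩
    obtain ⟨w, w1, w2, rfl, -⟩ := hA.exists_isReduced_of_isChain _ u le_rfl h2 hA.ex_zero h1
    refine ⟨w, ?_, w1, w2, ?_, ?_⟩
    · rintro rfl
      have hs : A.Step 0 1 := by simpa using h1
      have := hs.2.2
      rw [if_pos hA.ex_zero, hA.rev_zero] at this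
      exact this.2 rfl
    · rw [← hA.mk_flatMap hwl hcc w w2, h3]
    · rw [← hsum w w2, h4]
  · rintro ⟨w, w0, w1, w2, w3, w4⟩
    refine ⟨w.flatMap (petalWalk len), ?_, ?_, ?_, ?_⟩
    · refine hA.isChain_of_isReduced hlen w w1 w2 ?_ hA.ex_zero (fun h => absurd h w0) ?_
      · rw [hA.M]
        have := two_le_off len (r + 1)
        omega
      · intro x _
        rw [hA.rev_zero]
        have := petalState_ge (len := len) x.1 x.2 0
        omega
    · intro s hs
      obtain ⟨x, hx, hs⟩ := List.mem_flatMap.1 hs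
      simp only [petalWalk, List.mem_map, List.mem_range'_1] at hs
      obtain ⟨i, hi, rfl⟩ := hs
      rw [hA.lab_eq (w2 x hx) _ (by omega)]
      omega
    · rw [hA.mk_flatMap hwl hcc w w2, w3]
    · rw [hsum w w2, w4]

end IsTable

end

end Petal

/-! ### Equations and words -/

section

variable {F : Type*} [Group F] {H : Subgroup F} {r : ℕ}

/-- The value of a word in the basis of `H` and `x`, if `x` is replaced by `g`. -/
def wordValue (h : FreeGroupBasis (Fin r) H) (g : F) : FreeGroup (Option (Fin r)) →* F :=
  FreeGroup.lift fun o => o.elim g fun i => (h i : F)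

/-- The equation that a word in the basis of `H` and `x` represents. -/
def freeToEquation (h : FreeGroupBasis (Fin r) H) :
    FreeGroup (Option (Fin r)) →* H ∗ Multiplicative ℤ :=
  FreeGroup.lift fun o =>
    o.elim (Monoid.Coprod.inr (Multiplicative.ofAdd 1)) fun i => Monoid.Coprod.inl (h i)

theorem equationToFree_freeToEquation (h : FreeGroupBasis (Fin r) H)
    (u : FreeGroup (Option (Fin r))) : equationToFree h (freeToEquation h u) = u := by
  suffices (equationToFree h).comp (freeToEquation h) = MonoidHom.id _ from
    DFunLike.congr_fun this u
  ext o
  rcases o with _ | i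
  · simp [freeToEquation, equationToFree]
  · simp [freeToEquation, equationToFree]

theorem freeToEquation_equationToFree (h : FreeGroupBasis (Fin r) H)
    (w : H ∗ Multiplicative ℤ) : freeToEquation h (equationToFree h w) = w := by
  suffices (freeToEquation h).comp (equationToFree h) = MonoidHom.id _ from
    DFunLike.congr_fun this w
  refine Monoid.Coprod.hom_ext ?_ ?_
  · refine h.ext_hom _ _ fun i => ?_
    simp [freeToEquation, equationToFree]
  · ext
    simp [freeToEquation, equationToFree]

theorem wordValue_equationToFree (h : FreeGroupBasis (Fin r) H) (g : F)
    (w : H ∗ Multiplicative ℤ) : wordValue h g (equationToFree h w) = evalEquation H g w := by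
  suffices (wordValue h g).comp (equationToFree h) = evalEquation H g from
    DFunLike.congr_fun this w
  refine Monoid.Coprod.hom_ext ?_ ?_
  · refine h.ext_hom _ _ fun i => ?_
    simp [wordValue, equationToFree, evalEquation]
  · ext
    simp [wordValue, equationToFree, evalEquation]

/-- The degrees of the equations are the numbers of occurrences of `x` in certain reduced words:
a cyclically reduced word is conjugate to the word from which it arises. -/
theorem exists_word_of_mem_equationDegrees (h : FreeGroupBasis (Fin r) H) (g : F) {d : ℕ}
    (hd : d ∈ equationDegrees h g) : ∃ w : List (Option (Fin r) × Bool), w ≠ [] ∧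
      FreeGroup.IsReduced w ∧ wordValue h g (FreeGroup.mk w) = 1 ∧
      w.countP (fun c => c.1 = none) = d := by
  obtain ⟨q, hq, hne, rfl⟩ := hd
  obtain ⟨L, hL⟩ : ∃ L, L = (equationToFree h q).toWord := ⟨_, rfl⟩
  have hred : FreeGroup.IsReduced L := hL ▸ FreeGroup.isReduced_toWord
  have hmk : FreeGroup.mk L = equationToFree h q := by rw [hL, FreeGroup.mk_toWord]
  have hconj := congrArg FreeGroup.mk
    (FreeGroup.reduceCyclically.conj_conjugator_reduceCyclically L)
  rw [← FreeGroup.mul_mk, ← FreeGroup.mul_mk, ← FreeGroup.inv_mk] at hconj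
  have hval : wordValue h g (FreeGroup.mk L) = 1 := by
    rw [hmk, wordValue_equationToFree]
    exact hq
  refine ⟨FreeGroup.reduceCyclically L, ?_,
    (FreeGroup.reduceCyclically.isCyclicallyReduced hred).isReduced, ?_, by
      rw [equationDegree, ← hL]⟩
  · intro h0
    rw [h0, ← FreeGroup.one_eq_mk, mul_one, mul_inv_cancel, hmk] at hconj
    apply hne
    rw [← freeToEquation_equationToFree h q, ← hconj, map_one]
  · rw [← hconj, map_mul, map_mul, map_inv, mul_inv_eq_one] at hval
    exact mul_eq_left.1 hval

theorem exists_mem_equationDegrees_le (h : FreeGroupBasis (Fin r) H) (g : F)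
    {w : List (Option (Fin r) × Bool)} (h0 : w ≠ []) (hw : FreeGroup.IsReduced w)
    (hv : wordValue h g (FreeGroup.mk w) = 1) :
    ∃ d ∈ equationDegrees h g, d ≤ w.countP (fun c => c.1 = none) := by
  refine ⟨_, ⟨freeToEquation h (FreeGroup.mk w), ?_, ?_, rfl⟩, ?_⟩
  · change evalEquation H g _ = 1
    rw [← wordValue_equationToFree h, equationToFree_freeToEquation, hv]
  · intro h1
    have h2 := equationToFree_freeToEquation h (FreeGroup.mk w)
    rw [h1, map_one] at h2
    have h3 : (FreeGroup.mk w).toWord = w := by rw [FreeGroup.toWord_mk, hw.reduce_eq]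
    rw [← h2, FreeGroup.toWord_one] at h3
    exact h0 h3.symm
  · rw [equationDegree, equationToFree_freeToEquation, FreeGroup.toWord_mk, hw.reduce_eq]
    conv_rhs => rw [← FreeGroup.reduceCyclically.conj_conjugator_reduceCyclically w]
    rw [List.countP_append, List.countP_append]
    omega

/-- An equation of degree `0` would be a relation between the elements of the basis of `H`. -/
theorem pos_of_mem_equationDegrees (h : FreeGroupBasis (Fin r) H) (g : F) {d : ℕ}
    (hd : d ∈ equationDegrees h g) : 0 < d := by
  obtain ⟨w, h0, hw, hv, rfl⟩ := exists_word_of_mem_equationDegrees h g hd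
  by_contra hn
  have hc : w.countP (fun c => c.1 = none) = 0 := by omega
  obtain ⟨v, hvw⟩ : ∃ v : FreeGroup (Fin r), FreeGroup.map some v = FreeGroup.mk w := by
    clear h0 hw hv hd hn
    induction w with
    | nil => exact ⟨1, rfl⟩
    | cons c w ih =>
      obtain ⟨h1, h2⟩ : w.countP (fun c => c.1 = none) = 0 ∧ c.1 ≠ none := by
        rw [List.countP_cons] at hc
        split_ifs at hc with hs
        exact ⟨by omega, by simpa using hs⟩
      obtain ⟨v, hv⟩ := ih h1
      obtain ⟨i, hi⟩ := Option.ne_none_iff_exists.1 h2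
      refine ⟨FreeGroup.mk [(i, c.2)] * v, ?_⟩
      rw [map_mul, hv, FreeGroup.map.mk, FreeGroup.mul_mk]
      simp [hi]
  have h1 : ∀ v, wordValue h g (FreeGroup.map some v) = (h.repr.symm v : F) := by
    intro v
    suffices (wordValue h g).comp (FreeGroup.map some) =
        H.subtype.comp h.repr.symm.toMonoidHom from DFunLike.congr_fun this v
    ext i
    simp [wordValue]
    rfl
  rw [← hvw, h1] at hv
  have h2 : v = 1 := by
    have : h.repr.symm v = 1 := Subtype.ext hv
    simpa using this
  rw [h2, map_one] at hvw
  have h3 : (FreeGroup.mk w).toWord = w := by rw [FreeGroup.toWord_mk, hw.reduce_eq]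
  rw [← hvw, FreeGroup.toWord_one] at h3
  exact h0 h3.symm

end

namespace Petal

variable {n r : ℕ} {H : Subgroup (FreeGroup (Fin n))}

/-- The words of the petals: those of the basis of `H`, and that of `g`. -/
def petalWord (h : FreeGroupBasis (Fin r) H) (g : FreeGroup (Fin n)) (j : ℕ) : List (ℕ × Bool) :=
  (if hj : j < r then (h ⟨j, hj⟩ : FreeGroup (Fin n)) else g).toWord.map fun c => (c.1, c.2)

/-- The lengths of these words. -/
def petalLen (h : FreeGroupBasis (Fin r) H) (g : FreeGroup (Fin n)) (j : ℕ) : ℕ :=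
  (petalWord h g j).length

/-- The number of the petal for an element of the basis of `H`, or for `x`. -/
def petalIndex (o : Option (Fin r)) : ℕ := o.elim r fun i => i

theorem petalIndex_injective : Function.Injective (petalIndex (r := r)) := by
  rintro (_ | i) (_ | j) hij <;> simp only [petalIndex, Option.elim] at hij
  · rfl
  · omega
  · omega
  · rw [Fin.ext hij]

theorem petalIndex_le (o : Option (Fin r)) : petalIndex o ≤ r := by
  rcases o with _ | i
  · exact le_rfl
  · exact i.2.le

theorem petalIndex_eq_iff (o : Option (Fin r)) : petalIndex o = r ↔ o = none :=
  ⟨fun h => petalIndex_injective (h.trans rfl), fun h => h ▸ rfl⟩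

theorem exists_petalIndex {j : ℕ} (hj : j ≤ r) : ∃ o : Option (Fin r), petalIndex o = j := by
  rcases hj.lt_or_eq with hj | rfl
  · exact ⟨some ⟨j, hj⟩, rfl⟩
  · exact ⟨none, rfl⟩

theorem mk_petalWord (h : FreeGroupBasis (Fin r) H) (g : FreeGroup (Fin n))
    (o : Option (Fin r)) : FreeGroup.mk (petalWord h g (petalIndex o)) =
      FreeGroup.map Fin.val (o.elim g fun i => (h i : FreeGroup (Fin n))) := by
  rcases o with _ | i
  · have hn : ¬ petalIndex (none : Option (Fin r)) < r := lt_irrefl r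
    rw [petalWord, dif_neg hn,
      ← FreeGroup.map.mk, FreeGroup.mk_toWord, Option.elim]
  · have hi : petalIndex (some i) < r := i.2
    rw [petalWord, dif_pos hi, ← FreeGroup.map.mk,
      FreeGroup.mk_toWord, Option.elim]
    rfl

theorem lift_petalWord (h : FreeGroupBasis (Fin r) H) (g : FreeGroup (Fin n))
    (w : List (Option (Fin r) × Bool)) :
    FreeGroup.lift (fun j => FreeGroup.mk (petalWord h g j))
        (FreeGroup.mk (w.map fun c => (petalIndex c.1, c.2))) = 1 ↔
      wordValue h g (FreeGroup.mk w) = 1 := by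
  have h1 : FreeGroup.lift (fun j => FreeGroup.mk (petalWord h g j))
      (FreeGroup.mk (w.map fun c => (petalIndex c.1, c.2))) =
      FreeGroup.map Fin.val (wordValue h g (FreeGroup.mk w)) := by
    rw [← FreeGroup.map.mk]
    suffices (FreeGroup.lift fun j => FreeGroup.mk (petalWord h g j)).comp
        (FreeGroup.map petalIndex) = (FreeGroup.map Fin.val).comp (wordValue h g) from
      DFunLike.congr_fun this (FreeGroup.mk w)
    ext o : 1
    simp [wordValue, mk_petalWord]
  rw [h1, ← map_one (FreeGroup.map Fin.val),
    (FreeGroup.map_injective Fin.val_injective).eq_iff]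

/-- The degrees of the equations, in terms of words in the petals. -/
theorem exists_words_iff (h : FreeGroupBasis (Fin r) H) (g : FreeGroup (Fin n)) (d : ℕ) :
    (∃ w : List (ℕ × Bool), w ≠ [] ∧ FreeGroup.IsReduced w ∧ (∀ x ∈ w, x.1 ≤ r) ∧
      FreeGroup.lift (fun j => FreeGroup.mk (petalWord h g j)) (FreeGroup.mk w) = 1 ∧
      w.countP (fun x => x.1 = r) = d) ↔
    ∃ w : List (Option (Fin r) × Bool), w ≠ [] ∧ FreeGroup.IsReduced w ∧
      wordValue h g (FreeGroup.mk w) = 1 ∧ w.countP (fun c => c.1 = none) = d := by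
  have hcount : ∀ w : List (Option (Fin r) × Bool),
      (w.map fun c => (petalIndex c.1, c.2)).countP (fun x => x.1 = r) =
        w.countP (fun c => c.1 = none) := by
    intro w
    rw [List.countP_map]
    refine List.countP_congr fun c _ => ?_
    simp [petalIndex_eq_iff]
  have hred : ∀ w : List (Option (Fin r) × Bool),
      FreeGroup.IsReduced (w.map fun c => (petalIndex c.1, c.2)) ↔ FreeGroup.IsReduced w := by
    intro w
    unfold FreeGroup.IsReduced
    rw [List.isChain_map]
    simp only [petalIndex_injective.eq_iff]
  constructor
  · rintro ⟨w, w0, w1, w2, w3, rfl⟩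
    obtain ⟨w, rfl⟩ : ∃ w' : List (Option (Fin r) × Bool),
        (w'.map fun c => (petalIndex c.1, c.2)) = w := by
      clear w0 w1 w3
      induction w with
      | nil => exact ⟨[], rfl⟩
      | cons x w ih =>
        obtain ⟨w', rfl⟩ := ih fun y hy => w2 y (by simp [hy])
        obtain ⟨o, ho⟩ := exists_petalIndex (w2 x (by simp))
        exact ⟨(o, x.2) :: w', by simp [ho]⟩
    exact ⟨w, by simpa using w0, (hred w).1 w1, (lift_petalWord h g w).1 w3, (hcount w).symm⟩
  · rintro ⟨w, w0, w1, w2, rfl⟩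
    refine ⟨_, by simpa using w0, (hred w).2 w1, ?_, (lift_petalWord h g w).2 w2, hcount w⟩
    intro x hx
    obtain ⟨c, -, rfl⟩ := List.mem_map.1 hx
    exact petalIndex_le _

/-! ### The input -/

/-- The codes of the letters of a petal. -/
def petalCode (h : FreeGroupBasis (Fin r) H) (g : FreeGroup (Fin n)) (j : ℕ) : List ℕ :=
  (petalWord h g j).map fun c => 2 * c.1 + if c.2 then 0 else 1

/-- The part of the input with the words of the first `k` petals. -/
def petalCodes (h : FreeGroupBasis (Fin r) H) (g : FreeGroup (Fin n)) (k : ℕ) : List ℕ :=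
  ((List.range k).map fun j => petalLen h g j :: petalCode h g j).flatten

theorem petalCodes_succ (h : FreeGroupBasis (Fin r) H) (g : FreeGroup (Fin n)) (k : ℕ) :
    petalCodes h g (k + 1) = petalCodes h g k ++ (petalLen h g k :: petalCode h g k) := by
  simp [petalCodes, List.range_succ]

theorem encodeInstance_eq (h : FreeGroupBasis (Fin r) H) (g : FreeGroup (Fin n)) :
    encodeInstance h g = n :: r :: petalCodes h g (r + 1) := by
  have h1 : ∀ u : FreeGroup (Fin n), encodeElement u = (u.toWord.map fun c =>
      ((c.1 : ℕ), c.2)).length :: (u.toWord.map fun c => ((c.1 : ℕ), c.2)).map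
        fun c => 2 * c.1 + if c.2 then 0 else 1 := by
    intro u
    simp [encodeElement]
  have h2 : (List.ofFn fun i : Fin r => encodeElement (h i : FreeGroup (Fin n))) =
      (List.range r).map fun j => petalLen h g j :: petalCode h g j := by
    refine List.ext_getElem (by simp) fun i hi _ => ?_
    have hi' : i < r := by simpa using hi
    rw [List.getElem_ofFn, List.getElem_map, List.getElem_range, h1]
    simp only [petalLen, petalCode, petalWord, hi', dif_pos]
  rw [petalCodes_succ, encodeInstance, h2, h1]
  simp only [petalCodes, petalLen, petalCode, petalWord, lt_irrefl, dif_neg, not_false_eq_true]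

theorem length_petalCodes (h : FreeGroupBasis (Fin r) H) (g : FreeGroup (Fin n)) (k : ℕ) :
    (petalCodes h g k).length + 2 = off (petalLen h g) k := by
  induction k with
  | zero => rfl
  | succ k ih =>
    rw [petalCodes_succ, List.length_append, off, ← ih, List.length_cons, petalCode,
      List.length_map, petalLen]
    omega

theorem encodeInstance_split (h : FreeGroupBasis (Fin r) H) (g : FreeGroup (Fin n)) {j : ℕ}
    (hj : j ≤ r) : ∃ S T, encodeInstance h g = S ++ petalLen h g j :: (petalCode h g j ++ T) ∧
      S.length = off (petalLen h g) j := by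
  have h1 : ∀ k, ∃ T, petalCodes h g (j + 1 + k) = petalCodes h g (j + 1) ++ T := by
    intro k
    induction k with
    | zero => exact ⟨[], by simp⟩
    | succ k ih =>
      obtain ⟨T, hT⟩ := ih
      exact ⟨T ++ _, by rw [← add_assoc, petalCodes_succ, hT, List.append_assoc]⟩
  obtain ⟨T, hT⟩ := h1 (r - j)
  refine ⟨n :: r :: petalCodes h g j, T, ?_, length_petalCodes h g j⟩
  rw [encodeInstance_eq, show r + 1 = j + 1 + (r - j) by omega, hT, petalCodes_succ]
  simp

theorem letterCode_eq (h : FreeGroupBasis (Fin r) H) (g : FreeGroup (Fin n)) {j : ℕ} (hj : j ≤ r)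
    {p : ℕ} (hp : p < (petalWord h g j).length) :
    letterCode (encodeInstance h g) (petalLen h g) j p =
      2 * (petalWord h g j)[p].1 + if (petalWord h g j)[p].2 then 0 else 1 := by
  obtain ⟨S, T, hST, hS⟩ := encodeInstance_split h g hj
  rw [letterCode, hST, List.getD_append_right _ _ _ _ (by rw [hS, pos]; omega), hS,
    show pos (petalLen h g) j p - off (petalLen h g) j = p + 1 by rw [pos]; omega,
    List.getD_cons_succ, List.getD_append _ _ _ _ (by simpa [petalCode] using hp),
    List.getD_eq_getElem _ _ (by simpa [petalCode] using hp)]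
  simp [petalCode]

theorem isInput_encodeInstance (h : FreeGroupBasis (Fin r) H) (g : FreeGroup (Fin n)) :
    IsInput (encodeInstance h g) n r (petalLen h g) where
  n_eq := rfl
  r_eq := rfl
  len_eq j hj := by
    obtain ⟨S, T, hST, hS⟩ := encodeInstance_split h g hj
    rw [hST, List.getD_append_right _ _ _ _ hS.le, hS, Nat.sub_self, List.getD_cons_zero]
  code_lt j hj p hp := by
    change letterCode _ _ _ _ < _
    rw [letterCode_eq h g hj hp]
    have : ∀ c ∈ petalWord h g j, c.1 < n := by
      intro c hc
      obtain ⟨c, -, rfl⟩ := List.mem_map.1 hc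
      exact c.1.2
    have := this _ (List.getElem_mem hp)
    split_ifs <;> omega

theorem ofCode_letterCode (h : FreeGroupBasis (Fin r) H) (g : FreeGroup (Fin n)) {j : ℕ}
    (hj : j ≤ r) {p : ℕ} (hp : p < (petalWord h g j).length) :
    ofCode (letterCode (encodeInstance h g) (petalLen h g) j p) = (petalWord h g j)[p] := by
  rw [letterCode_eq h g hj hp, ofCode]
  rcases (petalWord h g j)[p] with ⟨a, _ | _⟩
  · simp only [Bool.false_eq_true, if_false, Prod.mk.injEq]
    refine ⟨by omega, ?_⟩
    have : (2 * a + 1) % 2 = 1 := by omega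
    simp [this]
  · simp

theorem petalLen_pos (h : FreeGroupBasis (Fin r) H) (g : FreeGroup (Fin n)) {j : ℕ} (hj : j < r) :
    0 < petalLen h g j := by
  rw [petalLen, List.length_pos_iff, petalWord, dif_pos hj, Ne, List.map_eq_nil_iff,
    FreeGroup.toWord_eq_nil_iff]
  intro h1
  have h2 : h ⟨j, hj⟩ = 1 := Subtype.ext h1
  have h3 := h.repr_apply_coe ⟨j, hj⟩
  rw [h2, map_one] at h3
  exact FreeGroup.of_ne_one _ h3.symm

theorem petalLen_le (h : FreeGroupBasis (Fin r) H) (g : FreeGroup (Fin n)) (j : ℕ) :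
    petalLen h g j ≤ maxLength h g := by
  rw [petalLen, petalWord, List.length_map, maxLength]
  split_ifs with hj
  · exact le_max_of_le_left (Finset.le_sup (f := fun i => (h i : FreeGroup (Fin n)).norm)
      (Finset.mem_univ (⟨j, hj⟩ : Fin r)))
  · exact le_max_right _ _

theorem petalLen_self (h : FreeGroupBasis (Fin r) H) (g : FreeGroup (Fin n)) :
    petalLen h g r = 0 ↔ g = 1 := by
  rw [petalLen, petalWord, dif_neg (lt_irrefl r), List.length_eq_zero_iff, List.map_eq_nil_iff,
    FreeGroup.toWord_eq_nil_iff]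

/-! ### The running time -/

theorem off_le {len : ℕ → ℕ} {L : ℕ} (hL : ∀ j, len j ≤ L) (k : ℕ) :
    off len k ≤ 2 + k * (L + 1) := by
  induction k with
  | zero => simp [off]
  | succ k ih =>
    have := hL k
    rw [off, Nat.succ_mul]
    omega

theorem time_le {n r L a b c o : ℕ} (hn : n ≤ a) (hr : r ≤ b) (hL : L ≤ c) (ha : 1 ≤ a)
    (hb : 1 ≤ b) (hc : 1 ≤ c) (ho : o ≤ 2 + (r + 1) * (L + 1)) :
    n * 300 + 6000 * o + 30000 * (2 * r + 5) * (2 * o) ^ 3 + 400 ≤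
      400000000 * (a * b ^ 9 * c ^ 3) := by
  have ho' : o ≤ 6 * (b * c) := by
    have h1 : (r + 1) * (L + 1) ≤ (2 * b) * (2 * c) := Nat.mul_le_mul (by omega) (by omega)
    have h2 : 1 ≤ b * c := Nat.mul_pos hb hc
    have h3 : (2 * b) * (2 * c) = 4 * (b * c) := by ring
    omega
  have h1 : b * c ≤ b ^ 9 * c ^ 3 :=
    Nat.mul_le_mul (Nat.le_self_pow (by norm_num) b) (Nat.le_self_pow (by norm_num) c)
  have h2 : b ^ 9 * c ^ 3 ≤ a * b ^ 9 * c ^ 3 := by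
    rw [mul_assoc]
    exact Nat.le_mul_of_pos_left _ ha
  have h3 : a ≤ a * b ^ 9 * c ^ 3 := by
    rw [mul_assoc]
    exact Nat.le_mul_of_pos_right _ (Nat.mul_pos (Nat.pow_pos hb) (Nat.pow_pos hc))
  have h4 : 30000 * (2 * r + 5) * (2 * o) ^ 3 ≤ 30000 * (7 * b) * (12 * (b * c)) ^ 3 :=
    Nat.mul_le_mul (Nat.mul_le_mul_left _ (by omega)) (Nat.pow_le_pow_left (by omega) 3)
  have h5 : 30000 * (7 * b) * (12 * (b * c)) ^ 3 = 362880000 * (b ^ 4 * c ^ 3) := by ring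
  have h6 : b ^ 4 * c ^ 3 ≤ b ^ 9 * c ^ 3 :=
    Nat.mul_le_mul_right _ (Nat.pow_le_pow_right hb (by norm_num))
  omega

theorem le_timeBound {n r L T : ℕ}
    (hT : T ≤ 400000000 * (max n 1 * max r 1 ^ 9 * max L 1 ^ 3)) :
    (T : ℝ) ≤ 800000000 * timeBound n r L := by
  have hlog : (1 / 2 : ℝ) ≤ Real.log ((max n 1 * max r 1 * max L 1 : ℕ) + 1) := by
    have h1 : 1 ≤ max n 1 * max r 1 * max L 1 := by
      exact Nat.mul_pos (Nat.mul_pos (by simp) (by simp)) (by simp)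
    have h2 : (2 : ℝ) ≤ ((max n 1 * max r 1 * max L 1 : ℕ) : ℝ) + 1 := by
      have : (1 : ℝ) ≤ ((max n 1 * max r 1 * max L 1 : ℕ) : ℝ) := by exact_mod_cast h1
      linarith
    have h3 := Real.log_le_log (by norm_num) h2
    have h4 := Real.log_two_gt_d9
    linarith
  have h5 : (T : ℝ) ≤ 400000000 * ((max n 1 : ℕ) * (max r 1 : ℕ) ^ 9 * (max L 1 : ℕ) ^ 3) := by
    exact_mod_cast hT
  have h6 : (0 : ℝ) ≤ (max n 1 : ℕ) * (max r 1 : ℕ) ^ 9 * (max L 1 : ℕ) ^ 3 := by positivity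
  rw [timeBound]
  nlinarith [mul_le_mul_of_nonneg_left hlog h6]

end Petal

theorem mainTheorem8 :
    ∃ (p : RamProg) (C : ℝ),
      ∀ (n r : ℕ) (H : Subgroup (FreeGroup (Fin n))) (h : FreeGroupBasis (Fin r) H)
        (g : FreeGroup (Fin n)),
        ∃ t out : ℕ,
          p.Computes (encodeInstance h g) t out ∧
          (t : ℝ) ≤ C * timeBound n r (maxLength h g) ∧
          ((equationDegrees h g).Nonempty → IsLeast (equationDegrees h g) out) ∧
          (equationDegrees h g = ∅ → out = 0) := by
  refine ⟨Petal.minDegree, 800000000, fun n r H h g => ?_⟩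
  obtain ⟨t, m, ht, hrun, h0, h1⟩ := Petal.run_minDegree (Petal.isInput_encodeInstance h g)
  have htime := ht.trans (Petal.time_le (le_max_left n 1) (le_max_left r 1)
    (le_max_left (maxLength h g) 1) (le_max_right n 1) (le_max_right r 1)
    (le_max_right (maxLength h g) 1) (Petal.off_le (Petal.petalLen_le h g) (r + 1)))
  refine ⟨t, m 0, ⟨m, hrun, rfl⟩, Petal.le_timeBound htime, ?_⟩
  by_cases hg : Petal.petalLen h g r = 0
  · -- `x` is an equation for `g = 1`
    rw [h0 hg]
    rw [Petal.petalLen_self] at hg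
    subst hg
    have hmem : 1 ∈ equationDegrees h (1 : FreeGroup (Fin n)) := by
      obtain ⟨d, hd, hd1⟩ := exists_mem_equationDegrees_le h (1 : FreeGroup (Fin n))
        (w := [(none, true)]) (by simp) FreeGroup.IsReduced.singleton (by simp [wordValue])
      have hpos := pos_of_mem_equationDegrees h _ hd
      simp only [List.countP_singleton] at hd1
      obtain rfl : d = 1 := by
        simp at hd1
        omega
      exact hd
    exact ⟨fun _ => ⟨hmem, fun d hd => pos_of_mem_equationDegrees h _ hd⟩, fun he => by
      rw [he] at hmem
      exact absurd hmem (Set.notMem_empty _)⟩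
  · obtain ⟨A, hA, hout⟩ := h1 hg
    have hlen : ∀ j ≤ r, 0 < Petal.petalLen h g j := by
      intro j hj
      rcases hj.lt_or_eq with hj | rfl
      · exact Petal.petalLen_pos h g hj
      · omega
    have key : ∀ d, A.Bridge 0 1 d ↔ ∃ w : List (Option (Fin r) × Bool), w ≠ [] ∧
        FreeGroup.IsReduced w ∧ wordValue h g (FreeGroup.mk w) = 1 ∧
        w.countP (fun c => c.1 = none) = d := fun d =>
      (hA.bridge_iff hlen (fun _ _ => rfl)
        (fun j hj p hp => Petal.ofCode_letterCode h g hj hp) d).trans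
        (Petal.exists_words_iff h g d)
    have hb : ∀ d ∈ equationDegrees h g, A.Bridge 0 1 d := fun d hd =>
      (key d).2 (exists_word_of_mem_equationDegrees h g hd)
    rcases hout with ⟨hno, hz⟩ | ⟨hm, hle⟩
    · exact ⟨fun ⟨d, hd⟩ => absurd (hb d hd) (hno d), fun _ => hz⟩
    · obtain ⟨w, w0, w1, w2, w3⟩ := (key _).1 hm
      obtain ⟨d, hd, hdle⟩ := exists_mem_equationDegrees_le h g w0 w1 w2
      obtain rfl : d = m 0 := le_antisymm (w3 ▸ hdle) (hle d (hb d hd))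
      exact ⟨fun _ => ⟨hd, fun d' hd' => hle d' (hb d' hd')⟩, fun he => by
        rw [he] at hd
        exact absurd hd (Set.notMem_empty _)⟩
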